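/- **Setting.** Let $P_0$ be an initial power spectrum, a real function of the modulus of a wave vector, with $P_0(0)=0$, continuous at $0$, and with $P_0(|\vec h|)$ and $P_0(|\vec h|)/h^2$ integrable over $\mathbb R^3$. Let $\bar\rho,\alpha\in\mathbb R$ and $\sigma_p>0$. External labels $r=1,\dots,n$ ($n\ge 1$) carry wave vectors $\vec k_r\in\mathbb R^3$ and real numbers $g_r=g_{qp}(t_r,t_{\rm i})$ (the position-momentum component of the free propagator from the initial time). The initial correlations of particles $i\ne j$ at positions $\vec q_i,\vec q_j$ are $$C_{\delta_i\delta_j}=\int\!\frac{d^3h}{(2\pi)^3}e^{i\vec h\cdot(\vec q_i-\vec q_j)}P_0(h),\quad \vec C_{\delta_ip_j}=-i\alpha\int\!\frac{d^3h}{(2\pi)^3}e^{i\vec h\cdot(\vec q_i-\vec q_j)}\frac{\vec h}{h^2}P_0(h),\quad C_{p_ip_j}=\alpha^2\int\!\frac{d^3h}{(2\pi)^3}e^{i\vec h\cdot(\vec q_i-\vec q_j)}\frac{\vec h\otimes\vec h}{h^4}P_0(h).$$ **The cumulant.** For $\ell$ particles the free generating functional at initial positions $\vec q_j$ and momenta $\vec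 p_j$ is $Z_0^{(\ell)}=\exp\big(i\sum_{j,r}\vec J_{j}(t_r)\cdot(\vec q_j+g_r(\vec p_j-\vec\kappa_j))\big)$, where $\vec\kappa_j$ is the source $\vec K_{p_j}$ at $t_{\rm i}$ (functional derivatives carry a factor $1/i$). The density operator at label $r$ is $\hat\Phi_\rho(r)=\sum_j\exp(-i\vec k_r\cdot\delta/\delta\vec J_{q_j}(t_r))$. Correlation lines are the operators $C_{\delta_i\delta_j}$, $\hat C_{\delta_ip_j}=-i\vec C_{\delta_ip_j}\cdot\delta/\delta\vec K_{p_j}(t_{\rm i})$ and $\hat C_{p_ip_j}=\exp\{-(\delta/\delta\vec K_{p_i}(t_{\rm i}))^\top C_{p_ip_j}\,(\delta/\delta\vec K_{p_j}(t_{\rm i}))\}-1$. $\hat{\mathcal C}^{(\ell)}_{\rm con}$ is $1/\ell!$ times the sum over all connected diagrams on $\ell$ particles (sets of lines, at most one $\hat C_{pp}$-line and one $C_{\delta\delta}$-line per pair, no two $\delta$-ends at the same particle). The $\ell$-particle $n$-point free density cumulant is $$G^{(0,\ell)}_{\rho_1\dots\rho_n}=\bar\rho^{\ell}\int d^{3\ell}q\int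 d^{3\ell}p\;\prod_j\frac{e^{-p_j^2/(2\sigma_p^2)}}{(2\pi\sigma_p^2)^{3/2}}\;\hat{\mathcal C}^{(\ell)}_{\rm con}\,\hat\Phi_\rho(1)\cdots\hat\Phi_\rho(n)\,Z_0^{(\ell)}\Big|_{J=K=0},$$ a distribution in $(\vec k_1,\dots,\vec k_n)$: the integral over positions is taken with a convergence factor $e^{-\varepsilon\sum_j q_j^2}$ and the limit $\varepsilon\to0^+$ is taken after integrating against a Schwartz function. **Claim (general $n$).** For sets of labels put $\vec k_{\{s\}}=\sum_{r\in s}\vec k_r$, $\vec K_{\{s\}}=\sum_{r\in s}g_r\vec k_r$ and $\mathfrak D_{(s_1,s_2)}=\exp\{-\frac{\sigma_p^2}{2}(\vec K_{\{s_1\}}^2+\vec K_{\{s_2\}}^2)\}$. With $P_0$ replaced by $xP_0$ ($\sigma_p$ held fixed), the 2-particle cumulant exists for all sufficiently small real $x$ and, tested against any Schwartz function, equals up to an error $O(x^3)$ as $x\to0$ $$G^{(0,2)}_{\rho_1\dots\rho_n}=\bar\rho^2(2\pi)^3\,\delta\Big(\sum_{j=1}^n\vec k_j\Big)\sum_{m=1}^{\lfloor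 n/2\rfloor}\ \sum_{\{s_1,s_2\}}\Big(\mathcal T^{(2,1)}(s_1;s_2)+\mathcal T^{(2,2)}(s_1;s_2)\Big),$$ the inner sum being over the partitions of the label set into $s_1,s_2$ with $\#s_1=m$, $\#s_2=n-m$ (each unordered grouping counted once). Here, with $P_0$ replaced by $xP_0$ throughout, $$\mathcal T^{(2,1)}(s_1;s_2)=\mathfrak D_{(s_1,s_2)}P_0(|\vec k_{\{s_1\}}|)\Big\{1-\alpha\frac{\vec k_{\{s_1\}}\cdot\vec K_{\{s_2\}}}{\vec k_{\{s_1\}}^2}-\alpha\frac{\vec k_{\{s_2\}}\cdot\vec K_{\{s_1\}}}{\vec k_{\{s_2\}}^2}+\alpha^2\frac{\vec K_{\{s_1\}}\cdot\vec k_{\{s_1\}}}{\vec k_{\{s_1\}}^2}\frac{\vec K_{\{s_2\}}\cdot\vec k_{\{s_2\}}}{\vec k_{\{s_2\}}^2}\Big\},$$ and, with $\vec l=\vec k_{\{s_1\}}-\vec h$, $$\mathcal T^{(2,2)}(s_1;s_2)=\mathfrak D_{(s_1,s_2)}\int\!\frac{d^3h}{(2\pi)^3}P_0(h)P_0(l)\Big\{-\alpha^2\frac{\vec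 K_{\{s_1\}}\cdot\vec h}{h^2}\frac{\vec K_{\{s_2\}}\cdot\vec l}{l^2}-\alpha^2\frac{\vec K_{\{s_1\}}\cdot\vec h}{h^2}\frac{\vec K_{\{s_2\}}\cdot\vec h}{h^2}\Big(1+\alpha\frac{\vec K_{\{s_1\}}\cdot\vec l}{l^2}-\alpha\frac{\vec K_{\{s_2\}}\cdot\vec l}{l^2}-\frac{\alpha^2}{2}\frac{\vec K_{\{s_1\}}\cdot\vec l}{l^2}\frac{\vec K_{\{s_2\}}\cdot\vec l}{l^2}\Big)\Big\}.$$ The $h$-integral converges absolutely for almost every $(\vec k_r)$ with $\sum_r\vec k_r=0$, and the right-hand side converges absolutely against every Schwartz function. **Claim ($n=2$).** For $\vec k_1=\vec k$, $\vec k_2=-\vec k$, $$\mathcal T^{(2,1)}(1;2)=P_0(k)(1+\alpha g_1)(1+\alpha g_2)\,e^{-\frac{\sigma_p^2}{2}k^2(g_1^2+g_2^2)},$$ $$\mathcal T^{(2,2)}(1;2)=e^{-\frac{\sigma_p^2}{2}k^2(g_1^2+g_2^2)}\int\!\frac{d^3h}{(2\pi)^3}P_0(|\vec k-\vec h|)P_0(h)\Big\{\alpha^2g_1g_2\,a^2\Big(1+\alpha(g_1+g_2)b+\frac{\alpha^2}{2}g_1g_2b^2\Big)+\alpha^2g_1g_2\,ab\Big\},$$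 where $a=\vec k\cdot\vec h/h^2$ and $b=\vec k\cdot(\vec k-\vec h)/(\vec k-\vec h)^2$ (the integral converging absolutely for almost every $\vec k$), and hence $G^{(0,2)}_{\rho_1\rho_2}=\bar\rho^2(2\pi)^3\delta(\vec k_1+\vec k_2)\big(\mathcal T^{(2,1)}(1;2)+\mathcal T^{(2,2)}(1;2)\big)$ up to an error $O(x^3)$ in the same sense. -/

import Mathlib

open MeasureTheory Filter Topology Asymptotics
open scoped SchwartzMap

/-- Three-dimensional Euclidean space: positions, momenta and wave vectors. -/
abbrev E3 : Type := EuclideanSpace ℝ (Fin 3)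

noncomputable section

/-! ### Initial two-particle correlations

`P` is the initial power spectrum as a function of the modulus of the wave vector, `α` the conversion
factor between velocity and momentum, `x` the separation `q_i - q_j`. -/

/-- `C_{δ_i δ_j} = ∫ d³h/(2π)³ e^{i h·x} P(h)`. -/
def corrDD (P : ℝ → ℝ) (x : E3) : ℂ :=
  ((2 * Real.pi) ^ 3 : ℂ)⁻¹ * ∫ h : E3, Complex.exp (Complex.I * (inner ℝ h x : ℝ)) * (P ‖h‖ : ℂ)

/-- Component `c` of `C_{δ_i p_j} = -i α ∫ d³h/(2π)³ e^{i h·x} (h/h²) P(h)`. -/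
def corrDP (α : ℝ) (P : ℝ → ℝ) (x : E3) (c : Fin 3) : ℂ :=
  -Complex.I * α * (((2 * Real.pi) ^ 3 : ℂ)⁻¹ *
    ∫ h : E3, Complex.exp (Complex.I * (inner ℝ h x : ℝ)) * ((h c / ‖h‖ ^ 2 * P ‖h‖ : ℝ) : ℂ))

/-- Entry `(c, d)` of `C_{p_i p_j} = α² ∫ d³h/(2π)³ e^{i h·x} (h ⊗ h / h⁴) P(h)`. -/
def corrPP (α : ℝ) (P : ℝ → ℝ) (x : E3) (c d : Fin 3) : ℂ :=
  (α : ℂ) ^ 2 * (((2 * Real.pi) ^ 3 : ℂ)⁻¹ *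
    ∫ h : E3, Complex.exp (Complex.I * (inner ℝ h x : ℝ)) * ((h c * h d / ‖h‖ ^ 4 * P ‖h‖ : ℝ) : ℂ))

/-! ### The free generating functional and the operators acting on it

The sources that are needed are `J`, where `J j r` is the amplitude of the source of the position of
particle `j` at the time `t_r` of the external label `r`, and `κ`, where `κ j` is the amplitude of
the source `K_{p_j}` at the initial time.  As usual for generating functionals with source terms
`e^{i J·x}`, functional derivatives carry a factor `1/i`. -/

/-- Functionals of the sources `(J, κ)` of `ℓ` particles with `n` external labels. -/
abbrev SourceFunctional (ℓ n : ℕ) : Type := (Fin ℓ → Fin n → E3) → (Fin ℓ → E3) → ℂ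

/-- The free generating functional for given initial positions `q` and momenta `p`: the exponential
`exp(i ∑ J·x)` along the free trajectories `q_j + g_r p_j`, where `g r` is the propagator component
`g_qp(t_r, t_i)` and the source `κ` shifts the initial momenta, `p_j ↦ p_j - κ_j`. -/
def freeFunctional {ℓ n : ℕ} (g : Fin n → ℝ) (q p : Fin ℓ → E3) : SourceFunctional ℓ n :=
  fun J κ => Complex.exp (Complex.I *
    ((∑ j, ∑ r, inner ℝ (J j r) (q j + g r • (p j - κ j)) : ℝ) : ℂ))

/-- The collective density operator at the external label `r`: the sum over the particles `j` of the
translations `exp(-i k_r · δ/δJ_{q_j}(t_r)) : J_{q_j}(t_r) ↦ J_{q_j}(t_r) - k_r`. -/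
def densityOp {ℓ n : ℕ} (k : Fin n → E3) (r : Fin n) (F : SourceFunctional ℓ n) :
    SourceFunctional ℓ n :=
  fun J κ => ∑ j, F (J - Pi.single j (Pi.single r (k r))) κ

/-- The component `c` of `δ/δK_{p_j}(t_i)`. -/
def momentumSourceDeriv {ℓ n : ℕ} (j : Fin ℓ) (c : Fin 3) (F : SourceFunctional ℓ n) :
    SourceFunctional ℓ n :=
  fun J κ => -Complex.I * fderiv ℝ (F J) κ (Pi.single j (EuclideanSpace.single c 1))

/-- The exponent `-(δ/δK_{p_i})ᵀ C_{p_i p_j} (δ/δK_{p_j})` of the momentum correlation line. -/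
def momentumExponentOp {ℓ n : ℕ} (α : ℝ) (P : ℝ → ℝ) (q : Fin ℓ → E3) (i j : Fin ℓ)
    (F : SourceFunctional ℓ n) : SourceFunctional ℓ n :=
  fun J κ => -∑ c, ∑ d, corrPP α P (q i - q j) c d *
    momentumSourceDeriv i c (momentumSourceDeriv j d F) J κ

/-! ### Diagrams of initial correlations -/

/-- The three types of correlation lines. -/
inductive LineKind : Type
  | dd
  | dp
  | pp
  deriving DecidableEq

instance : Fintype LineKind where
  elems := {LineKind.dd, LineKind.dp, LineKind.pp}
  complete t := by cases t <;> simp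

/-- A line of a given type between two particles; a `dp` line `(dp, i, j)` has its density end at `i`
and its momentum end at `j`. -/
abbrev CorrLine (ℓ : ℕ) : Type := LineKind × Fin ℓ × Fin ℓ

/-- Lines join different particles, and the symmetric types `dd` and `pp` are listed once per pair. -/
def CorrLine.IsProper {ℓ : ℕ} : CorrLine ℓ → Prop
  | (LineKind.dp, i, j) => i ≠ j
  | (_, i, j) => i < j

/-- The particles at which a line has a density end. -/
def CorrLine.densityEnds {ℓ : ℕ} : CorrLine ℓ → Finset (Fin ℓ)
  | (LineKind.dd, i, j) => {i, j}
  | (LineKind.dp, i, _) => {i}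
  | (LineKind.pp, _, _) => ∅

open Classical in
/-- The connected diagrams on `ℓ` particles: sets of lines such that no two density ends meet at the
same particle and such that the lines connect all particles. -/
def connectedDiagrams (ℓ : ℕ) : Finset (Finset (CorrLine ℓ)) :=
  Finset.univ.filter fun D =>
    (∀ L ∈ D, L.IsProper) ∧
    (∀ L ∈ D, ∀ L' ∈ D, L ≠ L' → Disjoint L.densityEnds L'.densityEnds) ∧
    (SimpleGraph.fromRel fun i j => ∃ t, (t, i, j) ∈ D).Connected

/-- The operator of a line: `C_{δ_i δ_j}`, or `-i C_{δ_i p_j} · δ/δK_{p_j}`, or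
`exp(-(δ/δK_{p_i})ᵀ C_{p_i p_j} (δ/δK_{p_j})) - 1`. -/
def lineOp {ℓ n : ℕ} (α : ℝ) (P : ℝ → ℝ) (q : Fin ℓ → E3) :
    CorrLine ℓ → SourceFunctional ℓ n → SourceFunctional ℓ n
  | (LineKind.dd, i, j), F => fun J κ => corrDD P (q i - q j) * F J κ
  | (LineKind.dp, i, j), F => fun J κ =>
      -Complex.I * ∑ c, corrDP α P (q i - q j) c * momentumSourceDeriv j c F J κ
  | (LineKind.pp, i, j), F => fun J κ =>
      ∑' m : ℕ, ((m + 1).factorial : ℂ)⁻¹ * (momentumExponentOp α P q i j)^[m + 1] F J κ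

/-- The operator `C_con^{(ℓ)}`: `1/ℓ!` times the sum of all connected diagrams, each diagram being the
product of its (commuting) line operators. -/
def connectedOp {ℓ n : ℕ} (α : ℝ) (P : ℝ → ℝ) (q : Fin ℓ → E3) (F : SourceFunctional ℓ n) :
    SourceFunctional ℓ n :=
  fun J κ => (ℓ.factorial : ℂ)⁻¹ *
    ∑ D ∈ connectedDiagrams ℓ, D.toList.foldr (lineOp α P q) F J κ

/-! ### Free density cumulants -/

/-- The Maxwell-Boltzmann distribution with dispersion `σ`. -/
def maxwellBoltzmann (σ : ℝ) (p : E3) : ℝ :=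
  Real.exp (-‖p‖ ^ 2 / (2 * σ ^ 2)) / Real.sqrt ((2 * Real.pi * σ ^ 2) ^ 3)

/-- The `ℓ`-particle `n`-point free density cumulant
`ρ̄^ℓ ∫ dq dp P_MB(p) C_con^{(ℓ)} Φ_ρ(1) ⋯ Φ_ρ(n) Z₀^{(ℓ)}[J, K]` at `J = K = 0`, as a function of the
wave vectors `k`, with a convergence factor `exp(-ε ∑ |q_j|²)` in the integral over all of space. -/
def regularizedCumulant (ℓ : ℕ) {n : ℕ} (ρbar α σ : ℝ) (P : ℝ → ℝ) (g : Fin n → ℝ) (ε : ℝ)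
    (k : Fin n → E3) : ℂ :=
  (ρbar : ℂ) ^ ℓ * ∫ q : Fin ℓ → E3, (Real.exp (-ε * ∑ j, ‖q j‖ ^ 2) : ℂ) *
    ∫ p : Fin ℓ → E3, ((∏ j, maxwellBoltzmann σ (p j) : ℝ) : ℂ) *
      connectedOp α P q ((List.finRange n).foldr (densityOp k) (freeFunctional g q p)) 0 0

/-- `G` is the `ℓ`-particle `n`-point free density cumulant as a distribution in the wave vectors: the
limit, against every Schwartz function, of the regularized cumulants as the convergence factor is
removed (the convention under which `∫ d³q e^{-i k·q} = (2π)³ δ(k)`). -/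
def IsFreeDensityCumulant (ℓ : ℕ) {n : ℕ} (ρbar α σ : ℝ) (P : ℝ → ℝ) (g : Fin n → ℝ)
    (G : 𝓢(Fin n → E3, ℂ) → ℂ) : Prop :=
  ∀ φ : 𝓢(Fin n → E3, ℂ),
    (∀ ε : ℝ, 0 < ε →
      Integrable (fun k : Fin n → E3 => regularizedCumulant ℓ ρbar α σ P g ε k * φ k)) ∧
    Tendsto (fun ε : ℝ => ∫ k : Fin n → E3, regularizedCumulant ℓ ρbar α σ P g ε k * φ k)
      (𝓝[>] 0) (𝓝 (G φ))

/-- The measure `δ(k_0 + ⋯ + k_n) d³k_0 ⋯ d³k_n`. -/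
def diracSum (n : ℕ) : Measure (Fin (n + 1) → E3) :=
  Measure.map (fun k : Fin n → E3 => (Fin.cons (-∑ i, k i) k : Fin (n + 1) → E3)) volume

/-! ### Label groupings and the functions `T^{(2,1)}`, `T^{(2,2)}` -/

/-- `k_{s} = ∑_{r ∈ s} k_r`. -/
def labelSum {n : ℕ} (k : Fin n → E3) (s : Finset (Fin n)) : E3 := ∑ r ∈ s, k r

/-- `K_{s} = ∑_{r ∈ s} g_r k_r`. -/
def weightedLabelSum {n : ℕ} (g : Fin n → ℝ) (k : Fin n → E3) (s : Finset (Fin n)) : E3 :=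
  ∑ r ∈ s, g r • k r

/-- The damping factor of a label grouping `(s₁; s₂)`. -/
def damping {n : ℕ} (σ : ℝ) (g : Fin n → ℝ) (k : Fin n → E3) (s₁ s₂ : Finset (Fin n)) : ℝ :=
  Real.exp (-(σ ^ 2 / 2) * (‖weightedLabelSum g k s₁‖ ^ 2 + ‖weightedLabelSum g k s₂‖ ^ 2))

/-- The function `T^{(2,1)}(s₁; s₂)`. -/
def T21 {n : ℕ} (α σ : ℝ) (P : ℝ → ℝ) (g : Fin n → ℝ) (k : Fin n → E3)
    (s₁ s₂ : Finset (Fin n)) : ℝ :=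
  let k₁ := labelSum k s₁
  let k₂ := labelSum k s₂
  let K₁ := weightedLabelSum g k s₁
  let K₂ := weightedLabelSum g k s₂
  damping σ g k s₁ s₂ * P ‖k₁‖ *
    (1 - α * (inner ℝ k₁ K₂ / ‖k₁‖ ^ 2) - α * (inner ℝ k₂ K₁ / ‖k₂‖ ^ 2)
      + α ^ 2 * (inner ℝ K₁ k₁ / ‖k₁‖ ^ 2) * (inner ℝ K₂ k₂ / ‖k₂‖ ^ 2))

/-- The integrand of `T^{(2,2)}(s₁; s₂)`, as a function of the integration variable `h`. -/
def T22Integrand {n : ℕ} (α : ℝ) (P : ℝ → ℝ) (g : Fin n → ℝ) (k : Fin n → E3)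
    (s₁ s₂ : Finset (Fin n)) (h : E3) : ℝ :=
  let l := labelSum k s₁ - h
  let K₁ := weightedLabelSum g k s₁
  let K₂ := weightedLabelSum g k s₂
  P ‖h‖ * P ‖l‖ *
    (-α ^ 2 * (inner ℝ K₁ h / ‖h‖ ^ 2) * (inner ℝ K₂ l / ‖l‖ ^ 2)
      - α ^ 2 * (inner ℝ K₁ h / ‖h‖ ^ 2) * (inner ℝ K₂ h / ‖h‖ ^ 2) *
        (1 + α * (inner ℝ K₁ l / ‖l‖ ^ 2) - α * (inner ℝ K₂ l / ‖l‖ ^ 2)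
          - α ^ 2 / 2 * (inner ℝ K₁ l / ‖l‖ ^ 2) * (inner ℝ K₂ l / ‖l‖ ^ 2)))

/-- The function `T^{(2,2)}(s₁; s₂)`. -/
def T22 {n : ℕ} (α σ : ℝ) (P : ℝ → ℝ) (g : Fin n → ℝ) (k : Fin n → E3)
    (s₁ s₂ : Finset (Fin n)) : ℝ :=
  damping σ g k s₁ s₂ * (((2 * Real.pi) ^ 3)⁻¹ * ∫ h : E3, T22Integrand α P g k s₁ s₂ h)

/-- The label groupings `(s; sᶜ)` of `n + 1` labels onto two particles with `m ≤ (n + 1)/2` labels in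
`s`, each listed once: for two sets of equal size, `s` is the one that contains the first label. -/
def labelGroupings (n m : ℕ) : Finset (Finset (Fin (n + 1))) :=
  Finset.univ.filter fun s => s.card = m ∧ (2 * m = n + 1 → 0 ∈ s)

/-- The sum of `T^{(2,1)} + T^{(2,2)}` over all label groupings. -/
def groupingSum {n : ℕ} (α σ : ℝ) (P : ℝ → ℝ) (g : Fin (n + 1) → ℝ) (k : Fin (n + 1) → E3) : ℝ :=
  ∑ m ∈ Finset.Icc 1 ((n + 1) / 2), ∑ s ∈ labelGroupings n m,
    (T21 α σ P g k s sᶜ + T22 α σ P g k s sᶜ)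

/-- The damped linear power spectrum. -/
def linearSpectrum (α σ : ℝ) (P : ℝ → ℝ) (g₁ g₂ : ℝ) (k : E3) : ℝ :=
  P ‖k‖ * (1 + α * g₁) * (1 + α * g₂) * Real.exp (-(σ ^ 2 / 2) * ‖k‖ ^ 2 * (g₁ ^ 2 + g₂ ^ 2))

/-- The integrand of the mode-coupling term of the two-point cumulant. -/
def modeCouplingIntegrand (α : ℝ) (P : ℝ → ℝ) (g₁ g₂ : ℝ) (k h : E3) : ℝ :=
  let a := inner ℝ k h / ‖h‖ ^ 2
  let b := inner ℝ k (k - h) / ‖k - h‖ ^ 2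
  P ‖k - h‖ * P ‖h‖ *
    (α ^ 2 * g₁ * g₂ * a ^ 2 * (1 + α * (g₁ + g₂) * b + α ^ 2 / 2 * g₁ * g₂ * b ^ 2)
      + α ^ 2 * g₁ * g₂ * a * b)

/-- The mode-coupling term of the two-point cumulant. -/
def modeCoupling (α σ : ℝ) (P : ℝ → ℝ) (g₁ g₂ : ℝ) (k : E3) : ℝ :=
  Real.exp (-(σ ^ 2 / 2) * ‖k‖ ^ 2 * (g₁ ^ 2 + g₂ ^ 2)) *
    (((2 * Real.pi) ^ 3)⁻¹ * ∫ h : E3, modeCouplingIntegrand α P g₁ g₂ k h)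

end

/-! After the density operators have acted, the free functional of two particles is a finite sum
over label sets `s`: the labels in `s` sit on the first particle, the others on the second. Each
summand is a plane wave in the momentum sources, on which every correlation line acts as a scalar
(`lineOp_planeWaves`). The connected diagrams thus collapse to `(1 + dp + pd + pd·dp + dd) e^{pp} -
1` (`sum_connectedDiagrams_two`). The Gaussian integral over the momenta produces the damping
factor, and exchanging the particles identifies `s` with `sᶜ`, which cancels `1/2!`.

Expanding the exponential gives words in the four factors `dd`, `dp`, `pd`, `pp`. Each factor is a
Fourier integral whose density is dominated by `|P| + |P|/h²`, so the regularized position integral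
of a word of length `j` is an integral over `y ∈ (ℝ³)^j` against two heat kernels, at `k_s - Σy` and
at `k_{sᶜ} + Σy` (`wordTerm_eq`). They approximate delta functions as `ε → 0`. If `s` and `sᶜ` are
both nonempty, taking label `0` in `s` and a label `r.succ` outside makes the two arguments
independent coordinates of `k`. Integrating these first gives bounds uniform in `ε` and the limit
(`norm_mollified_kernel_le`, `tendsto_mollified_kernel`), and a shear rewrites the limit as an
integral over wave vectors with vanishing sum (`integrable_kernel_diracSum`).

A word with `m` trailing `pp` factors grows like `(‖K‖‖L‖)^m`. The damping turns this into `m!`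
(`damped_growth_le`), which the coefficient `1/m!` of the exponential cancels. For small amplitude
`x` the expansion is therefore dominated by a geometric series uniformly in `ε`: the limit may be
taken termwise and everything beyond `x²` is `O(x³)` (`tendsto_integral_groupingTerm`,
`norm_series_sub_le`). Words of length one give `T21`; those of length two give `T22`.

If all labels sit on one particle, the second heat kernel constrains only `h` and concentrates it at
the origin. The `dd` term then vanishes in the limit because `P 0 = 0`; the singular `pd` term is
odd in `h` up to a bounded correction and vanishes for the same reason
(`tendsto_integral_groupingTerm_univ`). It remains to match two enumerations of the groupings, using
that `T21` and `T22` are symmetric under exchange on wave vectors with zero sum, and to specialize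
to two labels. -/

noncomputable section

/-! ### Superpositions of plane waves in the momentum sources -/

/-- Superpositions of plane waves in the momentum sources `κ`, with coefficients `c i J` and wave
vectors `B i J j` that may depend on the sources `J`. -/
def planeWaves {ι : Type*} [Fintype ι] {ℓ n : ℕ} (c : ι → (Fin ℓ → Fin n → E3) → ℂ)
    (B : ι → (Fin ℓ → Fin n → E3) → Fin ℓ → E3) : SourceFunctional ℓ n :=
  fun J κ => ∑ i, c i J * Complex.exp (Complex.I * ((∑ j, inner ℝ (B i J j) (κ j) : ℝ) : ℂ))

section PlaneWaves

variable {ι : Type*} [Fintype ι] {ℓ n : ℕ} (c : ι → (Fin ℓ → Fin n → E3) → ℂ)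
  (B : ι → (Fin ℓ → Fin n → E3) → Fin ℓ → E3)

/-- The factor `-I` of the functional derivative cancels the `I` of the exponent, so what remains is
multiplication by a component of the wave vector. All line operators are built from these
derivatives and are therefore diagonal on plane waves. -/
theorem momentumSourceDeriv_planeWaves (j : Fin ℓ) (a : Fin 3) :
    momentumSourceDeriv j a (planeWaves c B) =
      planeWaves (fun i J => c i J * (B i J j a : ℂ)) B := by
  funext J κ
  have hd : ∀ i, HasFDerivAt (fun κ : Fin ℓ → E3 => c i J * Complex.exp (Complex.I *
      ((∑ j, inner ℝ (B i J j) (κ j) : ℝ) : ℂ)))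
      (c i J • (Complex.exp (Complex.I * ((∑ j, inner ℝ (B i J j) (κ j) : ℝ) : ℂ)) •
        (Complex.I • Complex.ofRealCLM.comp
          (∑ j, (innerSL ℝ (B i J j)).comp (ContinuousLinearMap.proj (R := ℝ) j :
            (Fin ℓ → E3) →L[ℝ] E3))))) κ := by
    intro i
    refine HasFDerivAt.const_mul (HasFDerivAt.cexp (HasFDerivAt.const_mul ?_ _)) _
    have h := (Complex.ofRealCLM.comp (∑ j, (innerSL ℝ (B i J j)).comp
      (ContinuousLinearMap.proj (R := ℝ) j : (Fin ℓ → E3) →L[ℝ] E3))).hasFDerivAt (x := κ)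
    exact h.congr_of_eventuallyEq (Eventually.of_forall fun κ => by simp)
  have hs := HasFDerivAt.fun_sum (u := Finset.univ) (fun i _ => hd i)
  have he : planeWaves c B J = fun κ : Fin ℓ → E3 => ∑ i, c i J * Complex.exp (Complex.I *
      ((∑ j, inner ℝ (B i J j) (κ j) : ℝ) : ℂ)) := rfl
  have hsum : ∀ i, ∑ x, inner ℝ (B i J x)
      ((Pi.single j (EuclideanSpace.single a (1 : ℝ)) : Fin ℓ → E3) x) = B i J j a := by
    intro i
    rw [Finset.sum_eq_single j]
    · simp [EuclideanSpace.inner_single_right]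
    · intro b _ hb
      simp [Pi.single_eq_of_ne hb]
    · simp
  simp only [momentumSourceDeriv, he, hs.fderiv, planeWaves]
  rw [_root_.sum_apply, Finset.mul_sum]
  refine Finset.sum_congr rfl fun i _ => ?_
  simp only [_root_.smul_apply, ContinuousLinearMap.comp_apply,
    _root_.sum_apply, ContinuousLinearMap.proj_apply, innerSL_apply_apply, hsum,
    Complex.ofRealCLM_apply, smul_eq_mul]
  linear_combination (-c i J * B i J j a * Complex.exp (Complex.I *
      ((∑ j, inner ℝ (B i J j) (κ j) : ℝ) : ℂ))) * Complex.I_mul_I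

/-- The exponent of the momentum correlation line on a plane wave. -/
def momentumExponent (α : ℝ) (P : ℝ → ℝ) (x K L : E3) : ℂ :=
  -∑ c, ∑ d, corrPP α P x c d * ((K c : ℂ) * (L d : ℂ))

theorem momentumExponentOp_planeWaves (α : ℝ) (P : ℝ → ℝ) (q : Fin ℓ → E3) (i j : Fin ℓ) :
    momentumExponentOp α P q i j (planeWaves c B) =
      planeWaves (fun a J => c a J * momentumExponent α P (q i - q j) (B a J i) (B a J j)) B := by
  funext J κ
  simp only [momentumExponentOp, momentumSourceDeriv_planeWaves, planeWaves, momentumExponent]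
  simp only [Finset.mul_sum, Finset.sum_mul, ← Finset.sum_neg_distrib]
  simp_rw [Finset.sum_comm (s := (Finset.univ : Finset (Fin 3)))
    (t := (Finset.univ : Finset ι))]
  refine Finset.sum_congr rfl fun a _ => ?_
  refine Finset.sum_congr rfl fun x _ => Finset.sum_congr rfl fun y _ => ?_
  ring

theorem iterate_momentumExponentOp_planeWaves (α : ℝ) (P : ℝ → ℝ) (q : Fin ℓ → E3) (i j : Fin ℓ)
    (m : ℕ) :
    (momentumExponentOp α P q i j)^[m] (planeWaves c B) =
      planeWaves (fun a J => c a J *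
        momentumExponent α P (q i - q j) (B a J i) (B a J j) ^ m) B := by
  induction m with
  | zero => simp
  | succ m ih =>
    rw [Function.iterate_succ_apply', ih, momentumExponentOp_planeWaves]
    simp only [pow_succ, mul_assoc]

/-- The eigenvalue of a correlation line on a plane wave with wave vectors `b`. -/
def lineValue (α : ℝ) (P : ℝ → ℝ) (q : Fin ℓ → E3) (b : Fin ℓ → E3) : CorrLine ℓ → ℂ
  | (LineKind.dd, i, j) => corrDD P (q i - q j)
  | (LineKind.dp, i, j) => -Complex.I * ∑ c, corrDP α P (q i - q j) c * (b j c : ℂ)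
  | (LineKind.pp, i, j) => Complex.exp (momentumExponent α P (q i - q j) (b i) (b j)) - 1

theorem hasSum_exp_sub_one (z : ℂ) :
    HasSum (fun m : ℕ => ((m + 1).factorial : ℂ)⁻¹ * z ^ (m + 1)) (Complex.exp z - 1) := by
  have h := NormedSpace.exp_series_hasSum_exp' (𝕂 := ℂ) z
  rw [← Complex.exp_eq_exp_ℂ, ← hasSum_nat_add_iff' 1] at h
  simpa [smul_eq_mul] using h

/-- Iterates of the exponent operator are powers of its eigenvalue, so the series defining a `pp`
line is an exponential series without its constant term and converges without any smallness
condition. -/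
theorem lineOp_planeWaves (α : ℝ) (P : ℝ → ℝ) (q : Fin ℓ → E3) (L : CorrLine ℓ) :
    lineOp α P q L (planeWaves c B) =
      planeWaves (fun a J => lineValue α P q (B a J) L * c a J) B := by
  obtain ⟨t, i, j⟩ := L
  funext J κ
  cases t with
  | dd => simp only [lineOp, lineValue, planeWaves, Finset.mul_sum, mul_assoc]
  | dp =>
    simp only [lineOp, lineValue, momentumSourceDeriv_planeWaves, planeWaves, Finset.mul_sum,
      Finset.sum_mul]
    rw [Finset.sum_comm]
    refine Finset.sum_congr rfl fun a _ => Finset.sum_congr rfl fun x _ => ?_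
    ring
  | pp =>
    simp only [lineOp, lineValue, iterate_momentumExponentOp_planeWaves, planeWaves]
    refine HasSum.tsum_eq ?_
    simp only [Finset.mul_sum]
    refine hasSum_sum fun a _ => ?_
    have h := (hasSum_exp_sub_one
      (momentumExponent α P (q i - q j) (B a J i) (B a J j))).mul_right (c a J *
      Complex.exp (Complex.I * ((∑ j, inner ℝ (B a J j) (κ j) : ℝ) : ℂ)))
    rw [mul_assoc]
    refine h.congr_fun fun m => ?_
    ring

theorem foldr_lineOp_planeWaves (α : ℝ) (P : ℝ → ℝ) (q : Fin ℓ → E3) (D : List (CorrLine ℓ)) :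
    D.foldr (lineOp α P q) (planeWaves c B) =
      planeWaves (fun a J => (D.map (lineValue α P q (B a J))).prod * c a J) B := by
  induction D with
  | nil => simp
  | cons L D ih =>
    rw [List.foldr_cons, ih, lineOp_planeWaves]
    simp only [List.map_cons, List.prod_cons, mul_assoc]

theorem connectedOp_planeWaves (α : ℝ) (P : ℝ → ℝ) (q : Fin ℓ → E3)
    (J : Fin ℓ → Fin n → E3) (κ : Fin ℓ → E3) :
    connectedOp α P q (planeWaves c B) J κ = (ℓ.factorial : ℂ)⁻¹ * ∑ a,
      (∑ D ∈ connectedDiagrams ℓ, ∏ L ∈ D, lineValue α P q (B a J) L) * (c a J *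
        Complex.exp (Complex.I * ((∑ j, inner ℝ (B a J j) (κ j) : ℝ) : ℂ))) := by
  simp only [connectedOp, foldr_lineOp_planeWaves, planeWaves, Finset.prod_map_toList,
    Finset.sum_mul]
  rw [Finset.sum_comm]
  simp only [mul_assoc]

end PlaneWaves

/-! ### Density operators on the free generating functional -/

/-- Shifting the source at one label multiplies the exponential by a phase that does not involve
`J`. The phases of different labels therefore do not interact, and the fold becomes a product. -/
theorem foldr_densityOp_freeFunctional {ℓ n : ℕ} (g : Fin n → ℝ) (q p : Fin ℓ → E3)
    (k : Fin n → E3) (l : List (Fin n)) (J : Fin ℓ → Fin n → E3) (κ : Fin ℓ → E3) :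
    l.foldr (densityOp k) (freeFunctional g q p) J κ = freeFunctional g q p J κ *
      (l.map fun r => ∑ j, Complex.exp (-Complex.I *
        ((inner ℝ (k r) (q j + g r • (p j - κ j)) : ℝ) : ℂ))).prod := by
  induction l generalizing J with
  | nil => simp
  | cons r l ih =>
    rw [List.foldr_cons, densityOp]
    simp only [ih, List.map_cons, List.prod_cons, ← Finset.sum_mul]
    rw [← mul_assoc, Finset.mul_sum]
    congr 1
    refine Finset.sum_congr rfl fun j _ => ?_
    rw [freeFunctional, freeFunctional, ← Complex.exp_add]
    congr 1
    have : ∑ j', ∑ r', inner ℝ ((J - Pi.single j (Pi.single r (k r)) : Fin ℓ → Fin n → E3) j' r')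
        (q j' + g r' • (p j' - κ j')) = (∑ j', ∑ r', inner ℝ (J j' r')
        (q j' + g r' • (p j' - κ j'))) - inner ℝ (k r) (q j + g r • (p j - κ j)) := by
      simp only [Pi.sub_apply, inner_sub_left, Finset.sum_sub_distrib]
      congr 1
      rw [Finset.sum_eq_single j, Finset.sum_eq_single r]
      · simp
      · intro b _ hb; simp [Pi.single_eq_of_ne hb]
      · simp
      · intro b _ hb; simp [Pi.single_eq_of_ne hb]
      · simp
    rw [this]
    push_cast
    ring

/-- The phase of the particles at positions `q` with momenta `p` when the labels in `s` are attached
to the first and the others to the second particle. -/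
def groupingPhase {n : ℕ} (g : Fin n → ℝ) (k : Fin n → E3) (q p : Fin 2 → E3)
    (s : Finset (Fin n)) : ℝ :=
  (inner ℝ (labelSum k s) (q 0) + inner ℝ (labelSum k sᶜ) (q 1)) +
    (inner ℝ (weightedLabelSum g k s) (p 0) + inner ℝ (weightedLabelSum g k sᶜ) (p 1))

/-- The label sums enter the wave vectors with a plus sign because the minus sign of the density
phase meets the one in `p_j - κ_j`. -/
theorem foldr_densityOp_eq_planeWaves {n : ℕ} (g : Fin n → ℝ) (q p : Fin 2 → E3)
    (k : Fin n → E3) :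
    (List.finRange n).foldr (densityOp k) (freeFunctional g q p) =
      planeWaves (fun (s : Finset (Fin n)) J => Complex.exp (Complex.I *
          ((∑ j, ∑ r, inner ℝ (J j r) (q j + g r • p j) - groupingPhase g k q p s : ℝ) : ℂ)))
        (fun s J => ![weightedLabelSum g k s, weightedLabelSum g k sᶜ] -
          fun j => ∑ r, g r • J j r) := by
  funext J κ
  rw [foldr_densityOp_freeFunctional]
  rw [← List.ofFn_eq_map, List.prod_ofFn]
  simp only [Fin.sum_univ_two]
  -- Multiplying out a product over labels of two-term sums gives one term for each set of labels
  -- carried by the first particle.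
  rw [Fintype.prod_add, Finset.mul_sum, planeWaves]
  refine Finset.sum_congr rfl fun s _ => ?_
  rw [← Complex.exp_sum, ← Complex.exp_sum, freeFunctional, ← Complex.exp_add, ← Complex.exp_add,
    ← Complex.exp_add]
  congr 1
  simp only [← Finset.mul_sum, ← Complex.ofReal_sum]
  have h1 : ∀ (t : Finset (Fin n)) (j : Fin 2), ∑ r ∈ t, inner ℝ (k r) (q j + g r • (p j - κ j)) =
      inner ℝ (labelSum k t) (q j) + inner ℝ (weightedLabelSum g k t) (p j) -
        inner ℝ (weightedLabelSum g k t) (κ j) := by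
    intro t j
    simp only [labelSum, weightedLabelSum, sum_inner, ← Finset.sum_add_distrib,
      ← Finset.sum_sub_distrib]
    refine Finset.sum_congr rfl fun r _ => ?_
    simp only [inner_add_right, inner_smul_right, inner_smul_left, inner_sub_right,
      RCLike.conj_to_real]
    ring
  have h2 : ∀ j, ∑ r, inner ℝ (J j r) (q j + g r • (p j - κ j)) =
      ∑ r, inner ℝ (J j r) (q j + g r • p j) - inner ℝ (∑ r, g r • J j r) (κ j) := by
    intro j
    rw [sum_inner, ← Finset.sum_sub_distrib]
    refine Finset.sum_congr rfl fun r _ => ?_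
    simp only [inner_add_right, inner_smul_right, inner_smul_left, inner_sub_right,
      RCLike.conj_to_real]
    ring
  simp only [h1, h2, groupingPhase, Fin.sum_univ_two, Pi.sub_apply, Matrix.cons_val_zero,
    Matrix.cons_val_one, inner_sub_left]
  push_cast
  ring

/-! ### The connected two-particle diagrams -/

/-- The sum of the connected two-particle diagrams on a plane wave with wave vectors `K`, `L` at
separation `x`. -/
def pairSum (α : ℝ) (P : ℝ → ℝ) (x K L : E3) : ℂ :=
  (1 + (-Complex.I * ∑ c, corrDP α P x c * (L c : ℂ)) +
    (-Complex.I * ∑ c, corrDP α P (-x) c * (K c : ℂ)) +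
    (-Complex.I * ∑ c, corrDP α P (-x) c * (K c : ℂ)) *
      (-Complex.I * ∑ c, corrDP α P x c * (L c : ℂ)) +
    corrDD P x) * Complex.exp (momentumExponent α P x K L) - 1

/-- The four lines between two particles. -/
def pairLines : Finset (CorrLine 2) :=
  {(LineKind.dd, 0, 1), (LineKind.dp, 0, 1), (LineKind.dp, 1, 0), (LineKind.pp, 0, 1)}

theorem CorrLine.isProper_iff_mem_pairLines (L : CorrLine 2) : L.IsProper ↔ L ∈ pairLines := by
  obtain ⟨t, i, j⟩ := L
  cases t <;> fin_cases i <;> fin_cases j <;>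
    simp [CorrLine.IsProper, pairLines]

/-- On two vertices a single line already connects, so connectivity reduces to non-emptiness, and
the diagrams can be enumerated by computation. -/
theorem connectedDiagrams_two : connectedDiagrams 2 = pairLines.powerset.filter fun D : Finset (CorrLine 2) =>
    D.Nonempty ∧ ∀ L ∈ D, ∀ L' ∈ D, L ≠ L' → Disjoint L.densityEnds L'.densityEnds := by
  ext D
  simp only [connectedDiagrams, Finset.mem_filter, Finset.mem_univ, true_and, Finset.mem_powerset]
  constructor
  · rintro ⟨h1, h2, h3⟩
    refine ⟨fun L hL => (CorrLine.isProper_iff_mem_pairLines L).1 (h1 L hL), ?_, h2⟩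
    rw [Finset.nonempty_iff_ne_empty]
    rintro rfl
    obtain ⟨w, hw⟩ := h3.preconnected.exists_adj_of_nontrivial (0 : Fin 2)
    simp at hw
  · rintro ⟨h1, h2, h3⟩
    have h1' : ∀ L ∈ D, L.IsProper := fun L hL =>
      (CorrLine.isProper_iff_mem_pairLines L).2 (h1 hL)
    refine ⟨h1', h3, ?_⟩
    obtain ⟨⟨t, i, j⟩, hL⟩ := h2
    have hij : i ≠ j := by
      have := h1' _ hL
      cases t
      · exact ne_of_lt this
      · exact this
      · exact ne_of_lt this
    have hadj : (SimpleGraph.fromRel fun i j => ∃ t, (t, i, j) ∈ D).Adj i j :=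
      ⟨hij, Or.inl ⟨t, hL⟩⟩
    refine (SimpleGraph.connected_iff_exists_forall_reachable _).2 ⟨i, fun w => ?_⟩
    by_cases hw : w = i
    · rw [hw]
    · have : w = j := by omega
      rw [this]; exact hadj.reachable

/-- A `dd` line occupies both density ends and excludes the `dp` lines, the two opposite `dp` lines
are compatible, and a `pp` line can always be added. The subtracted `1` is the empty diagram. -/
theorem sum_connectedDiagrams_two (v : CorrLine 2 → ℂ) :
    ∑ D ∈ connectedDiagrams 2, ∏ L ∈ D, v L =
      (1 + v (LineKind.dp, 0, 1) + v (LineKind.dp, 1, 0) +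
        v (LineKind.dp, 1, 0) * v (LineKind.dp, 0, 1) + v (LineKind.dd, 0, 1)) *
        (v (LineKind.pp, 0, 1) + 1) - 1 := by
  rw [connectedDiagrams_two]
  have : (pairLines.powerset.filter fun D : Finset (CorrLine 2) =>
    D.Nonempty ∧ ∀ L ∈ D, ∀ L' ∈ D, L ≠ L' → Disjoint L.densityEnds L'.densityEnds) =
    {{(LineKind.dd, 0, 1)}, {(LineKind.dp, 0, 1)}, {(LineKind.dp, 1, 0)},
      {(LineKind.dp, 1, 0), (LineKind.dp, 0, 1)}, {(LineKind.pp, 0, 1)},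
      {(LineKind.dd, 0, 1), (LineKind.pp, 0, 1)}, {(LineKind.dp, 0, 1), (LineKind.pp, 0, 1)},
      {(LineKind.dp, 1, 0), (LineKind.pp, 0, 1)},
      {(LineKind.dp, 1, 0), (LineKind.dp, 0, 1), (LineKind.pp, 0, 1)}} := by
    decide
  rw [this]
  repeat rw [Finset.sum_insert (by decide)]
  rw [Finset.sum_singleton]
  repeat rw [Finset.prod_insert (by decide)]
  simp only [Finset.prod_singleton]
  ring

theorem connectedOp_foldr_densityOp {n : ℕ} (α : ℝ) (P : ℝ → ℝ) (g : Fin n → ℝ)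
    (q p : Fin 2 → E3) (k : Fin n → E3) :
    connectedOp α P q ((List.finRange n).foldr (densityOp k) (freeFunctional g q p)) 0 0 =
      (2 : ℂ)⁻¹ * ∑ s : Finset (Fin n), pairSum α P (q 0 - q 1) (weightedLabelSum g k s)
        (weightedLabelSum g k sᶜ) *
          Complex.exp (-Complex.I * (groupingPhase g k q p s : ℂ)) := by
  rw [foldr_densityOp_eq_planeWaves, connectedOp_planeWaves]
  simp only [sum_connectedDiagrams_two, lineValue, pairSum]
  simp

/-! ### Correlation lines as Fourier integrals -/

/-- The factors of the connected two-particle diagrams: `dd`, `dp`, `pd` (with its momentum end at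
the first particle) and the exponent of the `pp` line. -/
inductive CorrFactor : Type
  | dd
  | dp
  | pd
  | pp
  deriving DecidableEq

/-- The Fourier density of a factor, up to `(2π)³`, when `K`, `L` are the momentum wave vectors of
the two particles. -/
def factorWeight (α : ℝ) (P : ℝ → ℝ) (K L : E3) : CorrFactor → E3 → ℝ
  | CorrFactor.dd, h => P ‖h‖
  | CorrFactor.dp, h => -α * (inner ℝ L h / ‖h‖ ^ 2) * P ‖h‖
  | CorrFactor.pd, h => α * (inner ℝ K h / ‖h‖ ^ 2) * P ‖h‖
  | CorrFactor.pp, h => -α ^ 2 * ((inner ℝ K h / ‖h‖ ^ 2) * (inner ℝ L h / ‖h‖ ^ 2)) * P ‖h‖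

/-- The factor as a function of the separation `x`. -/
def factorValue (α : ℝ) (P : ℝ → ℝ) (K L : E3) (a : CorrFactor) (x : E3) : ℂ :=
  ((2 * Real.pi) ^ 3 : ℂ)⁻¹ * ∫ h : E3, Complex.exp (Complex.I * (inner ℝ h x : ℝ)) *
    (factorWeight α P K L a h : ℂ)

/-- A majorant of the Fourier densities of all factors. -/
def spectralMajorant (P : ℝ → ℝ) (h : E3) : ℝ := |P ‖h‖| + |P ‖h‖ / ‖h‖ ^ 2|

/-- The dependence of the size of a factor on the momentum wave vectors. -/
def factorGrowth (K L : E3) : CorrFactor → ℝ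
  | CorrFactor.dd => 1
  | CorrFactor.dp => ‖L‖
  | CorrFactor.pd => ‖K‖
  | CorrFactor.pp => ‖K‖ * ‖L‖

theorem factorGrowth_nonneg (K L : E3) (a : CorrFactor) : 0 ≤ factorGrowth K L a := by
  cases a <;> simp only [factorGrowth] <;> positivity

theorem spectralMajorant_nonneg (P : ℝ → ℝ) (h : E3) : 0 ≤ spectralMajorant P h := by
  unfold spectralMajorant; positivity

theorem integrable_spectralMajorant {P : ℝ → ℝ} (h0 : Integrable (fun h : E3 => P ‖h‖))
    (h2 : Integrable (fun h : E3 => P ‖h‖ / ‖h‖ ^ 2)) : Integrable (spectralMajorant P) :=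
  h0.abs.add h2.abs

theorem spectralMajorant_eq (P : ℝ → ℝ) (h : E3) :
    spectralMajorant P h = |P ‖h‖| * (1 + (‖h‖ ^ 2)⁻¹) := by
  rw [spectralMajorant, abs_div, abs_of_nonneg (sq_nonneg ‖h‖)]; ring

theorem abs_inner_div_sq_le (K h : E3) : |inner ℝ K h / ‖h‖ ^ 2| ≤ ‖K‖ * ‖h‖⁻¹ := by
  rw [abs_div, abs_of_nonneg (sq_nonneg ‖h‖)]
  rcases eq_or_ne h 0 with rfl | hh
  · simp
  have : 0 < ‖h‖ := norm_pos_iff.2 hh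
  rw [div_le_iff₀ (by positivity)]
  calc |inner ℝ K h| ≤ ‖K‖ * ‖h‖ := abs_real_inner_le_norm K h
    _ = _ := by field_simp

theorem inv_le_one_add_inv_sq (t : ℝ) : t⁻¹ ≤ 1 + (t ^ 2)⁻¹ := by
  rw [← inv_pow]
  nlinarith [sq_nonneg (t⁻¹ - 1), sq_nonneg t⁻¹]

/-- Each momentum end costs one power of `‖h‖⁻¹`. The worst case `‖h‖⁻²` is that of `pp`, and a
single inverse power is at most `1 + ‖h‖⁻²`; hence the two integrability assumptions on the spectrum
control all factors. -/
theorem abs_factorWeight_le (α : ℝ) (P : ℝ → ℝ) (K L : E3) (a : CorrFactor) (h : E3) :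
    |factorWeight α P K L a h| ≤ (1 + α ^ 2) * factorGrowth K L a * spectralMajorant P h := by
  rw [spectralMajorant_eq]
  have hα : |α| ≤ 1 + α ^ 2 := by rw [← sq_abs]; nlinarith [sq_nonneg (|α| - 1), abs_nonneg α]
  have hi := inv_le_one_add_inv_sq ‖h‖
  have hp := abs_nonneg (P ‖h‖)
  have hn : (0 : ℝ) ≤ ‖h‖⁻¹ := by positivity
  cases a with
  | dd =>
    simp only [factorWeight, factorGrowth]
    have h1 : (0 : ℝ) ≤ (‖h‖ ^ 2)⁻¹ := by positivity
    nlinarith [mul_nonneg hp h1, mul_nonneg (sq_nonneg α) (mul_nonneg hp h1),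
      mul_nonneg (sq_nonneg α) hp]
  | dp =>
    simp only [factorWeight, factorGrowth, abs_mul, abs_neg]
    calc |α| * |inner ℝ L h / ‖h‖ ^ 2| * |P ‖h‖|
        ≤ (1 + α ^ 2) * (‖L‖ * (1 + (‖h‖ ^ 2)⁻¹)) * |P ‖h‖| := by
          gcongr
          exact (abs_inner_div_sq_le L h).trans (by gcongr)
      _ = _ := by ring
  | pd =>
    simp only [factorWeight, factorGrowth, abs_mul]
    calc |α| * |inner ℝ K h / ‖h‖ ^ 2| * |P ‖h‖|
        ≤ (1 + α ^ 2) * (‖K‖ * (1 + (‖h‖ ^ 2)⁻¹)) * |P ‖h‖| := by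
          gcongr
          exact (abs_inner_div_sq_le K h).trans (by gcongr)
      _ = _ := by ring
  | pp =>
    simp only [factorWeight, factorGrowth, abs_mul, abs_neg, abs_pow, sq_abs]
    calc α ^ 2 * (|inner ℝ K h / ‖h‖ ^ 2| * |inner ℝ L h / ‖h‖ ^ 2|) * |P ‖h‖|
        ≤ (1 + α ^ 2) * (‖K‖ * ‖h‖⁻¹ * (‖L‖ * ‖h‖⁻¹)) * |P ‖h‖| := by
          gcongr
          · linarith
          · exact abs_inner_div_sq_le K h
          · exact abs_inner_div_sq_le L h
      _ = (1 + α ^ 2) * (‖K‖ * ‖L‖) * (|P ‖h‖| * (‖h‖ ^ 2)⁻¹) := by rw [← inv_pow]; ring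
      _ ≤ _ := by
          gcongr
          linarith

theorem aestronglyMeasurable_factorWeight {P : ℝ → ℝ} (α : ℝ)
    (h0 : Integrable (fun h : E3 => P ‖h‖)) (K L : E3) (a : CorrFactor) :
    AEStronglyMeasurable (factorWeight α P K L a) := by
  have hm : ∀ K : E3, Measurable fun h : E3 => inner ℝ K h / ‖h‖ ^ 2 := fun K => by fun_prop
  cases a with
  | dd => exact h0.aestronglyMeasurable
  | dp => exact (((hm L).const_mul (-α)).aestronglyMeasurable).mul h0.aestronglyMeasurable
  | pd => exact (((hm K).const_mul α).aestronglyMeasurable).mul h0.aestronglyMeasurable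
  | pp => 
    exact (((((hm K).mul (hm L)).const_mul (-α ^ 2) :
      Measurable fun h => -α ^ 2 * ((inner ℝ K h / ‖h‖ ^ 2) * (inner ℝ L h / ‖h‖ ^ 2))))
      |>.aestronglyMeasurable).mul h0.aestronglyMeasurable

section

variable {P : ℝ → ℝ} (h0 : Integrable (fun h : E3 => P ‖h‖))
  (h2 : Integrable (fun h : E3 => P ‖h‖ / ‖h‖ ^ 2))

include h0 h2

theorem integrable_factorWeight (α : ℝ) (K L : E3) (a : CorrFactor) :
    Integrable (factorWeight α P K L a) :=
  Integrable.mono' ((integrable_spectralMajorant h0 h2).const_mul _)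
    (aestronglyMeasurable_factorWeight α h0 K L a)
    (Eventually.of_forall fun h => abs_factorWeight_le α P K L a h)

end

theorem norm_exp_I_mul (t : ℝ) : ‖Complex.exp (Complex.I * (t : ℂ))‖ = 1 := by
  rw [mul_comm]; exact Complex.norm_exp_ofReal_mul_I t

theorem norm_exp_neg_I_mul (t : ℝ) : ‖Complex.exp (-Complex.I * (t : ℂ))‖ = 1 := by
  rw [neg_mul, ← mul_neg, ← Complex.ofReal_neg, norm_exp_I_mul]

theorem Integrable.exp_inner_mul {f : E3 → ℂ} (hf : Integrable f) (x : E3) :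
    Integrable fun h : E3 => Complex.exp (Complex.I * (inner ℝ h x : ℝ)) * f h := by
  refine hf.bdd_mul (c := 1) (Continuous.aestronglyMeasurable (by fun_prop)) ?_
  exact Eventually.of_forall fun h => (norm_exp_I_mul _).le

theorem continuous_factorValue {P : ℝ → ℝ} (h0 : Integrable (fun h : E3 => P ‖h‖))
    (h2 : Integrable (fun h : E3 => P ‖h‖ / ‖h‖ ^ 2)) (α : ℝ) (K L : E3) (a : CorrFactor) :
    Continuous (factorValue α P K L a) := by
  have hf := (integrable_factorWeight h0 h2 α K L a).ofReal (𝕜 := ℂ)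
  refine Continuous.mul continuous_const ?_
  refine continuous_of_dominated (bound := fun h => ‖((factorWeight α P K L a h : ℝ) : ℂ)‖)
    (fun x => (Integrable.exp_inner_mul hf x).aestronglyMeasurable) ?_ hf.norm ?_
  · intro x
    refine Eventually.of_forall fun h => ?_
    rw [norm_mul, norm_exp_I_mul, one_mul]
  · exact Eventually.of_forall fun h => by fun_prop

theorem inner_eq_sum_coord (K h : E3) : inner ℝ K h = ∑ c, h c * K c := by
  simp [PiLp.inner_apply]

theorem corrDD_eq (α : ℝ) (P : ℝ → ℝ) (x K L : E3) :
    corrDD P x = factorValue α P K L CorrFactor.dd x := rfl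

section

variable {P : ℝ → ℝ} (h0 : Integrable (fun h : E3 => P ‖h‖))
  (h2 : Integrable (fun h : E3 => P ‖h‖ / ‖h‖ ^ 2))

include h0 h2

theorem integrable_coord_div (c : Fin 3) :
    Integrable fun h : E3 => h c / ‖h‖ ^ 2 * P ‖h‖ := by
  have := integrable_factorWeight h0 h2 1 (EuclideanSpace.single c 1) 0 CorrFactor.pd
  refine this.congr (Eventually.of_forall fun h => ?_)
  simp [factorWeight, EuclideanSpace.inner_single_left]

theorem integrable_coord_mul_coord_div (c d : Fin 3) :
    Integrable fun h : E3 => h c * h d / ‖h‖ ^ 4 * P ‖h‖ := by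
  have := (integrable_factorWeight h0 h2 1 (EuclideanSpace.single c 1) (EuclideanSpace.single d 1)
    CorrFactor.pp).neg
  refine this.congr (Eventually.of_forall fun h => ?_)
  simp only [factorWeight, EuclideanSpace.inner_single_left, Pi.neg_apply, map_one, one_mul]
  ring

/-- The `-I` of the line and the `-I α` of the correlation multiply to the real coefficient `-α`. -/
theorem sum_corrDP (α : ℝ) (x K L : E3) :
    -Complex.I * ∑ c, corrDP α P x c * (L c : ℂ) = factorValue α P K L CorrFactor.dp x := by
  have hI : ∀ c, Integrable fun h : E3 => Complex.exp (Complex.I * (inner ℝ h x : ℝ)) *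
      ((h c / ‖h‖ ^ 2 * P ‖h‖ : ℝ) : ℂ) := fun c =>
    Integrable.exp_inner_mul (integrable_coord_div h0 h2 c).ofReal x
  have hs : ∫ h : E3, Complex.exp (Complex.I * (inner ℝ h x : ℝ)) *
      (factorWeight α P K L CorrFactor.dp h : ℂ) = ∑ c, -(α * (L c : ℂ)) *
        ∫ h : E3, Complex.exp (Complex.I * (inner ℝ h x : ℝ)) *
          ((h c / ‖h‖ ^ 2 * P ‖h‖ : ℝ) : ℂ) := by
    simp_rw [← integral_const_mul]
    rw [← integral_finsetSum _ fun c _ => (hI c).const_mul _]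
    refine integral_congr_ae (Eventually.of_forall fun h => ?_)
    simp only [factorWeight]
    generalize Complex.exp (Complex.I * (inner ℝ h x : ℝ)) = e
    simp only [inner_eq_sum_coord]
    push_cast
    rw [Finset.sum_div, Finset.mul_sum, Finset.sum_mul, Finset.mul_sum]
    refine Finset.sum_congr rfl fun c _ => ?_
    ring
  rw [factorValue, hs, Finset.mul_sum, Finset.mul_sum]
  refine Finset.sum_congr rfl fun c _ => ?_
  rw [corrDP]
  linear_combination (α * (((2 * Real.pi) ^ 3 : ℂ)⁻¹ *
    ∫ h : E3, Complex.exp (Complex.I * (inner ℝ h x : ℝ)) *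
      ((h c / ‖h‖ ^ 2 * P ‖h‖ : ℝ) : ℂ)) * L c) * Complex.I_mul_I

/-- For the line with its momentum end at the first particle the separation is reversed. The
reflection `h ↦ -h` restores it and flips the sign of the coefficient. -/
theorem sum_corrDP_neg (α : ℝ) (x K L : E3) :
    -Complex.I * ∑ c, corrDP α P (-x) c * (K c : ℂ) = factorValue α P K L CorrFactor.pd x := by
  rw [sum_corrDP h0 h2 α (-x) 0 K, factorValue, factorValue]
  congr 1
  rw [← integral_neg_eq_self]
  refine integral_congr_ae (Eventually.of_forall fun h => ?_)
  simp [factorWeight]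
  ring

theorem momentumExponent_eq (α : ℝ) (x K L : E3) :
    momentumExponent α P x K L = factorValue α P K L CorrFactor.pp x := by
  have hI : ∀ c d, Integrable fun h : E3 => Complex.exp (Complex.I * (inner ℝ h x : ℝ)) *
      ((h c * h d / ‖h‖ ^ 4 * P ‖h‖ : ℝ) : ℂ) := fun c d =>
    Integrable.exp_inner_mul (integrable_coord_mul_coord_div h0 h2 c d).ofReal x
  have hs : ∫ h : E3, Complex.exp (Complex.I * (inner ℝ h x : ℝ)) *
      (factorWeight α P K L CorrFactor.pp h : ℂ) = ∑ c, ∑ d, -(α ^ 2 * (K c : ℂ) * (L d : ℂ)) *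
        ∫ h : E3, Complex.exp (Complex.I * (inner ℝ h x : ℝ)) *
          ((h c * h d / ‖h‖ ^ 4 * P ‖h‖ : ℝ) : ℂ) := by
    simp_rw [← integral_const_mul]
    simp_rw [← integral_finsetSum _ fun d (_ : d ∈ Finset.univ) => (hI _ d).const_mul _]
    rw [← integral_finsetSum _ fun c _ => integrable_finsetSum _ fun d _ => (hI c d).const_mul _]
    refine integral_congr_ae (Eventually.of_forall fun h => ?_)
    simp only [factorWeight]
    generalize Complex.exp (Complex.I * (inner ℝ h x : ℝ)) = e
    simp only [inner_eq_sum_coord]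
    push_cast
    rw [Finset.sum_div, Finset.sum_div, Finset.sum_mul_sum, Finset.mul_sum, Finset.sum_mul,
      Finset.mul_sum]
    refine Finset.sum_congr rfl fun c _ => ?_
    rw [Finset.mul_sum, Finset.sum_mul, Finset.mul_sum]
    refine Finset.sum_congr rfl fun d _ => ?_
    ring
  rw [factorValue, hs, momentumExponent, Finset.mul_sum, ← Finset.sum_neg_distrib]
  refine Finset.sum_congr rfl fun c _ => ?_
  rw [Finset.mul_sum, ← Finset.sum_neg_distrib]
  refine Finset.sum_congr rfl fun d _ => ?_
  rw [corrPP]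
  ring

theorem pairSum_eq (α : ℝ) (x K L : E3) :
    pairSum α P x K L =
      (1 + factorValue α P K L CorrFactor.dp x + factorValue α P K L CorrFactor.pd x +
        factorValue α P K L CorrFactor.pd x * factorValue α P K L CorrFactor.dp x +
        factorValue α P K L CorrFactor.dd x) *
        Complex.exp (factorValue α P K L CorrFactor.pp x) - 1 := by
  rw [pairSum, sum_corrDP h0 h2 α x K L, sum_corrDP_neg h0 h2 α x K L,
    momentumExponent_eq h0 h2 α x K L, corrDD_eq α P x K L]

theorem norm_factorValue_le (α : ℝ) (K L : E3) (a : CorrFactor) (x : E3) :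
    ‖factorValue α P K L a x‖ ≤
      (1 + α ^ 2) * factorGrowth K L a * ∫ h, spectralMajorant P h := by
  have hpi : ‖((2 * Real.pi) ^ 3 : ℂ)⁻¹‖ ≤ 1 := by
    have h1 : (1 : ℝ) ≤ (2 * Real.pi) ^ 3 := one_le_pow₀ (by nlinarith [Real.pi_gt_three])
    have h3 : ((2 * Real.pi) ^ 3 : ℂ) = (((2 * Real.pi) ^ 3 : ℝ) : ℂ) := by push_cast; ring
    rw [norm_inv, h3, Complex.norm_real, Real.norm_of_nonneg (by positivity)]
    exact inv_le_one_of_one_le₀ h1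
  rw [factorValue, norm_mul]
  refine (mul_le_of_le_one_left (norm_nonneg _) hpi).trans ?_
  rw [← integral_const_mul]
  refine norm_integral_le_of_norm_le ((integrable_spectralMajorant h0 h2).const_mul _)
    (Eventually.of_forall fun h => ?_)
  rw [norm_mul, norm_exp_I_mul, one_mul, Complex.norm_real]
  exact abs_factorWeight_le α P K L a h

theorem continuous_pairSum (α : ℝ) (K L : E3) : Continuous fun x => pairSum α P x K L := by
  simp_rw [pairSum_eq h0 h2]
  have := continuous_factorValue h0 h2 α K L
  fun_prop

end

theorem factorValue_const_mul (α : ℝ) (P : ℝ → ℝ) (K L : E3) (a : CorrFactor) (t : ℝ) (x : E3) :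
    factorValue α (fun y => t * P y) K L a x = t * factorValue α P K L a x := by
  have : ∀ h, factorWeight α (fun y => t * P y) K L a h = t * factorWeight α P K L a h := by
    intro h
    cases a <;> simp only [factorWeight] <;> ring
  simp only [factorValue, this]
  rw [mul_left_comm, ← integral_const_mul (t : ℂ)]
  congr 2
  funext h
  push_cast
  ring

/-! ### Gaussian integrals -/

/-- The heat kernel on three-dimensional space at time `ε`. -/
def heat (ε : ℝ) (v : E3) : ℝ :=
  ((2 * Real.pi) ^ 3)⁻¹ * ((Real.pi / ε) ^ (3 / 2 : ℝ) * Real.exp (-(‖v‖ ^ 2 / (4 * ε))))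

theorem continuous_heat (ε : ℝ) : Continuous (heat ε) := by
  unfold heat; fun_prop

theorem heat_nonneg {ε : ℝ} (hε : 0 < ε) (v : E3) : 0 ≤ heat ε v := by
  unfold heat; positivity

theorem heat_neg (ε : ℝ) (v : E3) : heat ε (-v) = heat ε v := by simp [heat]

theorem heat_le {ε : ℝ} (hε : 0 < ε) (v : E3) : heat ε v ≤ heat ε 0 := by
  unfold heat
  gcongr
  simp

/-- This fixes the normalization of `heat`: the regularized plane-wave integral is `(2π)³` times a
probability density in `w`, the approximant of `(2π)³ δ(w)`. -/
theorem integral_gauss_phase {ε : ℝ} (hε : 0 < ε) (w : E3) :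
    ∫ q : E3, (Real.exp (-ε * ‖q‖ ^ 2) : ℂ) * Complex.exp (-Complex.I * (inner ℝ w q : ℝ)) =
      (2 * Real.pi) ^ 3 * (heat ε w : ℂ) := by
  have h := GaussianFourier.integral_cexp_neg_mul_sq_norm_add (V := E3) (b := ε) (by simpa using hε)
    (-Complex.I) w
  have h' : ∀ q : E3, (Real.exp (-ε * ‖q‖ ^ 2) : ℂ) * Complex.exp (-Complex.I * (inner ℝ w q : ℝ)) =
      Complex.exp (-(ε : ℂ) * (‖q‖ : ℂ) ^ 2 + -Complex.I * (inner ℝ w q : ℝ)) := by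
    intro q
    rw [Complex.exp_add]
    push_cast
    rfl
  simp_rw [h', h, heat]
  have hpow : ((Real.pi : ℂ) / ε) ^ ((Module.finrank ℝ E3 : ℂ) / 2) =
      (((Real.pi / ε) ^ (3 / 2 : ℝ) : ℝ) : ℂ) := by
    rw [Complex.ofReal_cpow (by positivity)]
    simp
  rw [hpow]
  have h2 : ((2 * Real.pi) ^ 3 : ℂ) ≠ 0 := by
    have := Real.pi_ne_zero
    simp [this]
  push_cast
  rw [mul_inv_cancel_left₀ h2]
  congr 2
  rw [neg_sq, Complex.I_sq]
  ring

theorem integrable_gauss {ε : ℝ} (hε : 0 < ε) : Integrable fun q : E3 => Real.exp (-ε * ‖q‖ ^ 2) := by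
  have h := GaussianFourier.integrable_cexp_neg_mul_sq_norm_add (V := E3) (b := ε)
    (by simpa using hε) 0 0
  have := h.norm
  refine this.congr (Eventually.of_forall fun q => ?_)
  simp [Complex.norm_exp, ← Complex.ofReal_pow]

theorem integrable_heat {ε : ℝ} (hε : 0 < ε) : Integrable (heat ε) := by
  have := (integrable_gauss (ε := 1 / (4 * ε)) (by positivity)).const_mul
    (((2 * Real.pi) ^ 3)⁻¹ * (Real.pi / ε) ^ (3 / 2 : ℝ))
  refine this.congr (Eventually.of_forall fun q => ?_)
  simp only [heat]
  rw [mul_assoc]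
  congr 3
  ring

theorem integral_heat {ε : ℝ} (hε : 0 < ε) : ∫ v, heat ε v = 1 := by
  have h := GaussianFourier.integral_rexp_neg_mul_sq_norm (V := E3) (b := 1 / (4 * ε)) (by positivity)
  have h' : ∀ v : E3, heat ε v = ((2 * Real.pi) ^ 3)⁻¹ * (Real.pi / ε) ^ (3 / 2 : ℝ) *
      Real.exp (-(1 / (4 * ε)) * ‖v‖ ^ 2) := by
    intro v
    simp only [heat]
    rw [mul_assoc]
    congr 3
    ring
  simp_rw [h']
  rw [integral_const_mul, h]
  simp only [finrank_euclideanSpace, Fintype.card_fin]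
  push_cast
  rw [mul_assoc, ← Real.mul_rpow (by positivity) (by positivity)]
  have : Real.pi / ε * (Real.pi / (1 / (4 * ε))) = (2 * Real.pi) ^ 2 := by
    field_simp
    ring
  rw [this, ← Real.rpow_natCast _ 2, ← Real.rpow_mul (by positivity)]
  norm_num

theorem heat_scale {ε : ℝ} (hε : 0 < ε) (a : E3) :
    heat ε (Real.sqrt ε • a) = (Real.sqrt ε ^ 3)⁻¹ * heat 1 a := by
  have hs : Real.sqrt ε ^ 2 = ε := Real.sq_sqrt hε.le
  simp only [heat, norm_smul, Real.norm_of_nonneg (Real.sqrt_nonneg ε), mul_pow, hs]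
  have h1 : ε * ‖a‖ ^ 2 / (4 * ε) = ‖a‖ ^ 2 / (4 * 1) := by field_simp
  have h2 : (Real.pi / ε) ^ (3 / 2 : ℝ) = (Real.sqrt ε ^ 3)⁻¹ * (Real.pi / 1) ^ (3 / 2 : ℝ) := by
    rw [div_one, Real.div_rpow Real.pi_pos.le hε.le, Real.sqrt_eq_rpow, ← Real.rpow_natCast,
      ← Real.rpow_mul hε.le]
    norm_num
    ring
  rw [h1, h2]
  ring

/-- Mollification with the heat kernel is averaging over a scaled Gaussian. -/
theorem integral_heat_mul {ε : ℝ} (hε : 0 < ε) (c : E3) (Θ : E3 → ℂ) :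
    ∫ v, (heat ε (v - c) : ℂ) * Θ v = ∫ a, (heat 1 a : ℂ) * Θ (c + Real.sqrt ε • a) := by
  have hs : 0 < Real.sqrt ε := Real.sqrt_pos.2 hε
  have h1 : ∫ v, (heat ε (v - c) : ℂ) * Θ v = ∫ v, (heat ε v : ℂ) * Θ (c + v) := by
    rw [← integral_add_left_eq_self _ c]
    simp
  have h2 := Measure.integral_comp_smul (volume : Measure E3)
    (fun v => (heat ε v : ℂ) * Θ (c + v)) (Real.sqrt ε)
  simp only [heat_scale hε, finrank_euclideanSpace, Fintype.card_fin] at h2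
  rw [h1]
  rw [abs_of_pos (by positivity)] at h2
  have h3 : ∀ a : E3, (((Real.sqrt ε ^ 3)⁻¹ * heat 1 a : ℝ) : ℂ) * Θ (c + Real.sqrt ε • a) =
      (((Real.sqrt ε ^ 3)⁻¹ : ℝ) : ℂ) * ((heat 1 a : ℂ) * Θ (c + Real.sqrt ε • a)) := by
    intro a; push_cast; ring
  simp_rw [h3] at h2
  rw [integral_const_mul, Complex.real_smul] at h2
  have hne : (((Real.sqrt ε ^ 3)⁻¹ : ℝ) : ℂ) ≠ 0 := by
    exact_mod_cast (inv_pos.2 (pow_pos hs 3)).ne'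
  exact (mul_left_cancel₀ hne h2).symm

/-- The same Gaussian integral as for the positions, taken at `ε = 1 / (2 σ²)`; the
Maxwell–Boltzmann normalization cancels the prefactor. -/
theorem integral_maxwellBoltzmann_phase {σ : ℝ} (hσ : 0 < σ) (K : E3) :
    ∫ p : E3, (maxwellBoltzmann σ p : ℂ) * Complex.exp (-Complex.I * (inner ℝ K p : ℝ)) =
      (Real.exp (-(σ ^ 2 / 2) * ‖K‖ ^ 2) : ℂ) := by
  have hb : (0 : ℝ) < 1 / (2 * σ ^ 2) := by positivity
  have h := integral_gauss_phase hb K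
  have h' : ∀ p : E3, (maxwellBoltzmann σ p : ℂ) * Complex.exp (-Complex.I * (inner ℝ K p : ℝ)) =
      (Real.sqrt ((2 * Real.pi * σ ^ 2) ^ 3) : ℂ)⁻¹ * ((Real.exp (-(1 / (2 * σ ^ 2)) * ‖p‖ ^ 2) : ℂ) *
        Complex.exp (-Complex.I * (inner ℝ K p : ℝ))) := by
    intro p
    have : -‖p‖ ^ 2 / (2 * σ ^ 2) = -(1 / (2 * σ ^ 2)) * ‖p‖ ^ 2 := by ring
    rw [maxwellBoltzmann, this, Complex.ofReal_div, div_eq_inv_mul, mul_assoc]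
  simp_rw [h']
  rw [integral_const_mul, h, heat]
  have h2 : ((2 * Real.pi) ^ 3 : ℂ) ≠ 0 := by
    have := Real.pi_ne_zero
    simp [this]
  have h3 : (Real.pi / (1 / (2 * σ ^ 2))) ^ (3 / 2 : ℝ) = Real.sqrt ((2 * Real.pi * σ ^ 2) ^ 3) := by
    rw [Real.sqrt_eq_rpow, ← Real.rpow_natCast (2 * Real.pi * σ ^ 2) 3,
      ← Real.rpow_mul (by positivity)]
    norm_num
    congr 1
    field_simp
  have h4 : Real.sqrt ((2 * Real.pi * σ ^ 2) ^ 3) ≠ 0 := by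
    have := Real.pi_pos
    positivity
  have h5 : -(‖K‖ ^ 2 / (4 * (1 / (2 * σ ^ 2)))) = -(σ ^ 2 / 2) * ‖K‖ ^ 2 := by
    field_simp
    ring
  rw [h3, h5]
  push_cast
  rw [mul_inv_cancel_left₀ h2, inv_mul_cancel_left₀ (by exact_mod_cast h4)]

/-! ### The regularized cumulant -/

/-- The regularized integral over the positions of two particles of a function of their separation. -/
def separationIntegral (ε : ℝ) (k l : E3) (f : E3 → ℂ) : ℂ :=
  ∫ q : Fin 2 → E3, (Real.exp (-ε * ∑ j, ‖q j‖ ^ 2) : ℂ) *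
    (Complex.exp (-Complex.I * ((inner ℝ k (q 0) + inner ℝ l (q 1) : ℝ) : ℂ)) * f (q 0 - q 1))

theorem exp_neg_mul_sum_eq_prod (ε : ℝ) (q : Fin 2 → E3) :
    Real.exp (-ε * ∑ j, ‖q j‖ ^ 2) = ∏ j, Real.exp (-ε * ‖q j‖ ^ 2) := by
  rw [Finset.mul_sum, Real.exp_sum]

theorem integrable_gauss_pair {ε : ℝ} (hε : 0 < ε) :
    Integrable fun q : Fin 2 → E3 => Real.exp (-ε * ∑ j, ‖q j‖ ^ 2) := by
  simp_rw [exp_neg_mul_sum_eq_prod]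
  exact Integrable.fintype_prod fun _ => integrable_gauss hε

theorem integral_gauss_pair_phase {ε : ℝ} (hε : 0 < ε) (k l : E3) :
    ∫ q : Fin 2 → E3, (Real.exp (-ε * ∑ j, ‖q j‖ ^ 2) : ℂ) *
      Complex.exp (-Complex.I * ((inner ℝ k (q 0) + inner ℝ l (q 1) : ℝ) : ℂ)) =
      (2 * Real.pi) ^ 6 * ((heat ε k : ℂ) * (heat ε l : ℂ)) := by
  have h := integral_fintype_prod_eq_prod (𝕜 := ℂ) (ι := Fin 2) (E := fun _ => E3)
    (μ := fun _ => volume) (fun j q => (Real.exp (-ε * ‖q‖ ^ 2) : ℂ) *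
      Complex.exp (-Complex.I * (inner ℝ ((![k, l] : Fin 2 → E3) j) q : ℝ)))
  simp only [integral_gauss_phase hε, Fin.prod_univ_two] at h
  calc _ = _ := ?_
    _ = _ := h
    _ = _ := by simp; ring
  refine integral_congr_ae (Eventually.of_forall fun q => ?_)
  simp only [exp_neg_mul_sum_eq_prod, Fin.prod_univ_two]
  simp only [Matrix.cons_val_zero, Matrix.cons_val_one]
  push_cast
  rw [mul_add, Complex.exp_add]
  ring

theorem integrable_separation {ε : ℝ} (hε : 0 < ε) (k l : E3) {f : E3 → ℂ} (hf : Continuous f)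
    {C : ℝ} (hC : ∀ x, ‖f x‖ ≤ C) :
    Integrable fun q : Fin 2 → E3 => (Real.exp (-ε * ∑ j, ‖q j‖ ^ 2) : ℂ) *
      (Complex.exp (-Complex.I * ((inner ℝ k (q 0) + inner ℝ l (q 1) : ℝ) : ℂ)) *
        f (q 0 - q 1)) := by
  refine (integrable_gauss_pair hε).ofReal.mul_bdd (c := C) ?_ ?_
  · exact Continuous.aestronglyMeasurable (by fun_prop)
  · refine Eventually.of_forall fun q => ?_
    rw [norm_mul, norm_exp_neg_I_mul, one_mul]
    exact hC _

/-- The regularized position integral of a Fourier integral. -/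
theorem separationIntegral_fourier {Y : Type*} [MeasurableSpace Y] (μ : Measure Y) [SFinite μ]
    {ε : ℝ} (hε : 0 < ε) (k l : E3) {η : Y → E3} (hη : Measurable η) {U : Y → ℂ}
    (hU : Integrable U μ) :
    separationIntegral ε k l (fun x => ∫ y, Complex.exp (Complex.I * (inner ℝ (η y) x : ℝ)) * U y ∂μ) =
      (2 * Real.pi) ^ 6 * ∫ y, (heat ε (k - η y) : ℂ) * (heat ε (l + η y) : ℂ) * U y ∂μ := by
  -- Fubini is available because the Gaussian is integrable in `q`, `U` is integrable in `y`, and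
  -- the phases have modulus one.
  have hint : Integrable (Function.uncurry fun (q : Fin 2 → E3) (y : Y) =>
      (Real.exp (-ε * ∑ j, ‖q j‖ ^ 2) : ℂ) *
      (Complex.exp (-Complex.I * ((inner ℝ k (q 0) + inner ℝ l (q 1) : ℝ) : ℂ)) *
        (Complex.exp (Complex.I * (inner ℝ (η y) (q 0 - q 1) : ℝ)) * U y)))
        ((volume : Measure (Fin 2 → E3)).prod μ) := by
    have h := (integrable_gauss_pair hε).ofReal (𝕜 := ℂ) |>.mul_prod hU
    refine (h.bdd_mul (c := 1) (f := fun z : (Fin 2 → E3) × Y => Complex.exp (-Complex.I *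
      ((inner ℝ k (z.1 0) + inner ℝ l (z.1 1) : ℝ) : ℂ)) *
        Complex.exp (Complex.I * (inner ℝ (η z.2) (z.1 0 - z.1 1) : ℝ))) ?_ ?_).congr ?_
    · exact Measurable.aestronglyMeasurable (by fun_prop)
    · refine Eventually.of_forall fun z => ?_
      rw [norm_mul, norm_exp_neg_I_mul, norm_exp_I_mul, one_mul]
    · refine Eventually.of_forall fun z => ?_
      simp only [Function.uncurry]
      simp only [RCLike.ofReal_eq_complex_ofReal]
      ring
  rw [separationIntegral]
  simp_rw [← integral_const_mul]
  rw [integral_integral_swap hint]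
  refine integral_congr_ae (Eventually.of_forall fun y => ?_)
  have h := integral_gauss_pair_phase hε (k - η y) (l + η y)
  simp only
  rw [← mul_assoc, ← h, ← integral_mul_const]
  refine integral_congr_ae (Eventually.of_forall fun q => ?_)
  simp only
  have he : Complex.exp (-Complex.I * ((inner ℝ (k - η y) (q 0) + inner ℝ (l + η y) (q 1) : ℝ) : ℂ)) =
      Complex.exp (-Complex.I * ((inner ℝ k (q 0) + inner ℝ l (q 1) : ℝ) : ℂ)) *
        Complex.exp (Complex.I * (inner ℝ (η y) (q 0 - q 1) : ℝ)) := by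
    rw [← Complex.exp_add]
    congr 1
    simp only [inner_sub_left, inner_add_left, inner_sub_right]
    push_cast
    ring
  rw [he]
  ring

theorem integral_momenta {n : ℕ} {σ : ℝ} (hσ : 0 < σ) (g : Fin n → ℝ) (k : Fin n → E3)
    (q : Fin 2 → E3) (s : Finset (Fin n)) :
    ∫ p : Fin 2 → E3, ((∏ j, maxwellBoltzmann σ (p j) : ℝ) : ℂ) *
      Complex.exp (-Complex.I * (groupingPhase g k q p s : ℂ)) = (damping σ g k s sᶜ : ℂ) *
        Complex.exp (-Complex.I *
          ((inner ℝ (labelSum k s) (q 0) + inner ℝ (labelSum k sᶜ) (q 1) : ℝ) : ℂ)) := by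
  have h := integral_fintype_prod_eq_prod (𝕜 := ℂ) (ι := Fin 2) (E := fun _ => E3)
    (μ := fun _ => volume) (fun j p => (maxwellBoltzmann σ p : ℂ) * Complex.exp (-Complex.I *
      (inner ℝ ((![weightedLabelSum g k s, weightedLabelSum g k sᶜ] : Fin 2 → E3) j) p : ℝ)))
  simp only [integral_maxwellBoltzmann_phase hσ] at h
  have hd : (damping σ g k s sᶜ : ℂ) = ∏ j, (Real.exp (-(σ ^ 2 / 2) *
      ‖(![weightedLabelSum g k s, weightedLabelSum g k sᶜ] : Fin 2 → E3) j‖ ^ 2) : ℂ) := by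
    rw [Fin.prod_univ_two, damping, ← Complex.ofReal_mul, ← Real.exp_add]
    simp [mul_add]
  rw [hd, ← h, ← integral_mul_const]
  refine integral_congr_ae (Eventually.of_forall fun p => ?_)
  simp only [Fin.prod_univ_two, groupingPhase, Matrix.cons_val_zero, Matrix.cons_val_one]
  push_cast
  simp only [mul_add, Complex.exp_add]
  ring

theorem integrable_maxwellBoltzmann {σ : ℝ} (hσ : 0 < σ) : Integrable (maxwellBoltzmann σ) := by
  have := (integrable_gauss (ε := 1 / (2 * σ ^ 2)) (by positivity)).div_const
    (Real.sqrt ((2 * Real.pi * σ ^ 2) ^ 3))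
  refine this.congr (Eventually.of_forall fun p => ?_)
  simp only [maxwellBoltzmann]
  congr 2
  ring

theorem exists_bound_pairSum {P : ℝ → ℝ} (h0 : Integrable (fun h : E3 => P ‖h‖))
    (h2 : Integrable (fun h : E3 => P ‖h‖ / ‖h‖ ^ 2)) (α : ℝ) (K L : E3) :
    ∃ C, ∀ x, ‖pairSum α P x K L‖ ≤ C := by
  have hb : ∀ a, ∃ C, ∀ x, ‖factorValue α P K L a x‖ ≤ C := fun a =>
    ⟨_, fun x => norm_factorValue_le h0 h2 α K L a x⟩
  choose C hC using hb
  refine ⟨(1 + C .dp + C .pd + C .pd * C .dp + C .dd) * Real.exp (C .pp) + 1, fun x => ?_⟩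
  rw [pairSum_eq h0 h2]
  have hC0 : ∀ a, 0 ≤ C a := fun a => (norm_nonneg _).trans (hC a x)
  refine (norm_sub_le _ _).trans ?_
  rw [norm_one, norm_mul]
  gcongr
  · have := hC0 .dp; have := hC0 .pd; have := hC0 .dd; positivity
  · refine (norm_add_le _ _).trans (add_le_add ((norm_add_le _ _).trans (add_le_add
      ((norm_add_le _ _).trans (add_le_add ((norm_add_le _ _).trans (add_le_add ?_ ?_)) ?_)) ?_)) ?_)
    · simp
    · exact hC _ x
    · exact hC _ x
    · rw [norm_mul]; gcongr
      · exact hC0 _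
      · exact hC _ x
      · exact hC _ x
    · exact hC _ x
  · exact (Complex.norm_exp_le_exp_norm _).trans (Real.exp_le_exp.2 (hC _ x))

theorem regularizedCumulant_two {P : ℝ → ℝ} (h0 : Integrable (fun h : E3 => P ‖h‖))
    (h2 : Integrable (fun h : E3 => P ‖h‖ / ‖h‖ ^ 2)) {n : ℕ} (ρbar α : ℝ) {σ : ℝ} (hσ : 0 < σ)
    (g : Fin n → ℝ) {ε : ℝ} (hε : 0 < ε) (k : Fin n → E3) :
    regularizedCumulant 2 ρbar α σ P g ε k = (ρbar : ℂ) ^ 2 * ((2 : ℂ)⁻¹ *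
      ∑ s : Finset (Fin n), (damping σ g k s sᶜ : ℂ) *
        separationIntegral ε (labelSum k s) (labelSum k sᶜ) (fun x =>
          pairSum α P x (weightedLabelSum g k s) (weightedLabelSum g k sᶜ))) := by
  rw [regularizedCumulant]
  congr 1
  -- The diagrams depend on the momenta only through the phase of each grouping, so at fixed
  -- positions the momenta integrate out to the damping factor.
  have hp : ∀ q : Fin 2 → E3, (∫ p : Fin 2 → E3, ((∏ j, maxwellBoltzmann σ (p j) : ℝ) : ℂ) *
      connectedOp α P q ((List.finRange n).foldr (densityOp k) (freeFunctional g q p)) 0 0) =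
      (2 : ℂ)⁻¹ * ∑ s : Finset (Fin n), pairSum α P (q 0 - q 1) (weightedLabelSum g k s)
        (weightedLabelSum g k sᶜ) * ((damping σ g k s sᶜ : ℂ) * Complex.exp (-Complex.I *
          ((inner ℝ (labelSum k s) (q 0) + inner ℝ (labelSum k sᶜ) (q 1) : ℝ) : ℂ))) := by
    intro q
    simp_rw [← integral_momenta hσ, ← integral_const_mul]
    rw [← integral_finsetSum, ← integral_const_mul]
    · refine integral_congr_ae (Eventually.of_forall fun p => ?_)
      simp only [connectedOp_foldr_densityOp, Finset.mul_sum]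
      refine Finset.sum_congr rfl fun s _ => ?_
      ring
    · intro s _
      refine Integrable.const_mul ?_ _
      have hm : Integrable fun p : Fin 2 → E3 => ∏ j, maxwellBoltzmann σ (p j) :=
        Integrable.fintype_prod fun _ => integrable_maxwellBoltzmann hσ
      refine hm.ofReal.mul_bdd (c := 1) ?_ ?_
      · unfold groupingPhase
        exact Continuous.aestronglyMeasurable (by fun_prop)
      · refine Eventually.of_forall fun p => ?_
        rw [norm_exp_neg_I_mul]
  simp_rw [hp, separationIntegral, ← integral_const_mul]
  rw [← integral_finsetSum, ← integral_const_mul]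
  · refine integral_congr_ae (Eventually.of_forall fun q => ?_)
    simp only [Finset.mul_sum]
    refine Finset.sum_congr rfl fun s _ => ?_
    ring
  · intro s _
    obtain ⟨C, hC⟩ := exists_bound_pairSum h0 h2 α (weightedLabelSum g k s)
      (weightedLabelSum g k sᶜ)
    exact (integrable_separation hε _ _ (continuous_pairSum h0 h2 α _ _) hC).const_mul _

/-! ### Coordinates on wave vectors adapted to a grouping of the labels -/

/-- Wave vectors with vanishing sum, parametrized by the wave vector `w.2` of the label `r.succ` and
the wave vectors `w.1` of the labels different from `0` and `r.succ`. -/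
def fiberPoint {m : ℕ} (r : Fin (m + 1)) (w : (Fin m → E3) × E3) : Fin (m + 2) → E3 :=
  Fin.cons (-(∑ i, w.1 i) - w.2) (Fin.insertNth (α := fun _ => E3) r w.2 w.1 : Fin (m + 1) → E3)

theorem continuous_fiberPoint {m : ℕ} (r : Fin (m + 1)) : Continuous (fiberPoint (m := m) r) := by
  unfold fiberPoint
  fun_prop

theorem continuous_cons_neg_sum (n : ℕ) :
    Continuous fun k : Fin n → E3 => (Fin.cons (-∑ i, k i) k : Fin (n + 1) → E3) := by
  fun_prop

theorem measurePreserving_cons_neg_sum (n : ℕ) :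
    MeasurePreserving (fun k : Fin n → E3 => (Fin.cons (-∑ i, k i) k : Fin (n + 1) → E3))
      volume (diracSum n) :=
  ⟨(continuous_cons_neg_sum n).measurable, rfl⟩

theorem measurableEmbedding_cons_neg_sum (n : ℕ) :
    MeasurableEmbedding fun k : Fin n → E3 => (Fin.cons (-∑ i, k i) k : Fin (n + 1) → E3) :=
  (continuous_cons_neg_sum n).measurableEmbedding fun _ _ h => (Fin.cons_inj.1 h).2

instance sFinite_diracSum (n : ℕ) : SFinite (diracSum n) := by
  unfold diracSum; infer_instance

theorem measurePreserving_insertNth {m : ℕ} (r : Fin (m + 1)) :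
    MeasurePreserving (fun w : (Fin m → E3) × E3 =>
      (Fin.insertNth (α := fun _ => E3) r w.2 w.1 : Fin (m + 1) → E3)) volume volume :=
  (volume_preserving_piFinSuccAbove (fun _ => E3) r).symm.comp Measure.measurePreserving_swap

theorem sum_insertNth {m : ℕ} (r : Fin (m + 1)) (v : E3) (z : Fin m → E3) :
    ∑ i, (Fin.insertNth (α := fun _ => E3) r v z : Fin (m + 1) → E3) i = v + ∑ i, z i := by
  rw [Fin.sum_univ_succAbove _ r]
  simp

/-- `diracSum` eliminates label `0`; singling out one of the remaining free labels only permutes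
Lebesgue coordinates. -/
theorem measurePreserving_fiberPoint {m : ℕ} (r : Fin (m + 1)) :
    MeasurePreserving (fiberPoint (m := m) r) volume (diracSum (m + 1)) := by
  have h := (measurePreserving_cons_neg_sum (m + 1)).comp (measurePreserving_insertNth r)
  convert! h using 1
  funext w
  simp only [fiberPoint, Function.comp, sum_insertNth]
  congr 1
  abel

theorem measurePreserving_prod_sub {A : Type*} [MeasurableSpace A] (μ : Measure A) [SFinite μ]
    {c : A → E3} (hc : Measurable c) :
    MeasurePreserving (fun w : A × E3 => (w.1, w.2 - c w.1)) (μ.prod volume) (μ.prod volume) :=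
  (MeasurePreserving.id μ).skew_product (g := fun a u => u - c a) (by fun_prop)
    (Eventually.of_forall fun a => (measurePreserving_sub_right volume (c a)).map_eq)

theorem cons_neg_sum_add_single {n : ℕ} (k : Fin n → E3) (u : E3) :
    (Fin.cons (-∑ i, k i) k : Fin (n + 1) → E3) + Pi.single 0 u = Fin.cons (u - ∑ i, k i) k := by
  funext i
  refine Fin.cases ?_ (fun i => ?_) i
  · simp; abel
  · simp

/-- Lebesgue measure disintegrates over the total wave vector: a configuration is one with zero sum
plus its total, added at label `0`. -/
theorem measurePreserving_add_single (n : ℕ) :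
    MeasurePreserving (fun w : (Fin (n + 1) → E3) × E3 => w.1 + Pi.single 0 w.2)
      ((diracSum n).prod volume) volume := by
  have hm : Measurable fun w : (Fin (n + 1) → E3) × E3 =>
      w.1 + (Pi.single 0 w.2 : Fin (n + 1) → E3) :=
    (continuous_fst.add ((continuous_single 0).comp continuous_snd)).measurable
  have h1 : MeasurePreserving (fun w : (Fin n → E3) × E3 =>
      (Fin.cons (w.2 - ∑ i, w.1 i) w.1 : Fin (n + 1) → E3)) (volume.prod volume) volume := by
    have ha := measurePreserving_prod_sub (volume : Measure (Fin n → E3))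
      (c := fun k => ∑ i, k i) (by fun_prop)
    have h := (measurePreserving_insertNth (0 : Fin (n + 1))).comp ha
    convert! h using 1
    funext w
    simp [Function.comp]
  have h2 := (measurePreserving_cons_neg_sum n).prod (MeasurePreserving.id (volume : Measure E3))
  refine ⟨hm, ?_⟩
  rw [← h2.map_eq, Measure.map_map hm h2.measurable, ← h1.map_eq]
  congr 1
  funext w
  simp only [Function.comp, Prod.map, id]
  rw [cons_neg_sum_add_single]

/-- The part of the wave vector of the label set `s` that is determined by the labels different from
`0` and `r.succ`. -/
def baseSum {m : ℕ} (r : Fin (m + 1)) (s : Finset (Fin (m + 2))) (z : Fin m → E3) : E3 :=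
  labelSum (fiberPoint r (z, 0)) s

theorem continuous_labelSum {n : ℕ} (s : Finset (Fin n)) :
    Continuous fun k : Fin n → E3 => labelSum k s := by
  unfold labelSum; fun_prop

theorem continuous_weightedLabelSum {n : ℕ} (g : Fin n → ℝ) (s : Finset (Fin n)) :
    Continuous fun k : Fin n → E3 => weightedLabelSum g k s := by
  unfold weightedLabelSum; fun_prop

theorem continuous_baseSum {m : ℕ} (r : Fin (m + 1)) (s : Finset (Fin (m + 2))) :
    Continuous (baseSum r s) :=
  (continuous_labelSum s).comp ((continuous_fiberPoint r).comp (by fun_prop))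

theorem labelSum_add {n : ℕ} (k l : Fin n → E3) (s : Finset (Fin n)) :
    labelSum (k + l) s = labelSum k s + labelSum l s := by
  simp [labelSum, Finset.sum_add_distrib]

theorem labelSum_single {n : ℕ} (r : Fin n) (v : E3) (s : Finset (Fin n)) :
    labelSum (Pi.single r v) s = if r ∈ s then v else 0 := by
  simp only [labelSum, Pi.single_apply, Finset.sum_ite_eq']

theorem labelSum_compl {n : ℕ} (k : Fin n → E3) (s : Finset (Fin n)) :
    labelSum k sᶜ = ∑ i, k i - labelSum k s := by
  rw [labelSum, labelSum, eq_sub_iff_add_eq, add_comm, Finset.sum_add_sum_compl]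

theorem sum_fiberPoint {m : ℕ} (r : Fin (m + 1)) (w : (Fin m → E3) × E3) :
    ∑ i, fiberPoint r w i = 0 := by
  rw [fiberPoint, Fin.sum_univ_succ]
  simp only [Fin.cons_zero, Fin.cons_succ, sum_insertNth]
  abel

theorem fiberPoint_eq {m : ℕ} (r : Fin (m + 1)) (z : Fin m → E3) (v : E3) :
    fiberPoint r (z, v) = fiberPoint r (z, 0) + Pi.single r.succ v + Pi.single 0 (-v) := by
  funext i
  refine Fin.cases ?_ (fun i => ?_) i
  · simp [fiberPoint]; abel
  · simp only [fiberPoint, Fin.cons_succ, Pi.add_apply]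
    have : (Pi.single 0 (-v) : Fin (m + 2) → E3) i.succ = 0 := by simp
    rw [this, add_zero]
    refine Fin.succAboveCases r ?_ (fun j => ?_) i
    · simp
    · simp [Fin.succAbove_ne]

section

variable {m : ℕ} (r : Fin (m + 1)) {s : Finset (Fin (m + 2))} (hs : (0 : Fin (m + 2)) ∈ s)
  (hr : r.succ ∉ s)

include hs hr

/-- Raising the wave vector of `r.succ` by `v` lowers that of label `0` by `v`. Since the two labels
lie in different blocks, `k_{sᶜ}` gains `v` and `k_s` loses it. -/
theorem labelSum_compl_fiberPoint (z : Fin m → E3) (v : E3) :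
    labelSum (fiberPoint r (z, v)) sᶜ = baseSum r sᶜ z + v := by
  rw [fiberPoint_eq, labelSum_add, labelSum_add, labelSum_single, labelSum_single]
  simp [hs, hr, baseSum]

theorem labelSum_fiberPoint (z : Fin m → E3) (v : E3) :
    labelSum (fiberPoint r (z, v)) s = -(baseSum r sᶜ z + v) := by
  have := labelSum_compl (fiberPoint r (z, v)) s
  rw [sum_fiberPoint, labelSum_compl_fiberPoint r hs hr] at this
  rw [this]; abel

end

/-- Wave vectors in terms of the deviations `w.1.2`, `w.2` of `k_{sᶜ}` from `-η` and of `k_s` from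
`η`. -/
def deviationPoint {m : ℕ} (r : Fin (m + 1)) (s : Finset (Fin (m + 2))) (η : E3)
    (w : ((Fin m → E3) × E3) × E3) : Fin (m + 2) → E3 :=
  fiberPoint r (w.1.1, w.1.2 - (baseSum r sᶜ w.1.1 + η)) + Pi.single 0 (w.2 + w.1.2)

theorem continuous_deviationPoint {m : ℕ} (r : Fin (m + 1)) (s : Finset (Fin (m + 2))) (η : E3) :
    Continuous (deviationPoint r s η) := by
  have h1 := continuous_fiberPoint r
  have h2 := continuous_baseSum r sᶜ
  exact (h1.comp (by fun_prop)).add ((continuous_single 0).comp (by fun_prop))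

/-- The coordinate change consists of translations of one coordinate by functions of the others,
hence has unit Jacobian. -/
theorem measurePreserving_deviationPoint {m : ℕ} (r : Fin (m + 1)) (s : Finset (Fin (m + 2)))
    (η : E3) : MeasurePreserving (deviationPoint r s η) volume volume := by
  have h1 := measurePreserving_prod_sub (volume : Measure (Fin m → E3))
    (c := fun z => baseSum r sᶜ z + η) ((continuous_baseSum r sᶜ).measurable.add_const η)
  have h2 := h1.skew_product (μc := (volume : Measure E3)) (μd := volume) (g := fun p a => a + p.2)
    (by fun_prop) (Eventually.of_forall fun p => (measurePreserving_add_right volume p.2).map_eq)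
  have h3 := (measurePreserving_fiberPoint r).prod (MeasurePreserving.id (volume : Measure E3))
  exact (measurePreserving_add_single (m + 1)).comp (h3.comp h2)

section

variable {m : ℕ} (r : Fin (m + 1)) {s : Finset (Fin (m + 2))} (hs : (0 : Fin (m + 2)) ∈ s)
  (hr : r.succ ∉ s) (η : E3) (w : ((Fin m → E3) × E3) × E3)

include hs hr

/-- Together with its companion for `sᶜ`, this makes the arguments of the two heat kernels
independent coordinates, which is where having one label in each block matters. -/
theorem labelSum_deviationPoint : labelSum (deviationPoint r s η w) s - η = w.2 := by
  rw [deviationPoint, labelSum_add, labelSum_fiberPoint r hs hr, labelSum_single, if_pos hs]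
  abel

theorem labelSum_compl_deviationPoint : labelSum (deviationPoint r s η w) sᶜ + η = w.1.2 := by
  rw [deviationPoint, labelSum_add, labelSum_compl_fiberPoint r hs hr, labelSum_single,
    if_neg (by simpa using hs)]
  abel

end

/-! ### Decay of test functions -/

/-- A product of integrable weights. -/
def decay {m : ℕ} (z : Fin m → E3) : ℝ := ∏ i, ((1 + ‖z i‖) ^ 4)⁻¹

theorem decay_nonneg {m : ℕ} (z : Fin m → E3) : 0 ≤ decay z :=
  Finset.prod_nonneg fun _ _ => by positivity

theorem inv_one_add_norm_pow_le_one (v : E3) : ((1 + ‖v‖) ^ 4)⁻¹ ≤ 1 :=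
  inv_le_one_of_one_le₀ (one_le_pow₀ (by linarith [norm_nonneg v]))

theorem continuous_decay (m : ℕ) : Continuous (decay (m := m)) := by
  unfold decay
  refine continuous_finsetProd _ fun i _ => Continuous.inv₀ (by fun_prop) fun z => ?_
  positivity

/-- The fourth power suffices since `4 > 3`, the dimension of each factor. -/
theorem integrable_decay (m : ℕ) : Integrable (decay (m := m)) := by
  refine Integrable.fintype_prod (f := fun (_ : Fin m) (v : E3) => ((1 + ‖v‖) ^ 4)⁻¹) fun _ => ?_
  have := integrable_one_add_norm (E := E3) (μ := volume) (r := 4) (by simp; norm_num)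
  refine this.congr (Eventually.of_forall fun v => ?_)
  simp only
  rw [Real.rpow_neg (by positivity)]
  norm_cast

theorem decay_cons {m : ℕ} (v : E3) (z : Fin m → E3) :
    decay (Fin.cons v z : Fin (m + 1) → E3) = ((1 + ‖v‖) ^ 4)⁻¹ * decay z := by
  simp only [decay, Fin.prod_univ_succ, Fin.cons_zero, Fin.cons_succ]

theorem decay_cons_le {m : ℕ} (v : E3) (z : Fin m → E3) :
    decay (Fin.cons v z : Fin (m + 1) → E3) ≤ decay z := by
  rw [decay_cons]
  exact mul_le_of_le_one_left (decay_nonneg z) (inv_one_add_norm_pow_le_one v)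

theorem decay_insertNth_le {m : ℕ} (r : Fin (m + 1)) (v : E3) (z : Fin m → E3) :
    decay (Fin.insertNth (α := fun _ => E3) r v z : Fin (m + 1) → E3) ≤ decay z := by
  rw [decay, Fin.prod_univ_succAbove _ r]
  simp only [Fin.insertNth_apply_same, Fin.insertNth_apply_succAbove]
  exact mul_le_of_le_one_left (decay_nonneg z) (inv_one_add_norm_pow_le_one v)

theorem fiberPoint_add_single {m : ℕ} (r : Fin (m + 1)) (z : Fin m → E3) (v u : E3) :
    fiberPoint r (z, v) + Pi.single 0 u = Fin.cons (u + (-(∑ i, z i) - v))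
      (Fin.insertNth (α := fun _ => E3) r v z : Fin (m + 1) → E3) := by
  funext i
  refine Fin.cases ?_ (fun i => ?_) i
  · simp [fiberPoint]; abel
  · simp [fiberPoint]

/-- Decay is kept only in the labels other than `0` and `r.succ`: the two remaining directions are
integrated against the heat kernels. -/
theorem decay_deviationPoint_le {m : ℕ} (r : Fin (m + 1)) (s : Finset (Fin (m + 2))) (η : E3)
    (w : ((Fin m → E3) × E3) × E3) : decay (deviationPoint r s η w) ≤ decay w.1.1 := by
  rw [deviationPoint, fiberPoint_add_single]
  exact (decay_cons_le _ _).trans (decay_insertNth_le _ _ _)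

theorem decay_fiberPoint_le {m : ℕ} (r : Fin (m + 1)) (w : (Fin m → E3) × E3) :
    decay (fiberPoint r w) ≤ decay w.1 :=
  (decay_cons_le _ _).trans (decay_insertNth_le _ _ _)

/-- Schwartz functions are dominated by `decay`. -/
theorem exists_norm_le_decay {m : ℕ} (φ : 𝓢(Fin m → E3, ℂ)) (j : ℕ) :
    ∃ C : ℝ, 0 ≤ C ∧ ∀ k, ‖iteratedFDeriv ℝ j φ k‖ ≤ C * decay k := by
  set C := 2 ^ (4 * m) * ((Finset.Iic (4 * m, j)).sup fun p => SchwartzMap.seminorm ℝ p.1 p.2) φ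
    with hC
  have hC0 : 0 ≤ C := by rw [hC]; positivity
  refine ⟨C, hC0, fun k => ?_⟩
  have h := SchwartzMap.one_add_le_sup_seminorm_apply (𝕜 := ℝ) (m := (4 * m, j)) (k := 4 * m)
    (n := j) le_rfl le_rfl φ k
  -- The product carries the supremum norm, so every single factor of `decay` is at least `(1 +
  -- ‖k‖)⁻⁴`.
  have hd : ((1 + ‖k‖) ^ (4 * m))⁻¹ ≤ decay k := by
    have : ((1 + ‖k‖) ^ (4 * m))⁻¹ = ∏ _i : Fin m, ((1 + ‖k‖) ^ 4)⁻¹ := by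
      rw [Finset.prod_const, Finset.card_univ, Fintype.card_fin, inv_pow, pow_mul]
    rw [this, decay]
    refine Finset.prod_le_prod (fun _ _ => by positivity) fun i _ => ?_
    gcongr
    exact norm_le_pi_norm k i
  have hp : (0 : ℝ) < (1 + ‖k‖) ^ (4 * m) := by positivity
  calc ‖iteratedFDeriv ℝ j φ k‖ ≤ C * ((1 + ‖k‖) ^ (4 * m))⁻¹ := by
        rw [← div_eq_mul_inv, le_div_iff₀ hp, mul_comm]; exact h
    _ ≤ C * decay k := by gcongr

/-! ### Removing the convergence factor -/

theorem integrable_decay_heat_heat (m : ℕ) {ε : ℝ} (hε : 0 < ε) :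
    Integrable fun w : ((Fin m → E3) × E3) × E3 => decay w.1.1 * heat ε w.1.2 * heat ε w.2 :=
  ((integrable_decay m).mul_prod (integrable_heat hε)).mul_prod (integrable_heat hε)

theorem integrable_heat_heat_mul {m : ℕ} {ε : ℝ} (hε : 0 < ε)
    {f : ((Fin m → E3) × E3) × E3 → ℂ} (hf : Continuous f) {C : ℝ}
    (hC : ∀ w, ‖f w‖ ≤ C * decay w.1.1) :
    Integrable fun w : ((Fin m → E3) × E3) × E3 =>
      (heat ε w.1.2 : ℂ) * ((heat ε w.2 : ℂ) * f w) := by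
  have hh := continuous_heat ε
  refine Integrable.mono' ((integrable_decay_heat_heat m hε).const_mul C)
    (Continuous.aestronglyMeasurable (by fun_prop)) (Eventually.of_forall fun w => ?_)
  rw [norm_mul, norm_mul, Complex.norm_real, Complex.norm_real, Real.norm_of_nonneg (heat_nonneg hε _),
    Real.norm_of_nonneg (heat_nonneg hε _)]
  calc heat ε w.1.2 * (heat ε w.2 * ‖f w‖) ≤ heat ε w.1.2 * (heat ε w.2 * (C * decay w.1.1)) := by
        have := heat_nonneg hε w.2
        have := heat_nonneg hε w.1.2
        gcongr
        exact hC w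
    _ = _ := by ring

theorem integral_heat_heat_mul {m : ℕ} {ε : ℝ} (hε : 0 < ε)
    {f : ((Fin m → E3) × E3) × E3 → ℂ} (hf : Continuous f) {C : ℝ}
    (hC : ∀ w, ‖f w‖ ≤ C * decay w.1.1) :
    ∫ w : ((Fin m → E3) × E3) × E3, (heat ε w.1.2 : ℂ) * ((heat ε w.2 : ℂ) * f w) =
      ∫ w : ((Fin m → E3) × E3) × E3, (heat 1 w.1.2 : ℂ) * ((heat 1 w.2 : ℂ) *
        f ((w.1.1, Real.sqrt ε • w.1.2), Real.sqrt ε • w.2)) := by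
  have h1 := integrable_heat_heat_mul hε hf hC
  have h2 := integrable_heat_heat_mul (m := m) one_pos
    (f := fun w => f ((w.1.1, Real.sqrt ε • w.1.2), Real.sqrt ε • w.2)) (by fun_prop) (C := C)
    (fun w => hC _)
  rw [Measure.volume_eq_prod, integral_prod _ h1, integral_prod _ h2, Measure.volume_eq_prod,
    integral_prod _ h1.integral_prod_left, integral_prod _ h2.integral_prod_left]
  refine integral_congr_ae (Eventually.of_forall fun z => ?_)
  simp only [integral_const_mul]
  have ha : ∀ b, ∫ a, (heat ε a : ℂ) * f ((z, b), a) =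
      ∫ a, (heat 1 a : ℂ) * f ((z, b), Real.sqrt ε • a) := fun b => by
    simpa using integral_heat_mul hε 0 fun a => f ((z, b), a)
  simp_rw [ha]
  simpa using integral_heat_mul hε 0 fun b => ∫ a, (heat 1 a : ℂ) * f ((z, b), Real.sqrt ε • a)

/-! ### Smoothed delta functions at a fixed separation wave vector -/

section Mollified

variable {m : ℕ} (r : Fin (m + 1)) {s : Finset (Fin (m + 2))} (hs : (0 : Fin (m + 2)) ∈ s)
  (hr : r.succ ∉ s)

include hs hr

/-- Rescaling the two deviations by `√ε` moves all dependence on `ε` into the argument of `f`,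
leaving a fixed Gaussian weight to which dominated convergence applies. -/
theorem mollified_eq {ε : ℝ} (hε : 0 < ε) (η : E3) {f : (Fin (m + 2) → E3) → ℂ}
    (hf : Continuous f) {C : ℝ} (hC0 : 0 ≤ C) (hC : ∀ k, ‖f k‖ ≤ C * decay k) :
    ∫ k, (heat ε (labelSum k s - η) : ℂ) * (heat ε (labelSum k sᶜ + η) : ℂ) * f k =
      ∫ w : ((Fin m → E3) × E3) × E3, (heat 1 w.1.2 : ℂ) * ((heat 1 w.2 : ℂ) *
        f (deviationPoint r s η ((w.1.1, Real.sqrt ε • w.1.2), Real.sqrt ε • w.2))) := by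
  have hd := continuous_deviationPoint r s η
  have hmp := measurePreserving_deviationPoint r s η
  rw [← integral_heat_heat_mul hε (f := fun w => f (deviationPoint r s η w)) (by fun_prop) (C := C)
    (fun w => (hC _).trans (by gcongr; exact decay_deviationPoint_le _ _ _ _))]
  have hh := continuous_heat ε
  have hk := continuous_labelSum s
  have hk' := continuous_labelSum sᶜ
  rw [← hmp.map_eq, integral_map hmp.measurable.aemeasurable
    (Continuous.aestronglyMeasurable (by fun_prop))]
  refine integral_congr_ae (Eventually.of_forall fun w => ?_)
  simp only
  rw [labelSum_deviationPoint r hs hr, labelSum_compl_deviationPoint r hs hr]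
  ring

/-- Each heat kernel has mass one, whence a bound independent of both `ε` and `η`. -/
theorem norm_mollified_le {ε : ℝ} (hε : 0 < ε) (η : E3) {f : (Fin (m + 2) → E3) → ℂ}
    (hf : Continuous f) {C : ℝ} (hC0 : 0 ≤ C) (hC : ∀ k, ‖f k‖ ≤ C * decay k) :
    ‖∫ k, (heat ε (labelSum k s - η) : ℂ) * (heat ε (labelSum k sᶜ + η) : ℂ) * f k‖ ≤
      C * ∫ z : Fin m → E3, decay z := by
  rw [mollified_eq r hs hr hε η hf hC0 hC]
  have h : ∫ w : ((Fin m → E3) × E3) × E3, C * (decay w.1.1 * heat 1 w.1.2 * heat 1 w.2) =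
      C * ∫ z : Fin m → E3, decay z := by
    rw [integral_const_mul, Measure.volume_eq_prod,
      integral_prod_mul (f := fun p : (Fin m → E3) × E3 => decay p.1 * heat 1 p.2) (g := heat 1),
      Measure.volume_eq_prod, integral_prod_mul, integral_heat one_pos, mul_one, mul_one]
  rw [← h]
  refine norm_integral_le_of_norm_le ((integrable_decay_heat_heat m one_pos).const_mul C)
    (Eventually.of_forall fun w => ?_)
  have h1 := heat_nonneg one_pos w.1.2
  have h2 := heat_nonneg one_pos w.2
  rw [norm_mul, norm_mul, Complex.norm_real, Complex.norm_real, Real.norm_of_nonneg h1,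
    Real.norm_of_nonneg h2]
  calc _ ≤ heat 1 w.1.2 * (heat 1 w.2 * (C * decay w.1.1)) := by
        gcongr
        refine (hC _).trans ?_
        gcongr
        exact decay_deviationPoint_le r s η _
    _ = _ := by ring

theorem tendsto_mollified (η : E3) {f : (Fin (m + 2) → E3) → ℂ}
    (hf : Continuous f) {C : ℝ} (hC0 : 0 ≤ C) (hC : ∀ k, ‖f k‖ ≤ C * decay k) :
    Tendsto (fun ε : ℝ => ∫ k, (heat ε (labelSum k s - η) : ℂ) *
      (heat ε (labelSum k sᶜ + η) : ℂ) * f k) (𝓝[>] 0)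
      (𝓝 (∫ z : Fin m → E3, f (fiberPoint r (z, -(baseSum r sᶜ z + η))))) := by
  have hd := continuous_deviationPoint r s η
  have hh := continuous_heat 1
  have hlim : ∫ z : Fin m → E3, f (fiberPoint r (z, -(baseSum r sᶜ z + η))) =
      ∫ w : ((Fin m → E3) × E3) × E3, (heat 1 w.1.2 : ℂ) * ((heat 1 w.2 : ℂ) *
        f (fiberPoint r (w.1.1, -(baseSum r sᶜ w.1.1 + η)))) := by
    have h1 : ∀ w : ((Fin m → E3) × E3) × E3, (heat 1 w.1.2 : ℂ) * ((heat 1 w.2 : ℂ) *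
        f (fiberPoint r (w.1.1, -(baseSum r sᶜ w.1.1 + η)))) =
        (f (fiberPoint r (w.1.1, -(baseSum r sᶜ w.1.1 + η))) * (heat 1 w.1.2 : ℂ)) *
          (heat 1 w.2 : ℂ) := fun w => by ring
    have h2 : ∫ v, (heat 1 v : ℂ) = 1 := by
      rw [integral_complex_ofReal, integral_heat one_pos, Complex.ofReal_one]
    simp_rw [h1]
    rw [Measure.volume_eq_prod,
      integral_prod_mul (f := fun p : (Fin m → E3) × E3 =>
        f (fiberPoint r (p.1, -(baseSum r sᶜ p.1 + η))) * (heat 1 p.2 : ℂ))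
        (g := fun v => (heat 1 v : ℂ)),
      Measure.volume_eq_prod, integral_prod_mul (f := fun z : Fin m → E3 =>
        f (fiberPoint r (z, -(baseSum r sᶜ z + η)))) (g := fun v => (heat 1 v : ℂ)), h2, mul_one,
      mul_one]
  rw [hlim]
  have heq : ∀ ε ∈ Set.Ioi (0 : ℝ), ∫ w : ((Fin m → E3) × E3) × E3, (heat 1 w.1.2 : ℂ) *
      ((heat 1 w.2 : ℂ) * f (deviationPoint r s η ((w.1.1, Real.sqrt ε • w.1.2),
        Real.sqrt ε • w.2))) = ∫ k, (heat ε (labelSum k s - η) : ℂ) *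
      (heat ε (labelSum k sᶜ + η) : ℂ) * f k := fun ε hε =>
    (mollified_eq r hs hr hε η hf hC0 hC).symm
  refine Tendsto.congr' (eventually_nhdsWithin_of_forall heq) ?_
  refine tendsto_integral_filter_of_dominated_convergence
    (fun w => C * (decay w.1.1 * heat 1 w.1.2 * heat 1 w.2)) ?_ ?_
    ((integrable_decay_heat_heat m one_pos).const_mul C) ?_
  · exact Eventually.of_forall fun ε => Continuous.aestronglyMeasurable (by fun_prop)
  · refine Eventually.of_forall fun ε => Eventually.of_forall fun w => ?_
    have h1 := heat_nonneg one_pos w.1.2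
    have h2 := heat_nonneg one_pos w.2
    rw [norm_mul, norm_mul, Complex.norm_real, Complex.norm_real, Real.norm_of_nonneg h1,
      Real.norm_of_nonneg h2]
    calc _ ≤ heat 1 w.1.2 * (heat 1 w.2 * (C * decay w.1.1)) := by
          gcongr
          refine (hC _).trans ?_
          gcongr
          exact decay_deviationPoint_le r s η _
      _ = _ := by ring
  · refine Eventually.of_forall fun w => ?_
    have hc : Continuous fun ε : ℝ => (heat 1 w.1.2 : ℂ) * ((heat 1 w.2 : ℂ) *
        f (deviationPoint r s η ((w.1.1, Real.sqrt ε • w.1.2), Real.sqrt ε • w.2))) := by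
      fun_prop
    -- The rescaled integrand is continuous in `ε` up to `0`, where both deviations vanish.
    have := (hc.tendsto 0).mono_left (nhdsWithin_le_nhds (s := Set.Ioi 0))
    convert! this using 3
    simp [deviationPoint]

end Mollified

/-! ### Superposition over the separation variables -/

section Kernel

variable {Y : Type*} [MeasurableSpace Y] {μ : Measure Y} [SFinite μ] {η : Y → E3}
  {ρ : Y → ℂ} {B : Y → ℝ}

omit [SFinite μ] in
theorem integrable_kernel {N : ℕ} (hρ : AEStronglyMeasurable ρ μ)
    {Φ : Y → (Fin N → E3) → ℂ} (hΦ : Measurable (Function.uncurry Φ)) (hB : Integrable B μ)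
    (hbound : ∀ y k, ‖ρ y * Φ y k‖ ≤ B y * decay k) :
    Integrable (fun p : (Fin N → E3) × Y => ρ p.2 * Φ p.2 p.1) (volume.prod μ) := by
  refine Integrable.mono' ((integrable_decay N).mul_prod hB) ?_ (Eventually.of_forall fun p => ?_)
  · exact hρ.comp_snd.mul
      (hΦ.comp measurable_swap).aestronglyMeasurable
  · exact (hbound p.2 p.1).trans_eq (mul_comm _ _)

omit [SFinite μ] in
theorem integrable_mollified_kernel {N : ℕ} (hη : Measurable η) (hρ : AEStronglyMeasurable ρ μ)
    {Φ : Y → (Fin N → E3) → ℂ} (hΦ : Measurable (Function.uncurry Φ)) (hB : Integrable B μ)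
    (hbound : ∀ y k, ‖ρ y * Φ y k‖ ≤ B y * decay k) {ε : ℝ} (hε : 0 < ε) (s t : Finset (Fin N)) :
    Integrable (fun p : (Fin N → E3) × Y => (heat ε (labelSum p.1 s - η p.2) : ℂ) *
      (heat ε (labelSum p.1 t + η p.2) : ℂ) * (ρ p.2 * Φ p.2 p.1)) (volume.prod μ) := by
  have hh := (continuous_heat ε).measurable
  have hk := (continuous_labelSum s).measurable
  have hk' := (continuous_labelSum t).measurable
  refine (integrable_kernel hρ hΦ hB hbound).bdd_mul (c := heat ε 0 * heat ε 0)
    (Measurable.aestronglyMeasurable (by fun_prop)) (Eventually.of_forall fun p => ?_)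
  rw [norm_mul, Complex.norm_real, Complex.norm_real, Real.norm_of_nonneg (heat_nonneg hε _),
    Real.norm_of_nonneg (heat_nonneg hε _)]
  have h0 := heat_nonneg hε 0
  gcongr
  · exact heat_nonneg hε _
  · exact heat_le hε _
  · exact heat_le hε _

variable {m : ℕ} (r : Fin (m + 1)) {s : Finset (Fin (m + 2))} (hs : (0 : Fin (m + 2)) ∈ s)
  (hr : r.succ ∉ s) (hη : Measurable η) (hρ : AEStronglyMeasurable ρ μ)
  {Φ : Y → (Fin (m + 2) → E3) → ℂ} (hΦ : Measurable (Function.uncurry Φ))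
  (hΦc : ∀ y, Continuous (Φ y)) (hB : Integrable B μ) (hB0 : ∀ y, 0 ≤ B y)
  (hbound : ∀ y k, ‖ρ y * Φ y k‖ ≤ B y * decay k)

include hs hr hη hρ hΦ hΦc hB hB0 hbound

/-- The integral over `k` is taken first, so that the heat kernels are used up before absolute
values in `y`; this is what makes the bound independent of `ε`. -/
theorem norm_mollified_kernel_le {ε : ℝ} (hε : 0 < ε) :
    ‖∫ k, ∫ y, (heat ε (labelSum k s - η y) : ℂ) * (heat ε (labelSum k sᶜ + η y) : ℂ) *
      (ρ y * Φ y k) ∂μ‖ ≤ (∫ y, B y ∂μ) * ∫ z : Fin m → E3, decay z := by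
  have hI := integrable_mollified_kernel hη hρ hΦ hB hbound hε s sᶜ
  rw [integral_integral_swap hI, ← integral_mul_const]
  refine norm_integral_le_of_norm_le (hB.mul_const _) (Eventually.of_forall fun y => ?_)
  have hc := hΦc y
  exact norm_mollified_le r hs hr hε (η y) (by fun_prop) (hB0 y) (hbound y)

theorem tendsto_mollified_kernel :
    Tendsto (fun ε : ℝ => ∫ k, ∫ y, (heat ε (labelSum k s - η y) : ℂ) *
      (heat ε (labelSum k sᶜ + η y) : ℂ) * (ρ y * Φ y k) ∂μ) (𝓝[>] 0)
      (𝓝 (∫ y, (∫ z : Fin m → E3,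
        ρ y * Φ y (fiberPoint r (z, -(baseSum r sᶜ z + η y)))) ∂μ)) := by
  have heq : ∀ ε ∈ Set.Ioi (0 : ℝ), ∫ y, (∫ k, (heat ε (labelSum k s - η y) : ℂ) *
      (heat ε (labelSum k sᶜ + η y) : ℂ) * (ρ y * Φ y k)) ∂μ =
      ∫ k, ∫ y, (heat ε (labelSum k s - η y) : ℂ) * (heat ε (labelSum k sᶜ + η y) : ℂ) *
      (ρ y * Φ y k) ∂μ := fun ε hε =>
    (integral_integral_swap (integrable_mollified_kernel hη hρ hΦ hB hbound hε s sᶜ)).symm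
  refine Tendsto.congr' (eventually_nhdsWithin_of_forall heq) ?_
  refine tendsto_integral_filter_of_dominated_convergence
    (fun y => B y * ∫ z : Fin m → E3, decay z) ?_ ?_ (hB.mul_const _) ?_
  · exact eventually_nhdsWithin_of_forall fun ε hε =>
      (integrable_mollified_kernel hη hρ hΦ hB hbound hε s sᶜ).swap.integral_prod_left
        |>.aestronglyMeasurable
  · refine eventually_nhdsWithin_of_forall fun ε hε => Eventually.of_forall fun y => ?_
    have hc := hΦc y
    exact norm_mollified_le r hs hr hε (η y) (by fun_prop) (hB0 y) (hbound y)
  · refine Eventually.of_forall fun y => ?_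
    have hc := hΦc y
    exact tendsto_mollified r hs hr (η y) (by fun_prop) (hB0 y) (hbound y)

end Kernel

/-! ### Limits as integrals over wave vectors with vanishing sum -/

theorem injective_fiberPoint {m : ℕ} (r : Fin (m + 1)) :
    Function.Injective (fiberPoint (m := m) r) := by
  rintro ⟨z, v⟩ ⟨z', v'⟩ h
  have h1 := (Fin.cons_inj.1 h).2
  have h2 := (Fin.insertNth_inj (p := r)).1 h1
  exact Prod.ext h2.2 h2.1

/-- The separation variables `y` in terms of their tail and of the wave vector of the label
`r.succ`. -/
def shearPoint {m : ℕ} (r : Fin (m + 1)) (s : Finset (Fin (m + 2))) {j : ℕ}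
    (w : ((Fin m → E3) × E3) × (Fin j → E3)) : (Fin m → E3) × (Fin (j + 1) → E3) :=
  (w.1.1, Fin.cons (-(baseSum r sᶜ w.1.1 + w.1.2) - ∑ i, w.2 i) w.2)

/-- For fixed labels `z` and fixed tail, the first separation variable is a reflected translate of
the wave vector of `r.succ`. -/
theorem measurePreserving_shearPoint {m : ℕ} (r : Fin (m + 1)) (s : Finset (Fin (m + 2))) (j : ℕ) :
    MeasurePreserving (shearPoint r s (j := j)) volume volume := by
  have hb := (continuous_baseSum r sᶜ).measurable
  have hg : ∀ z : Fin m → E3, MeasurePreserving (fun p : E3 × (Fin j → E3) =>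
      (Fin.cons (-(baseSum r sᶜ z + p.1) - ∑ i, p.2 i) p.2 : Fin (j + 1) → E3)) volume volume := by
    intro z
    have h1 := measurePreserving_prod_sub (volume : Measure (Fin j → E3))
      (c := fun y => ∑ i, y i + baseSum r sᶜ z) (by fun_prop)
    have h2 := (MeasurePreserving.id (volume : Measure (Fin j → E3))).prod
      (Measure.measurePreserving_neg (volume : Measure E3))
    have h := (measurePreserving_insertNth (0 : Fin (j + 1))).comp
      (h1.comp (h2.comp Measure.measurePreserving_swap))
    convert! h using 1
    funext p
    simp only [Function.comp, Prod.map, Prod.swap, id, Fin.insertNth_zero', neg_add]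
    congr 1
    abel
  have h := (MeasurePreserving.id (volume : Measure (Fin m → E3))).skew_product
    (μc := (volume : Measure (E3 × (Fin j → E3)))) (μd := volume) (g := fun z p =>
      (Fin.cons (-(baseSum r sᶜ z + p.1) - ∑ i, p.2 i) p.2 : Fin (j + 1) → E3))
    (by
      have h0 := continuous_baseSum r sᶜ
      exact Continuous.measurable (by unfold Function.uncurry; fun_prop))
    (Eventually.of_forall fun z => (hg z).map_eq)
  exact h.comp (measurePreserving_prodAssoc volume volume volume)

section

variable {m j : ℕ} (r : Fin (m + 1)) {s : Finset (Fin (m + 2))} (hs : (0 : Fin (m + 2)) ∈ s)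
  (hr : r.succ ∉ s) {ρ : (Fin (j + 1) → E3) → ℂ} (hρ : AEStronglyMeasurable ρ)
  {Φ : (Fin (j + 1) → E3) → (Fin (m + 2) → E3) → ℂ} (hΦ : Measurable (Function.uncurry Φ))
  {B : (Fin (j + 1) → E3) → ℝ} (hB : Integrable B) (hB0 : ∀ y, 0 ≤ B y)
  (hbound : ∀ y k, ‖ρ y * Φ y k‖ ≤ B y * decay k)

include hρ hΦ hB hB0 hbound

theorem integrable_kernel_fiberPoint :
    Integrable fun p : (Fin m → E3) × (Fin (j + 1) → E3) =>
      ρ p.2 * Φ p.2 (fiberPoint r (p.1, -(baseSum r sᶜ p.1 + ∑ i, p.2 i))) := by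
  have hf := (continuous_fiberPoint r).measurable
  have hb := (continuous_baseSum r sᶜ).measurable
  refine Integrable.mono' ((integrable_decay m).mul_prod hB) ?_
    (Eventually.of_forall fun p => ?_)
  · refine hρ.comp_snd.mul (Measurable.aestronglyMeasurable ?_)
    exact hΦ.comp (measurable_snd.prodMk (hf.comp (by fun_prop)))
  · refine (hbound _ _).trans ?_
    rw [mul_comm]
    gcongr
    · exact hB0 _
    · exact decay_fiberPoint_le r _

include hs hr

omit hρ hΦ hB hB0 hbound in
-- Momentum conservation: in these coordinates the sum of all separation variables is `k_s`, so the
-- first one is `k_s` minus the sum of the tail.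
theorem shear_kernel_eq (w : ((Fin m → E3) × E3) × (Fin j → E3)) :
    ρ (shearPoint r s w).2 * Φ (shearPoint r s w).2 (fiberPoint r ((shearPoint r s w).1,
      -(baseSum r sᶜ (shearPoint r s w).1 + ∑ i, (shearPoint r s w).2 i))) =
    ρ (Fin.cons (labelSum (fiberPoint r w.1) s - ∑ i, w.2 i) w.2) *
      Φ (Fin.cons (labelSum (fiberPoint r w.1) s - ∑ i, w.2 i) w.2) (fiberPoint r w.1) := by
  obtain ⟨⟨z, v⟩, y⟩ := w
  have h : -(baseSum r sᶜ z + ∑ i, (Fin.cons (-(baseSum r sᶜ z + v) - ∑ i, y i) y :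
      Fin (j + 1) → E3) i) = v := by
    rw [Fin.sum_univ_succ]
    simp
  simp only [shearPoint, labelSum_fiberPoint r hs hr, h]

/-- The first separation variable is traded for the wave vector of `r.succ`. The outcome is
symmetric in the labels again: neither the measure nor the integrand on the right refers to `r`. -/
theorem integrable_kernel_diracSum :
    Integrable (fun p : (Fin (m + 2) → E3) × (Fin j → E3) =>
      ρ (Fin.cons (labelSum p.1 s - ∑ i, p.2 i) p.2) *
        Φ (Fin.cons (labelSum p.1 s - ∑ i, p.2 i) p.2) p.1)
      ((diracSum (m + 1)).prod volume) ∧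
    ∫ y, (∫ z : Fin m → E3, ρ y * Φ y (fiberPoint r (z, -(baseSum r sᶜ z + ∑ i, y i)))) =
      ∫ k, (∫ y : Fin j → E3, ρ (Fin.cons (labelSum k s - ∑ i, y i) y) *
        Φ (Fin.cons (labelSum k s - ∑ i, y i) y) k) ∂diracSum (m + 1) := by
  have hW := integrable_kernel_fiberPoint (s := s) r hρ hΦ hB hB0 hbound
  have hQ := measurePreserving_shearPoint r s j
  have hQW := hQ.integrable_comp_of_integrable hW
  have hE := (measurePreserving_fiberPoint r).prod
    (MeasurePreserving.id (volume : Measure (Fin j → E3)))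
  have hemb : MeasurableEmbedding (Prod.map (fiberPoint r) (id : (Fin j → E3) → (Fin j → E3))) :=
    (((continuous_fiberPoint r).prodMap continuous_id).measurableEmbedding
      ((injective_fiberPoint r).prodMap Function.injective_id))
  have hX : Integrable (fun p : (Fin (m + 2) → E3) × (Fin j → E3) =>
      ρ (Fin.cons (labelSum p.1 s - ∑ i, p.2 i) p.2) *
        Φ (Fin.cons (labelSum p.1 s - ∑ i, p.2 i) p.2) p.1)
      ((diracSum (m + 1)).prod volume) := by
    rw [← hE.integrable_comp_emb hemb]
    refine hQW.congr (Eventually.of_forall fun w => ?_)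
    exact shear_kernel_eq r hs hr w
  refine ⟨hX, ?_⟩
  rw [← integral_prod _ hX, ← hE.integral_comp hemb]
  have h1 : ∫ y, (∫ z : Fin m → E3, ρ y * Φ y (fiberPoint r (z, -(baseSum r sᶜ z + ∑ i, y i)))) =
      ∫ p : (Fin m → E3) × (Fin (j + 1) → E3),
        ρ p.2 * Φ p.2 (fiberPoint r (p.1, -(baseSum r sᶜ p.1 + ∑ i, p.2 i))) := by
    rw [Measure.volume_eq_prod, integral_prod_symm _ hW]
  rw [h1, ← hQ.map_eq, integral_map hQ.measurable.aemeasurable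
    (by rw [hQ.map_eq]; exact hW.aestronglyMeasurable)]
  refine integral_congr_ae (Eventually.of_forall fun w => ?_)
  exact shear_kernel_eq r hs hr w

end

/-! ### Words of correlation factors -/

/-- The geometric part of the Fourier density of a factor. -/
def factorGeom (α : ℝ) (K L : E3) : CorrFactor → E3 → ℝ
  | CorrFactor.dd, _ => 1
  | CorrFactor.dp, h => -α * (inner ℝ L h / ‖h‖ ^ 2)
  | CorrFactor.pd, h => α * (inner ℝ K h / ‖h‖ ^ 2)
  | CorrFactor.pp, h => -α ^ 2 * ((inner ℝ K h / ‖h‖ ^ 2) * (inner ℝ L h / ‖h‖ ^ 2))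

theorem factorWeight_eq (α : ℝ) (P : ℝ → ℝ) (K L : E3) (a : CorrFactor) (h : E3) :
    factorWeight α P K L a h = factorGeom α K L a h * P ‖h‖ := by
  cases a <;> simp [factorWeight, factorGeom]

theorem measurable_factorGeom {X : Type*} [MeasurableSpace X] (α : ℝ) (a : CorrFactor)
    {K L h : X → E3} (hK : Measurable K) (hL : Measurable L) (hh : Measurable h) :
    Measurable fun x => factorGeom α (K x) (L x) a (h x) := by
  cases a <;> simp only [factorGeom] <;> fun_prop

theorem continuous_factorGeom {X : Type*} [TopologicalSpace X] (α : ℝ) (a : CorrFactor)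
    {K L : X → E3} (hK : Continuous K) (hL : Continuous L) (h : E3) :
    Continuous fun x => factorGeom α (K x) (L x) a h := by
  cases a <;> simp only [factorGeom] <;> fun_prop

/-- The Fourier density of a product of factors. -/
def wordWeight (α : ℝ) (P : ℝ → ℝ) (K L : E3) {j : ℕ} (w : Fin j → CorrFactor) (y : Fin j → E3) :
    ℝ :=
  ∏ i, factorWeight α P K L (w i) (y i)

/-- Only the sum of the separation variables enters the phase, so a whole word is treated like a
single Fourier integral with `η y = Σ y`. -/
theorem prod_factorValue {P : ℝ → ℝ} (α : ℝ) (K L : E3) {j : ℕ} (w : Fin j → CorrFactor) (x : E3) :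
    ∏ i, factorValue α P K L (w i) x =
      ∫ y : Fin j → E3, Complex.exp (Complex.I * (inner ℝ (∑ i, y i) x : ℝ)) *
        (((2 * Real.pi) ^ 3 : ℂ)⁻¹ ^ j * (wordWeight α P K L w y : ℂ)) := by
  have h := integral_fintype_prod_eq_prod (𝕜 := ℂ) (ι := Fin j) (E := fun _ => E3)
    (μ := fun _ => volume) (fun i h => Complex.exp (Complex.I * (inner ℝ h x : ℝ)) *
      (factorWeight α P K L (w i) h : ℂ))
  simp only [factorValue, Finset.prod_mul_distrib, Finset.prod_const, Finset.card_univ,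
    Fintype.card_fin]
  rw [← h, ← integral_const_mul]
  refine integral_congr_ae (Eventually.of_forall fun y => ?_)
  simp only [Finset.prod_mul_distrib, ← Complex.exp_sum, ← Finset.mul_sum, sum_inner, wordWeight]
  push_cast
  ring

theorem integrable_wordWeight {P : ℝ → ℝ} (h0 : Integrable (fun h : E3 => P ‖h‖))
    (h2 : Integrable (fun h : E3 => P ‖h‖ / ‖h‖ ^ 2)) (α : ℝ) (K L : E3) {j : ℕ}
    (w : Fin j → CorrFactor) : Integrable (wordWeight α P K L w) :=
  Integrable.fintype_prod (f := fun i h => factorWeight α P K L (w i) h) fun i =>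
    integrable_factorWeight h0 h2 α K L (w i)

theorem abs_wordWeight_le (α : ℝ) (P : ℝ → ℝ) (K L : E3) {j : ℕ} (w : Fin j → CorrFactor)
    (y : Fin j → E3) : |wordWeight α P K L w y| ≤
      (∏ i, factorGrowth K L (w i)) * ∏ i, ((1 + α ^ 2) * spectralMajorant P (y i)) := by
  rw [wordWeight, Finset.abs_prod, ← Finset.prod_mul_distrib]
  refine Finset.prod_le_prod (fun _ _ => abs_nonneg _) fun i _ => ?_
  refine (abs_factorWeight_le α P K L (w i) (y i)).trans_eq ?_
  ring

/-- The contribution of a product of factors to the regularized cumulant for the label grouping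
`(s; sᶜ)`. -/
def wordTerm {n : ℕ} (α σ : ℝ) (P : ℝ → ℝ) (g : Fin n → ℝ) (s : Finset (Fin n)) {j : ℕ}
    (w : Fin j → CorrFactor) (ε : ℝ) (k : Fin n → E3) : ℂ :=
  (damping σ g k s sᶜ : ℂ) * separationIntegral ε (labelSum k s) (labelSum k sᶜ) (fun x =>
    ∏ i, factorValue α P (weightedLabelSum g k s) (weightedLabelSum g k sᶜ) (w i) x)

/-- The damped Fourier density of a product of factors. -/
def dampedWeight {n : ℕ} (α σ : ℝ) (P : ℝ → ℝ) (g : Fin n → ℝ) (s : Finset (Fin n)) {j : ℕ}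
    (w : Fin j → CorrFactor) (k : Fin n → E3) (y : Fin j → E3) : ℝ :=
  damping σ g k s sᶜ * wordWeight α P (weightedLabelSum g k s) (weightedLabelSum g k sᶜ) w y

/-- The limit of `wordTerm` as a distribution in the wave vectors, with the first separation variable
fixed by momentum conservation. -/
def wordLimit {n : ℕ} (α σ : ℝ) (P : ℝ → ℝ) (g : Fin (n + 1) → ℝ) (s : Finset (Fin (n + 1)))
    {j : ℕ} (w : Fin (j + 1) → CorrFactor) (φ : 𝓢(Fin (n + 1) → E3, ℂ)) : ℂ :=
  (2 * Real.pi) ^ 6 * ((2 * Real.pi) ^ 3 : ℂ)⁻¹ ^ (j + 1) *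
    ∫ k, (∫ y : Fin j → E3,
      (dampedWeight α σ P g s w k (Fin.cons (labelSum k s - ∑ i, y i) y) : ℂ) * φ k) ∂diracSum n

theorem continuous_damping {n : ℕ} (σ : ℝ) (g : Fin n → ℝ) (s t : Finset (Fin n)) :
    Continuous fun k => damping σ g k s t := by
  have h1 := continuous_weightedLabelSum g s
  have h2 := continuous_weightedLabelSum g t
  unfold damping
  fun_prop

theorem damping_pos {n : ℕ} (σ : ℝ) (g : Fin n → ℝ) (k : Fin n → E3) (s t : Finset (Fin n)) :
    0 < damping σ g k s t := Real.exp_pos _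

theorem wordTerm_eq {P : ℝ → ℝ} (h0 : Integrable (fun h : E3 => P ‖h‖))
    (h2 : Integrable (fun h : E3 => P ‖h‖ / ‖h‖ ^ 2)) {n : ℕ} (α σ : ℝ) (g : Fin n → ℝ)
    (s : Finset (Fin n)) {j : ℕ} (w : Fin j → CorrFactor) {ε : ℝ} (hε : 0 < ε) (k : Fin n → E3) :
    wordTerm α σ P g s w ε k = (2 * Real.pi) ^ 6 * ((2 * Real.pi) ^ 3 : ℂ)⁻¹ ^ j *
      ∫ y, (heat ε (labelSum k s - ∑ i, y i) : ℂ) * (heat ε (labelSum k sᶜ + ∑ i, y i) : ℂ) *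
        (dampedWeight α σ P g s w k y : ℂ) := by
  simp only [wordTerm, prod_factorValue]
  rw [separationIntegral_fourier volume hε _ _ (η := fun y : Fin j → E3 => ∑ i, y i) (by fun_prop)
    (U := fun y => ((2 * Real.pi) ^ 3 : ℂ)⁻¹ ^ j * (wordWeight α P (weightedLabelSum g k s)
      (weightedLabelSum g k sᶜ) w y : ℂ))
    ((integrable_wordWeight h0 h2 α _ _ w).ofReal.const_mul _), ← mul_assoc, mul_comm, mul_assoc]
  rw [← integral_const_mul, ← integral_const_mul, ← integral_mul_const]
  refine integral_congr_ae (Eventually.of_forall fun y => ?_)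
  simp only [dampedWeight]
  push_cast
  ring

section Word

variable {P : ℝ → ℝ} (h0 : Integrable (fun h : E3 => P ‖h‖))
  (h2 : Integrable (fun h : E3 => P ‖h‖ / ‖h‖ ^ 2)) {n : ℕ} (α σ : ℝ) (g : Fin n → ℝ)
  (s : Finset (Fin n)) {j : ℕ} (w : Fin j → CorrFactor)

/-- The part of the damped Fourier density that depends on the wave vectors. -/
def wordKernel (α σ : ℝ) (g : Fin n → ℝ) (s : Finset (Fin n)) (w : Fin j → CorrFactor)
    (φ : (Fin n → E3) → ℂ) (y : Fin j → E3) (k : Fin n → E3) : ℂ :=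
  (damping σ g k s sᶜ : ℂ) *
    ((∏ i, factorGeom α (weightedLabelSum g k s) (weightedLabelSum g k sᶜ) (w i) (y i) : ℝ) : ℂ) *
      φ k

/-- The spectrum is only almost everywhere measurable. It is split off as a function of `y` alone,
leaving a kernel that is jointly measurable and continuous in `k`. -/
theorem wordKernel_eq (φ : (Fin n → E3) → ℂ) (y : Fin j → E3) (k : Fin n → E3) :
    ((∏ i, P ‖y i‖ : ℝ) : ℂ) * wordKernel α σ g s w φ y k =
      (dampedWeight α σ P g s w k y : ℂ) * φ k := by
  simp only [wordKernel, dampedWeight, wordWeight, factorWeight_eq, Finset.prod_mul_distrib]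
  push_cast
  ring

theorem measurable_wordKernel {φ : (Fin n → E3) → ℂ} (hφ : Continuous φ) :
    Measurable (Function.uncurry (wordKernel α σ g s w φ)) := by
  have hsnd : Measurable (Prod.snd : (Fin j → E3) × (Fin n → E3) → Fin n → E3) := measurable_snd
  have hd := (continuous_damping σ g s sᶜ).measurable.comp hsnd
  have h1 := (continuous_weightedLabelSum g s).measurable.comp hsnd
  have h2 := (continuous_weightedLabelSum g sᶜ).measurable.comp hsnd
  have hφ' := hφ.measurable.comp hsnd
  have hp : Measurable fun p : (Fin j → E3) × (Fin n → E3) =>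
      ∏ i, factorGeom α (weightedLabelSum g p.2 s) (weightedLabelSum g p.2 sᶜ) (w i) (p.1 i) := by
    refine Finset.measurable_prod _ fun i _ => ?_
    exact measurable_factorGeom α (w i) h1 h2 ((measurable_pi_apply i).comp measurable_fst)
  exact ((Complex.measurable_ofReal.comp hd).mul (Complex.measurable_ofReal.comp hp)).mul hφ'

theorem continuous_wordKernel {φ : (Fin n → E3) → ℂ} (hφ : Continuous φ) (y : Fin j → E3) :
    Continuous (wordKernel α σ g s w φ y) := by
  have hd := continuous_damping σ g s sᶜ
  have h1 := continuous_weightedLabelSum g s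
  have h2 := continuous_weightedLabelSum g sᶜ
  have hp : Continuous fun k : Fin n → E3 =>
      ∏ i, factorGeom α (weightedLabelSum g k s) (weightedLabelSum g k sᶜ) (w i) (y i) := by
    refine continuous_finsetProd _ fun i _ => ?_
    exact continuous_factorGeom α (w i) h1 h2 (y i)
  unfold wordKernel
  fun_prop

theorem prod_spectral_nonneg (P : ℝ → ℝ) (y : Fin j → E3) :
    0 ≤ ∏ i, ((1 + α ^ 2) * spectralMajorant P (y i)) :=
  Finset.prod_nonneg fun i _ => mul_nonneg (by positivity) (spectralMajorant_nonneg P _)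

theorem prod_factorGrowth_nonneg (K L : E3) : 0 ≤ ∏ i, factorGrowth K L (w i) :=
  Finset.prod_nonneg fun _ _ => factorGrowth_nonneg K L _

variable {G : ℝ} (hG : ∀ k, damping σ g k s sᶜ *
  ∏ i, factorGrowth (weightedLabelSum g k s) (weightedLabelSum g k sᶜ) (w i) ≤ G)

include hG in
theorem abs_dampedWeight_le (k : Fin n → E3) (y : Fin j → E3) :
    |dampedWeight α σ P g s w k y| ≤ G * ∏ i, ((1 + α ^ 2) * spectralMajorant P (y i)) := by
  rw [dampedWeight, abs_mul, abs_of_pos (damping_pos _ _ _ _ _)]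
  calc _ ≤ damping σ g k s sᶜ * ((∏ i, factorGrowth (weightedLabelSum g k s)
        (weightedLabelSum g k sᶜ) (w i)) * ∏ i, ((1 + α ^ 2) * spectralMajorant P (y i))) := by
        gcongr
        · exact (damping_pos _ _ _ _ _).le
        · exact abs_wordWeight_le _ _ _ _ _ _
    _ ≤ _ := by
        rw [← mul_assoc]
        exact mul_le_mul_of_nonneg_right (hG k) (prod_spectral_nonneg α P y)

include hG in
theorem wordGrowth_nonneg : 0 ≤ G :=
  (mul_nonneg (damping_pos σ g 0 s sᶜ).le (prod_factorGrowth_nonneg w _ _)).trans (hG 0)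

include h0 h2

theorem integrable_prod_spectral :
    Integrable fun y : Fin j → E3 => ∏ i, ((1 + α ^ 2) * spectralMajorant P (y i)) :=
  Integrable.fintype_prod fun _ => (integrable_spectralMajorant h0 h2).const_mul _

omit h0 h2 in
theorem integral_prod_spectral :
    ∫ y : Fin j → E3, ∏ i, ((1 + α ^ 2) * spectralMajorant P (y i)) =
      ((1 + α ^ 2) * ∫ h, spectralMajorant P h) ^ j := by
  have h := integral_fintype_prod_eq_prod (𝕜 := ℝ) (ι := Fin j) (E := fun _ => E3)
    (μ := fun _ => volume) (fun _ h => (1 + α ^ 2) * spectralMajorant P h)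
  refine h.trans ?_
  simp [integral_const_mul]

omit h2 in
theorem aestronglyMeasurable_prod_spectrum :
    AEStronglyMeasurable fun y : Fin j → E3 => ((∏ i, P ‖y i‖ : ℝ) : ℂ) :=
  (Integrable.fintype_prod (f := fun (_ : Fin j) (h : E3) => P ‖h‖) fun _ => h0).ofReal
    |>.aestronglyMeasurable

include hG in
-- A bound pointwise in `k`, at the price of `heat ε 0 ^ 2`, which blows up as `ε → 0`. It serves
-- only to exchange series and integral at fixed `ε`.
theorem norm_wordTerm_le {ε : ℝ} (hε : 0 < ε) (k : Fin n → E3) :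
    ‖wordTerm α σ P g s w ε k‖ ≤ (2 * Real.pi) ^ 6 * (heat ε 0 ^ 2 *
      (G * ((1 + α ^ 2) * ∫ h, spectralMajorant P h) ^ j)) := by
  have hpi : (1 : ℝ) ≤ 2 * Real.pi := by nlinarith [Real.pi_gt_three]
  rw [wordTerm_eq h0 h2 α σ g s w hε, ← integral_prod_spectral, norm_mul, norm_mul]
  have h6 : ‖((2 * Real.pi) ^ 6 : ℂ)‖ = (2 * Real.pi) ^ 6 := by
    rw [norm_pow]; simp [Real.pi_pos.le]
  have h3 : ‖((2 * Real.pi) ^ 3 : ℂ)⁻¹ ^ j‖ ≤ 1 := by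
    rw [norm_pow, norm_inv, norm_pow]
    refine pow_le_one₀ (by positivity) (inv_le_one_of_one_le₀ (one_le_pow₀ ?_))
    simpa [abs_of_pos Real.pi_pos] using hpi
  rw [h6]
  refine mul_le_mul (mul_le_of_le_one_right (by positivity) h3) ?_ (norm_nonneg _) (by positivity)
  rw [← integral_const_mul, ← integral_const_mul]
  refine norm_integral_le_of_norm_le
    (((integrable_prod_spectral h0 h2 α).const_mul _).const_mul _) (Eventually.of_forall fun y => ?_)
  rw [norm_mul, norm_mul, Complex.norm_real, Complex.norm_real, Complex.norm_real,
    Real.norm_of_nonneg (heat_nonneg hε _), Real.norm_of_nonneg (heat_nonneg hε _), sq]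
  have hh := heat_nonneg hε 0
  gcongr
  · exact heat_nonneg hε _
  · exact heat_le hε _
  · exact heat_le hε _
  · exact abs_dampedWeight_le α σ g s w hG k y

variable (φ : 𝓢(Fin n → E3, ℂ))

omit h0 h2 in
theorem exists_decay_bound : ∃ C : ℝ, 0 ≤ C ∧ ∀ k, ‖φ k‖ ≤ C * decay k := by
  obtain ⟨C, hC, h⟩ := exists_norm_le_decay φ 0
  exact ⟨C, hC, fun k => by simpa using h k⟩

variable {C : ℝ} (hC0 : 0 ≤ C) (hC : ∀ k, ‖φ k‖ ≤ C * decay k)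

include hG hC

omit h0 h2 hC in
theorem norm_wordKernel_le (φ : (Fin n → E3) → ℂ) (hC : ∀ k, ‖φ k‖ ≤ C * decay k)
    (y : Fin j → E3) (k : Fin n → E3) :
    ‖((∏ i, P ‖y i‖ : ℝ) : ℂ) * wordKernel α σ g s w φ y k‖ ≤
      (C * G * ∏ i, ((1 + α ^ 2) * spectralMajorant P (y i))) * decay k := by
  rw [wordKernel_eq, norm_mul, Complex.norm_real, Real.norm_eq_abs]
  calc _ ≤ (G * ∏ i, ((1 + α ^ 2) * spectralMajorant P (y i))) * (C * decay k) :=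
        mul_le_mul (abs_dampedWeight_le α σ g s w hG k y) (hC k) (norm_nonneg _)
          (mul_nonneg (wordGrowth_nonneg σ g s w hG) (prod_spectral_nonneg α P y))
    _ = _ := by ring

omit hC hG in
theorem wordTerm_mul_eq {ε : ℝ} (hε : 0 < ε) (k : Fin n → E3) :
    wordTerm α σ P g s w ε k * φ k = (2 * Real.pi) ^ 6 * ((2 * Real.pi) ^ 3 : ℂ)⁻¹ ^ j *
      ∫ y : Fin j → E3, (heat ε (labelSum k s - ∑ i, y i) : ℂ) *
        (heat ε (labelSum k sᶜ + ∑ i, y i) : ℂ) *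
        (((∏ i, P ‖y i‖ : ℝ) : ℂ) * wordKernel α σ g s w φ y k) := by
  rw [wordTerm_eq h0 h2 α σ g s w hε, mul_assoc, ← integral_mul_const]
  congr 1
  refine integral_congr_ae (Eventually.of_forall fun y => ?_)
  simp only [wordKernel_eq]
  ring

theorem integrable_wordTerm {ε : ℝ} (hε : 0 < ε) :
    Integrable fun k => wordTerm α σ P g s w ε k * φ k := by
  simp_rw [wordTerm_mul_eq h0 h2 α σ g s w φ hε]
  exact (integrable_mollified_kernel (μ := volume) (η := fun y : Fin j → E3 => ∑ i, y i) (by fun_prop)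
    (aestronglyMeasurable_prod_spectrum h0) (measurable_wordKernel α σ g s w φ.continuous)
    ((integrable_prod_spectral h0 h2 α).const_mul (C * G))
    (norm_wordKernel_le α σ g s w hG φ hC) hε s sᶜ).integral_prod_left.const_mul _

end Word

/-! ### Bounds uniform in the convergence factor, and limits of words -/

section WordLimit

variable {P : ℝ → ℝ} (h0 : Integrable (fun h : E3 => P ‖h‖))
  (h2 : Integrable (fun h : E3 => P ‖h‖ / ‖h‖ ^ 2)) {m : ℕ} (α σ : ℝ) (g : Fin (m + 2) → ℝ)
  (r : Fin (m + 1)) {s : Finset (Fin (m + 2))} (hs : (0 : Fin (m + 2)) ∈ s)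
  (hr : r.succ ∉ s) {j : ℕ} (w : Fin (j + 1) → CorrFactor)
  {G : ℝ} (hG : ∀ k, damping σ g k s sᶜ *
    ∏ i, factorGrowth (weightedLabelSum g k s) (weightedLabelSum g k sᶜ) (w i) ≤ G)
  (φ : 𝓢(Fin (m + 2) → E3, ℂ)) {C : ℝ} (hC0 : 0 ≤ C) (hC : ∀ k, ‖φ k‖ ≤ C * decay k)

include h0 h2 hs hr hG hC0 hC

/-- Integrating over the wave vectors absorbs both heat kernels, so this bound, unlike the pointwise
one, survives the limit `ε → 0`. -/
theorem norm_integral_wordTerm_le {ε : ℝ} (hε : 0 < ε) :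
    ‖∫ k, wordTerm α σ P g s w ε k * φ k‖ ≤ (2 * Real.pi) ^ 6 * (C * G *
      ((1 + α ^ 2) * ∫ h, spectralMajorant P h) ^ (j + 1) * ∫ z : Fin m → E3, decay z) := by
  have hpi : (1 : ℝ) ≤ 2 * Real.pi := by nlinarith [Real.pi_gt_three]
  simp_rw [wordTerm_mul_eq h0 h2 α σ g s w φ hε]
  rw [integral_const_mul, norm_mul, norm_mul]
  have h6 : ‖((2 * Real.pi) ^ 6 : ℂ)‖ = (2 * Real.pi) ^ 6 := by
    rw [norm_pow]; simp [Real.pi_pos.le]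
  have h3 : ‖((2 * Real.pi) ^ 3 : ℂ)⁻¹ ^ (j + 1)‖ ≤ 1 := by
    rw [norm_pow, norm_inv, norm_pow]
    refine pow_le_one₀ (by positivity) (inv_le_one_of_one_le₀ (one_le_pow₀ ?_))
    simpa [abs_of_pos Real.pi_pos] using hpi
  rw [h6]
  refine mul_le_mul (mul_le_of_le_one_right (by positivity) h3) ?_ (norm_nonneg _) (by positivity)
  have h := norm_mollified_kernel_le (η := fun y : Fin (j + 1) → E3 => ∑ i, y i) r hs hr (by fun_prop)
    (aestronglyMeasurable_prod_spectrum h0) (measurable_wordKernel α σ g s w φ.continuous)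
    (continuous_wordKernel α σ g s w φ.continuous)
    ((integrable_prod_spectral h0 h2 α).const_mul (C * G))
    (fun y => mul_nonneg (mul_nonneg hC0 (wordGrowth_nonneg σ g s w hG))
      (prod_spectral_nonneg α P y))
    (norm_wordKernel_le α σ g s w hG φ hC) hε
  rwa [integral_const_mul, integral_prod_spectral] at h

omit hC in
-- Stated for continuous functions with a decay bound, because it is also needed with the strictly
-- positive weight `decay` in place of a Schwartz function.
theorem integrable_dampedWeight_diracSum {φ : (Fin (m + 2) → E3) → ℂ} (hφ : Continuous φ)
    (hC : ∀ k, ‖φ k‖ ≤ C * decay k) :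
    Integrable (fun p : (Fin (m + 2) → E3) × (Fin j → E3) =>
      (dampedWeight α σ P g s w p.1 (Fin.cons (labelSum p.1 s - ∑ i, p.2 i) p.2) : ℂ) * φ p.1)
      ((diracSum (m + 1)).prod volume) := by
  have h := (integrable_kernel_diracSum r hs hr (aestronglyMeasurable_prod_spectrum h0)
    (measurable_wordKernel α σ g s w hφ)
    ((integrable_prod_spectral h0 h2 α).const_mul (C * G))
    (fun y => mul_nonneg (mul_nonneg hC0 (wordGrowth_nonneg σ g s w hG))
      (prod_spectral_nonneg α P y))
    (norm_wordKernel_le α σ g s w hG φ hC)).1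
  simpa only [wordKernel_eq] using h

theorem tendsto_integral_wordTerm :
    Tendsto (fun ε : ℝ => ∫ k, wordTerm α σ P g s w ε k * φ k) (𝓝[>] 0)
      (𝓝 (wordLimit α σ P g s w φ)) := by
  have h := (integrable_kernel_diracSum r hs hr (aestronglyMeasurable_prod_spectrum h0)
    (measurable_wordKernel α σ g s w φ.continuous)
    ((integrable_prod_spectral h0 h2 α).const_mul (C * G))
    (fun y => mul_nonneg (mul_nonneg hC0 (wordGrowth_nonneg σ g s w hG))
      (prod_spectral_nonneg α P y))
    (norm_wordKernel_le α σ g s w hG φ hC)).2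
  have ht := tendsto_mollified_kernel (η := fun y : Fin (j + 1) → E3 => ∑ i, y i) r hs hr
    (by fun_prop)
    (aestronglyMeasurable_prod_spectrum h0) (measurable_wordKernel α σ g s w φ.continuous)
    (continuous_wordKernel α σ g s w φ.continuous)
    ((integrable_prod_spectral h0 h2 α).const_mul (C * G))
    (fun y => mul_nonneg (mul_nonneg hC0 (wordGrowth_nonneg σ g s w hG))
      (prod_spectral_nonneg α P y))
    (norm_wordKernel_le α σ g s w hG φ hC)
  rw [h] at ht
  simp only [wordKernel_eq] at ht
  refine Tendsto.congr' (eventually_nhdsWithin_of_forall fun ε hε => ?_)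
    (ht.const_mul ((2 * Real.pi) ^ 6 * ((2 * Real.pi) ^ 3 : ℂ)⁻¹ ^ (j + 1)))
  simp_rw [wordTerm_mul_eq h0 h2 α σ g s w φ hε]
  rw [integral_const_mul]
  simp only [wordKernel_eq]

theorem norm_wordLimit_le :
    ‖wordLimit α σ P g s w φ‖ ≤ (2 * Real.pi) ^ 6 * (C * G *
      ((1 + α ^ 2) * ∫ h, spectralMajorant P h) ^ (j + 1) * ∫ z : Fin m → E3, decay z) :=
  le_of_tendsto (tendsto_integral_wordTerm h0 h2 α σ g r hs hr w hG φ hC0 hC).norm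
    (eventually_nhdsWithin_of_forall fun _ hε =>
      norm_integral_wordTerm_le h0 h2 α σ g r hs hr w hG φ hC0 hC hε)

end WordLimit

/-! ### The expansion in powers of the power spectrum -/

instance : Fintype CorrFactor where
  elems := {CorrFactor.dd, CorrFactor.dp, CorrFactor.pd, CorrFactor.pp}
  complete a := by cases a <;> simp

theorem sum_corrFactor {M : Type*} [AddCommMonoid M] (f : CorrFactor → M) :
    ∑ a, f a = f CorrFactor.dd + (f CorrFactor.dp + (f CorrFactor.pd + f CorrFactor.pp)) := by
  have : (Finset.univ : Finset CorrFactor) =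
    {CorrFactor.dd, CorrFactor.dp, CorrFactor.pd, CorrFactor.pp} := rfl
  rw [this, Finset.sum_insert (by simp), Finset.sum_insert (by simp), Finset.sum_insert (by simp),
    Finset.sum_singleton]

/-- A factor followed by `m` momentum correlations. -/
def singleWord (a : CorrFactor) (m : ℕ) : Fin (m + 1) → CorrFactor :=
  Fin.cons a fun _ => CorrFactor.pp

/-- Two crossed density-momentum correlations followed by `m` momentum correlations. -/
def crossedWord (m : ℕ) : Fin (m + 2) → CorrFactor :=
  Fin.cons CorrFactor.dp (Fin.cons CorrFactor.pd fun _ => CorrFactor.pp)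

/-- The coefficient of `singleWord a m` in the sum of all connected diagrams. -/
def singleCoeff : CorrFactor → ℕ → ℝ
  | CorrFactor.pp, m => ((m + 1).factorial : ℝ)⁻¹
  | _, m => (m.factorial : ℝ)⁻¹

theorem singleCoeff_nonneg (a : CorrFactor) (m : ℕ) : 0 ≤ singleCoeff a m := by
  cases a <;> simp only [singleCoeff] <;> positivity

theorem singleCoeff_le (a : CorrFactor) (m : ℕ) : singleCoeff a m ≤ (m.factorial : ℝ)⁻¹ := by
  cases a <;> simp only [singleCoeff, le_refl]
  have : (0 : ℝ) < m.factorial := by positivity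
  gcongr
  omega

theorem prod_singleWord {M : Type*} [CommMonoid M] (f : CorrFactor → M) (a : CorrFactor) (m : ℕ) :
    ∏ i, f (singleWord a m i) = f a * f CorrFactor.pp ^ m := by
  rw [Fin.prod_univ_succ]
  simp [singleWord]

theorem prod_crossedWord {M : Type*} [CommMonoid M] (f : CorrFactor → M) (m : ℕ) :
    ∏ i, f (crossedWord m i) = f CorrFactor.dp * (f CorrFactor.pd * f CorrFactor.pp ^ m) := by
  rw [Fin.prod_univ_succ, Fin.prod_univ_succ]
  simp [crossedWord]

/-- The terms of the expansion of the connected two-particle diagrams for the power spectrum `t P`. -/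
def pairSumTerm (α : ℝ) (P : ℝ → ℝ) (t : ℝ) (K L : E3) (m : ℕ) (x : E3) : ℂ :=
  (t : ℂ) ^ (m + 1) * ∑ a, (singleCoeff a m : ℂ) * ∏ i, factorValue α P K L (singleWord a m i) x +
    (t : ℂ) ^ (m + 2) * ((m.factorial : ℝ)⁻¹ : ℝ) * ∏ i, factorValue α P K L (crossedWord m i) x

/-- The `1` in the prefactor, less the empty diagram, leaves `exp - 1` and hence the coefficients
`1/(m+1)!` of pure `pp` words. Every other prefix multiplies the full exponential. The crossed pair
is quadratic in the spectrum, which shifts its power of `t` by one. -/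
theorem hasSum_pairSumTerm {P : ℝ → ℝ} (h0 : Integrable (fun h : E3 => P ‖h‖))
    (h2 : Integrable (fun h : E3 => P ‖h‖ / ‖h‖ ^ 2)) (α t : ℝ) (K L x : E3) :
    HasSum (fun m => pairSumTerm α P t K L m x) (pairSum α (fun y => t * P y) x K L) := by
  have h0' : Integrable (fun h : E3 => t * P ‖h‖) := h0.const_mul t
  have h2' : Integrable (fun h : E3 => t * P ‖h‖ / ‖h‖ ^ 2) := by
    simpa only [mul_div_assoc] using h2.const_mul t
  rw [pairSum_eq h0' h2']
  simp only [factorValue_const_mul, pairSumTerm,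
    prod_singleWord fun a => factorValue α P K L a x,
    prod_crossedWord fun a => factorValue α P K L a x, sum_corrFactor, singleCoeff]
  generalize factorValue α P K L CorrFactor.dd x = d
  generalize factorValue α P K L CorrFactor.dp x = a
  generalize factorValue α P K L CorrFactor.pd x = b
  generalize factorValue α P K L CorrFactor.pp x = w
  have hs1 := hasSum_exp_sub_one ((t : ℂ) * w)
  have hs2 := NormedSpace.exp_series_hasSum_exp' (𝕂 := ℂ) ((t : ℂ) * w)
  rw [← Complex.exp_eq_exp_ℂ] at hs2
  have hs3 := hs1.add (hs2.mul_left (t * a + t * b + t * b * (t * a) + t * d))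
  convert! hs3 using 1
  · funext m
    simp only [smul_eq_mul, mul_pow, pow_succ]
    push_cast
    ring
  · ring

theorem hasSum_separationIntegral {ε : ℝ} (hε : 0 < ε) (k l : E3) {f : ℕ → E3 → ℂ} {F : E3 → ℂ}
    (hf : ∀ m, Continuous (f m)) {b : ℕ → ℝ} (hb : Summable b) (hfb : ∀ m x, ‖f m x‖ ≤ b m)
    (hF : ∀ x, HasSum (fun m => f m x) (F x)) :
    HasSum (fun m => separationIntegral ε k l (f m)) (separationIntegral ε k l F) := by
  have hint := fun m => integrable_separation hε k l (hf m) (hfb m)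
  have hn : ∀ m, ∫ q : Fin 2 → E3, ‖(Real.exp (-ε * ∑ j, ‖q j‖ ^ 2) : ℂ) *
      (Complex.exp (-Complex.I * ((inner ℝ k (q 0) + inner ℝ l (q 1) : ℝ) : ℂ)) *
        f m (q 0 - q 1))‖ ≤ b m * ∫ q : Fin 2 → E3, Real.exp (-ε * ∑ j, ‖q j‖ ^ 2) := by
    intro m
    rw [← integral_const_mul]
    refine integral_mono (hint m).norm ((integrable_gauss_pair hε).const_mul _) fun q => ?_
    simp only
    rw [norm_mul, norm_mul, norm_exp_neg_I_mul, one_mul,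
      Complex.norm_real, Real.norm_of_nonneg (Real.exp_pos _).le, mul_comm]
    gcongr
    exact hfb m _
  have h := hasSum_integral_of_summable_integral_norm hint
    (Summable.of_nonneg_of_le (fun m => integral_nonneg fun q => norm_nonneg _) hn
      (hb.mul_right _))
  have hs : separationIntegral ε k l F = _ :=
    integral_congr_ae (Eventually.of_forall fun q =>
      ((((hF (q 0 - q 1)).mul_left _).mul_left _).tsum_eq).symm)
  rw [hs]
  exact h

/-- Half of the Gaussian is spent on `(a b)^m`, through `u^m ≤ m! e^u` at `u = σ² a b / 2` and `a b
≤ (a² + b²)/2`; the other half controls `1 + a` and `1 + b`. The resulting `m!` is what the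
exponential series cancels. -/
theorem damped_growth_le {σ : ℝ} (hσ : 0 < σ) {a b : ℝ} (ha : 0 ≤ a) (hb : 0 ≤ b) (m : ℕ) :
    Real.exp (-(σ ^ 2 / 2) * (a ^ 2 + b ^ 2)) * ((1 + a) * (1 + b) * (a * b) ^ m) ≤
      (2 + 4 / σ ^ 2) ^ 2 * (2 / σ ^ 2) ^ m * m.factorial := by
  have h1 : ∀ t : ℝ, (1 + t) ≤ (2 + 4 / σ ^ 2) * Real.exp (σ ^ 2 * t ^ 2 / 4) := by
    intro t
    have he := Real.add_one_le_exp (σ ^ 2 * t ^ 2 / 4)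
    calc 1 + t ≤ (2 + 4 / σ ^ 2) * (σ ^ 2 * t ^ 2 / 4 + 1) := by
          have : (2 + 4 / σ ^ 2) * (σ ^ 2 * t ^ 2 / 4 + 1) =
              2 + σ ^ 2 * t ^ 2 / 2 + t ^ 2 + 4 / σ ^ 2 := by field_simp; ring
          rw [this]
          have h3 : 0 ≤ σ ^ 2 * t ^ 2 / 2 + 4 / σ ^ 2 := by positivity
          nlinarith [sq_nonneg (t - 1)]
      _ ≤ _ := by gcongr
  have h2 : (a * b) ^ m ≤ (2 / σ ^ 2) ^ m * m.factorial * Real.exp (σ ^ 2 * (a ^ 2 + b ^ 2) / 4) := by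
    have h3 := Real.pow_div_factorial_le_exp (σ ^ 2 * (a * b) / 2) (by positivity) m
    have h4 : Real.exp (σ ^ 2 * (a * b) / 2) ≤ Real.exp (σ ^ 2 * (a ^ 2 + b ^ 2) / 4) := by
      apply Real.exp_le_exp.2
      nlinarith [mul_nonneg (sq_nonneg σ) (sq_nonneg (a - b))]
    have h5 := h3.trans h4
    rw [div_le_iff₀ (by positivity)] at h5
    calc (a * b) ^ m = (2 / σ ^ 2) ^ m * (σ ^ 2 * (a * b) / 2) ^ m := by
          rw [← mul_pow]; congr 1; field_simp
      _ ≤ (2 / σ ^ 2) ^ m * (Real.exp (σ ^ 2 * (a ^ 2 + b ^ 2) / 4) * m.factorial) := by gcongr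
      _ = _ := by ring
  calc _ ≤ Real.exp (-(σ ^ 2 / 2) * (a ^ 2 + b ^ 2)) *
        (((2 + 4 / σ ^ 2) * Real.exp (σ ^ 2 * a ^ 2 / 4)) *
          ((2 + 4 / σ ^ 2) * Real.exp (σ ^ 2 * b ^ 2 / 4)) *
          ((2 / σ ^ 2) ^ m * m.factorial * Real.exp (σ ^ 2 * (a ^ 2 + b ^ 2) / 4))) := by
        gcongr
        · exact h1 a
        · exact h1 b
    _ = (2 + 4 / σ ^ 2) ^ 2 * (2 / σ ^ 2) ^ m * m.factorial *
        (Real.exp (-(σ ^ 2 / 2) * (a ^ 2 + b ^ 2)) * Real.exp (σ ^ 2 * a ^ 2 / 4) *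
          Real.exp (σ ^ 2 * b ^ 2 / 4) * Real.exp (σ ^ 2 * (a ^ 2 + b ^ 2) / 4)) := by ring
    _ = _ := by
        rw [← Real.exp_add, ← Real.exp_add, ← Real.exp_add]
        have : -(σ ^ 2 / 2) * (a ^ 2 + b ^ 2) + σ ^ 2 * a ^ 2 / 4 + σ ^ 2 * b ^ 2 / 4 +
          σ ^ 2 * (a ^ 2 + b ^ 2) / 4 = 0 := by ring
        rw [this, Real.exp_zero, mul_one]

theorem factorGrowth_le (K L : E3) (a : CorrFactor) :
    factorGrowth K L a ≤ (1 + ‖K‖) * (1 + ‖L‖) := by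
  have h1 := norm_nonneg K
  have h2 := norm_nonneg L
  cases a <;> simp only [factorGrowth] <;> nlinarith [mul_nonneg h1 h2]

/-- The growth bound for the words of length `m + 1` and `m + 2`. -/
def wordBound (σ : ℝ) (m : ℕ) : ℝ := (2 + 4 / σ ^ 2) ^ 2 * (2 / σ ^ 2) ^ m * m.factorial

theorem singleWord_growth_le {n : ℕ} {σ : ℝ} (hσ : 0 < σ) (g : Fin n → ℝ) (s : Finset (Fin n))
    (a : CorrFactor) (m : ℕ) (k : Fin n → E3) : damping σ g k s sᶜ *
      ∏ i, factorGrowth (weightedLabelSum g k s) (weightedLabelSum g k sᶜ) (singleWord a m i) ≤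
        wordBound σ m := by
  rw [prod_singleWord (factorGrowth _ _)]
  refine le_trans ?_ (damped_growth_le hσ (norm_nonneg (weightedLabelSum g k s))
    (norm_nonneg (weightedLabelSum g k sᶜ)) m)
  exact mul_le_mul_of_nonneg_left (mul_le_mul_of_nonneg_right (factorGrowth_le _ _ _)
    (pow_nonneg (factorGrowth_nonneg _ _ _) m)) (Real.exp_pos _).le

theorem crossedWord_growth_le {n : ℕ} {σ : ℝ} (hσ : 0 < σ) (g : Fin n → ℝ) (s : Finset (Fin n))
    (m : ℕ) (k : Fin n → E3) : damping σ g k s sᶜ *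
      ∏ i, factorGrowth (weightedLabelSum g k s) (weightedLabelSum g k sᶜ) (crossedWord m i) ≤
        wordBound σ m := by
  rw [prod_crossedWord (factorGrowth _ _)]
  refine le_trans ?_ (damped_growth_le hσ (norm_nonneg (weightedLabelSum g k s))
    (norm_nonneg (weightedLabelSum g k sᶜ)) m)
  rw [← mul_assoc (factorGrowth _ _ _)]
  refine mul_le_mul_of_nonneg_left (mul_le_mul_of_nonneg_right ?_
    (pow_nonneg (factorGrowth_nonneg _ _ _) m))
    (Real.exp_pos _).le
  simp only [factorGrowth]
  nlinarith [norm_nonneg (weightedLabelSum g k s), norm_nonneg (weightedLabelSum g k sᶜ)]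

/-! ### Power series with geometrically bounded coefficients -/

section Series

variable {a b : ℕ → ℂ} {M Q : ℝ} (hQ : 0 ≤ Q) (ha : ∀ m, ‖a m‖ ≤ M * Q ^ m)
  (hb : ∀ m, ‖b m‖ ≤ M * Q ^ m) {t : ℝ} (ht : |t| ≤ 1 / (2 * (Q + 1)))

include hQ ha hb ht

omit ha hb in
theorem abs_le_half_of_le : |t| ≤ 1 / 2 ∧ |t| * Q ≤ 1 / 2 := by
  have h1 : |t| * (2 * (Q + 1)) ≤ 1 := by rwa [le_div_iff₀ (by positivity)] at ht
  constructor <;> nlinarith [abs_nonneg t, mul_nonneg (abs_nonneg t) hQ]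

theorem norm_seriesTerm_le (m : ℕ) :
    ‖(t : ℂ) ^ (m + 1) * a m + (t : ℂ) ^ (m + 2) * b m‖ ≤ M * (1 / 2) ^ m := by
  obtain ⟨h1, h2⟩ := abs_le_half_of_le hQ ht
  have hM : 0 ≤ M := by simpa using (norm_nonneg _).trans (ha 0)
  refine (norm_add_le _ _).trans ?_
  rw [norm_mul, norm_mul, norm_pow, norm_pow, Complex.norm_real, Real.norm_eq_abs]
  have h3 : (|t| * Q) ^ m ≤ (1 / 2) ^ m := by gcongr
  have h4 := abs_nonneg t
  calc |t| ^ (m + 1) * ‖a m‖ + |t| ^ (m + 2) * ‖b m‖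
      ≤ |t| ^ (m + 1) * (M * Q ^ m) + |t| ^ (m + 2) * (M * Q ^ m) := by
        gcongr
        · exact ha m
        · exact hb m
    _ = (|t| + |t| ^ 2) * (M * (|t| * Q) ^ m) := by rw [mul_pow]; ring
    _ ≤ 1 * (M * (1 / 2) ^ m) := by
        gcongr
        nlinarith
    _ = _ := one_mul _

theorem norm_seriesTerm_add_two_le (m : ℕ) :
    ‖(t : ℂ) ^ (m + 2 + 1) * a (m + 2) + (t : ℂ) ^ (m + 2 + 2) * b (m + 2)‖ ≤
      2 * M * Q ^ 2 * |t| ^ 3 * (1 / 2) ^ m := by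
  obtain ⟨h1, h2⟩ := abs_le_half_of_le hQ ht
  have hM : 0 ≤ M := by simpa using (norm_nonneg _).trans (ha 0)
  refine (norm_add_le _ _).trans ?_
  rw [norm_mul, norm_mul, norm_pow, norm_pow, Complex.norm_real, Real.norm_eq_abs]
  have h3 : (|t| * Q) ^ m ≤ (1 / 2) ^ m := by gcongr
  have h4 := abs_nonneg t
  calc |t| ^ (m + 2 + 1) * ‖a (m + 2)‖ + |t| ^ (m + 2 + 2) * ‖b (m + 2)‖
      ≤ |t| ^ (m + 2 + 1) * (M * Q ^ (m + 2)) + |t| ^ (m + 2 + 2) * (M * Q ^ (m + 2)) := by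
        gcongr
        · exact ha _
        · exact hb _
    _ = (1 + |t|) * (M * Q ^ 2 * |t| ^ 3 * (|t| * Q) ^ m) := by rw [mul_pow]; ring
    _ ≤ 2 * (M * Q ^ 2 * |t| ^ 3 * (1 / 2) ^ m) := by
        gcongr
        linarith
    _ = _ := by ring

theorem summable_seriesTerm :
    Summable fun m => (t : ℂ) ^ (m + 1) * a m + (t : ℂ) ^ (m + 2) * b m :=
  Summable.of_norm_bounded (summable_geometric_two.mul_left M)
    fun m => norm_seriesTerm_le hQ ha hb ht m

/-- The terms with `m = 0, 1` contain one excess term `t³ b 1`, which is moved to the error. The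
tail from `m = 2` on is a geometric series with sum at most `4 M Q² |t|³`. -/
theorem norm_series_sub_le :
    ‖(∑' m, ((t : ℂ) ^ (m + 1) * a m + (t : ℂ) ^ (m + 2) * b m)) -
      ((t : ℂ) * a 0 + (t : ℂ) ^ 2 * (a 1 + b 0))‖ ≤
      (‖b 1‖ + 4 * M * Q ^ 2) * |t| ^ 3 := by
  have hs := summable_seriesTerm hQ ha hb ht
  rw [← hs.sum_add_tsum_nat_add 2, Finset.sum_range_succ, Finset.sum_range_one]
  have h1 : ‖∑' m, ((t : ℂ) ^ (m + 2 + 1) * a (m + 2) + (t : ℂ) ^ (m + 2 + 2) * b (m + 2))‖ ≤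
      2 * M * Q ^ 2 * |t| ^ 3 * 2 :=
    tsum_of_norm_bounded (hasSum_geometric_two.mul_left _)
      fun m => norm_seriesTerm_add_two_le hQ ha hb ht m
  have h2 : ‖(t : ℂ) ^ 3 * b 1‖ = ‖b 1‖ * |t| ^ 3 := by
    rw [norm_mul, norm_pow, Complex.norm_real, Real.norm_eq_abs, mul_comm]
  calc _ = ‖(t : ℂ) ^ 3 * b 1 + ∑' m, ((t : ℂ) ^ (m + 2 + 1) * a (m + 2) +
        (t : ℂ) ^ (m + 2 + 2) * b (m + 2))‖ := by congr 1; ring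
    _ ≤ ‖b 1‖ * |t| ^ 3 + 2 * M * Q ^ 2 * |t| ^ 3 * 2 :=
        (norm_add_le _ _).trans (add_le_add h2.le h1)
    _ = _ := by ring

end Series

/-! ### The contribution of a label grouping -/

theorem separationIntegral_sum {ι : Type*} {ε : ℝ} (hε : 0 < ε) (k l : E3) (S : Finset ι)
    (c : ι → ℂ) {F : ι → E3 → ℂ} (hF : ∀ i, Continuous (F i)) {M : ι → ℝ}
    (hM : ∀ i x, ‖F i x‖ ≤ M i) :
    separationIntegral ε k l (fun x => ∑ i ∈ S, c i * F i x) =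
      ∑ i ∈ S, c i * separationIntegral ε k l (F i) := by
  simp only [separationIntegral, ← integral_const_mul]
  rw [← integral_finsetSum _ fun i _ => (integrable_separation hε k l (hF i) (hM i)).const_mul _]
  refine integral_congr_ae (Eventually.of_forall fun q => ?_)
  simp only [Finset.mul_sum]
  refine Finset.sum_congr rfl fun i _ => ?_
  ring

/-- The contribution of the label grouping `(s; sᶜ)` to the regularized two-particle cumulant. -/
def groupingTerm {n : ℕ} (α σ : ℝ) (P : ℝ → ℝ) (g : Fin n → ℝ) (s : Finset (Fin n)) (ε : ℝ)
    (k : Fin n → E3) : ℂ :=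
  (damping σ g k s sᶜ : ℂ) * separationIntegral ε (labelSum k s) (labelSum k sᶜ) (fun x =>
    pairSum α P x (weightedLabelSum g k s) (weightedLabelSum g k sᶜ))

/-- A linear functional of the words with a single prefix and `m` momentum correlations. -/
def singleSum (W : (j : ℕ) → (Fin (j + 1) → CorrFactor) → ℂ) (m : ℕ) : ℂ :=
  ∑ a, (singleCoeff a m : ℂ) * W m (singleWord a m)

/-- A linear functional of the words with a crossed prefix and `m` momentum correlations. -/
def crossedSum (W : (j : ℕ) → (Fin (j + 1) → CorrFactor) → ℂ) (m : ℕ) : ℂ :=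
  ((m.factorial : ℝ)⁻¹ : ℝ) * W (m + 1) (crossedWord m)

theorem hasSum_groupingTerm {P : ℝ → ℝ} (h0 : Integrable (fun h : E3 => P ‖h‖))
    (h2 : Integrable (fun h : E3 => P ‖h‖ / ‖h‖ ^ 2)) {n : ℕ} (α σ t : ℝ) (g : Fin n → ℝ)
    (s : Finset (Fin n)) {ε : ℝ} (hε : 0 < ε) (k : Fin n → E3) :
    HasSum (fun m => (t : ℂ) ^ (m + 1) * singleSum (fun _ w => wordTerm α σ P g s w ε k) m +
      (t : ℂ) ^ (m + 2) * crossedSum (fun _ w => wordTerm α σ P g s w ε k) m)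
      (groupingTerm α σ (fun y => t * P y) g s ε k) := by
  set K := weightedLabelSum g k s with hK
  set L := weightedLabelSum g k sᶜ with hL
  have hb : ∃ M : ℝ, 0 ≤ M ∧ ∀ a x, ‖factorValue α P K L a x‖ ≤ M := by
    have hA : 0 ≤ ∫ h, spectralMajorant P h := integral_nonneg (spectralMajorant_nonneg P)
    refine ⟨(1 + α ^ 2) * ((1 + ‖K‖) * (1 + ‖L‖)) * ∫ h, spectralMajorant P h, by positivity,
      fun a x => (norm_factorValue_le h0 h2 α K L a x).trans ?_⟩
    gcongr
    exact factorGrowth_le K L a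
  obtain ⟨M, hM0, hM⟩ := hb
  have hcont : ∀ {j : ℕ} (w : Fin j → CorrFactor),
      Continuous fun x => ∏ i, factorValue α P K L (w i) x := fun w =>
    continuous_finsetProd _ fun i _ => continuous_factorValue h0 h2 α K L (w i)
  have hbd : ∀ {j : ℕ} (w : Fin j → CorrFactor) x,
      ‖∏ i, factorValue α P K L (w i) x‖ ≤ M ^ j := by
    intro j w x
    rw [norm_prod]
    refine (Finset.prod_le_prod (fun _ _ => norm_nonneg _) fun i _ => hM (w i) x).trans_eq ?_
    simp
  have hterm : ∀ m, separationIntegral ε (labelSum k s) (labelSum k sᶜ) (pairSumTerm α P t K L m) =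
      (t : ℂ) ^ (m + 1) * ∑ a, (singleCoeff a m : ℂ) * separationIntegral ε (labelSum k s)
        (labelSum k sᶜ) (fun x => ∏ i, factorValue α P K L (singleWord a m i) x) +
      (t : ℂ) ^ (m + 2) * ((m.factorial : ℝ)⁻¹ : ℝ) * separationIntegral ε (labelSum k s)
        (labelSum k sᶜ) (fun x => ∏ i, factorValue α P K L (crossedWord m i) x) := by
    intro m
    -- `none` stands for the crossed word and `some a` for the four single words.
    have h := separationIntegral_sum hε (labelSum k s) (labelSum k sᶜ)
      (Finset.univ : Finset (Option CorrFactor))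
      (fun o => o.elim ((t : ℂ) ^ (m + 2) * ((m.factorial : ℝ)⁻¹ : ℝ))
        fun a => (t : ℂ) ^ (m + 1) * singleCoeff a m)
      (F := fun o => o.elim (fun x => ∏ i, factorValue α P K L (crossedWord m i) x)
        fun a x => ∏ i, factorValue α P K L (singleWord a m i) x)
      (M := fun o => o.elim (M ^ (m + 2)) fun _ => M ^ (m + 1))
      (by rintro (_ | a)
          · exact hcont _
          · exact hcont _)
      (by rintro (_ | a) x
          · exact hbd _ x
          · exact hbd _ x)
    simp only [Fintype.sum_option, Option.elim] at h
    rw [Finset.mul_sum, add_comm]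
    simp only [← mul_assoc]
    rw [← h]
    congr 1
    funext x
    rw [pairSumTerm, Finset.mul_sum, add_comm]
    simp only [mul_assoc]
  -- At fixed wave vectors the series converges for every `t`. The majorant counts four single words
  -- and one crossed word, uniformly in the separation.
  have hsum := hasSum_separationIntegral hε (labelSum k s) (labelSum k sᶜ)
    (f := pairSumTerm α P t K L) (F := fun x => pairSum α (fun y => t * P y) x K L)
    (b := fun m => (4 * (|t| * M) + (|t| * M) ^ 2) * ((|t| * M) ^ m / m.factorial))
    (fun m => by
      have h1 : ∀ a, Continuous fun x => ∏ i, factorValue α P K L (singleWord a m i) x :=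
        fun a => hcont _
      have h2 : Continuous fun x => ∏ i, factorValue α P K L (crossedWord m i) x := hcont _
      unfold pairSumTerm
      fun_prop)
    ((Real.summable_pow_div_factorial _).mul_left _)
    (fun m x => by
      rw [pairSumTerm]
      refine (norm_add_le _ _).trans ?_
      have h1 : ‖∑ a, (singleCoeff a m : ℂ) * ∏ i, factorValue α P K L (singleWord a m i) x‖ ≤
          4 * ((m.factorial : ℝ)⁻¹ * M ^ (m + 1)) := by
        refine (norm_sum_le _ _).trans ((Finset.sum_le_card_nsmul _ _
          ((m.factorial : ℝ)⁻¹ * M ^ (m + 1)) fun a _ => ?_).trans_eq ?_)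
        · rw [norm_mul, Complex.norm_real, Real.norm_of_nonneg (singleCoeff_nonneg a m)]
          gcongr
          · exact singleCoeff_le a m
          · exact hbd _ x
        · have : (Finset.univ : Finset CorrFactor).card = 4 := rfl
          rw [this, nsmul_eq_mul]
          norm_num
      have h2 := hbd (crossedWord m) x
      have h3 := abs_nonneg t
      rw [norm_mul, norm_mul, norm_mul, norm_pow, norm_pow, Complex.norm_real, Complex.norm_real,
        Real.norm_eq_abs, Real.norm_of_nonneg (by positivity : (0 : ℝ) ≤ (m.factorial : ℝ)⁻¹)]
      calc _ ≤ |t| ^ (m + 1) * (4 * ((m.factorial : ℝ)⁻¹ * M ^ (m + 1))) +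
            |t| ^ (m + 2) * (m.factorial : ℝ)⁻¹ * M ^ (m + 2) := by gcongr
        _ = _ := by ring)
    (fun x => hasSum_pairSumTerm h0 h2 α t K L x)
  have h := hsum.mul_left (damping σ g k s sᶜ : ℂ)
  refine h.congr_fun fun m => ?_
  rw [hterm, singleSum, crossedSum]
  simp only [wordTerm]
  rw [mul_add, Finset.mul_sum, Finset.mul_sum, Finset.mul_sum]
  congr 1
  · refine Finset.sum_congr rfl fun a _ => ?_
    ring
  · ring

section Bounds

variable {σ A N : ℝ} (hA : 0 ≤ A) (hN : 0 ≤ N)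

/-- The constant in the bounds of the coefficients of the expansion. -/
def seriesConst (σ A N : ℝ) : ℝ := 4 * (N * ((2 + 4 / σ ^ 2) ^ 2 * (A + A ^ 2)))

include hA hN

/-- The factorial in `wordBound` is absorbed by `singleCoeff`. In `seriesConst` the `4` counts the
factors, and `A + A²` covers both the single words with `A^(m+1)` and the crossed ones with
`A^(m+2)`. -/
theorem norm_singleSum_le {W : (j : ℕ) → (Fin (j + 1) → CorrFactor) → ℂ} (m : ℕ)
    (hW : ∀ a, ‖W m (singleWord a m)‖ ≤ N * (wordBound σ m * A ^ (m + 1))) :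
    ‖singleSum W m‖ ≤ seriesConst σ A N * (A * (2 / σ ^ 2)) ^ m := by
  have hf : (0 : ℝ) < m.factorial := by positivity
  rw [singleSum]
  refine (norm_sum_le _ _).trans ((Finset.sum_le_card_nsmul _ _
    (N * ((2 + 4 / σ ^ 2) ^ 2 * (A + A ^ 2)) * (A * (2 / σ ^ 2)) ^ m) fun a _ => ?_).trans_eq ?_)
  · rw [norm_mul, Complex.norm_real, Real.norm_of_nonneg (singleCoeff_nonneg a m)]
    calc singleCoeff a m * ‖W m (singleWord a m)‖
        ≤ (m.factorial : ℝ)⁻¹ * (N * (wordBound σ m * A ^ (m + 1))) := by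
          gcongr
          · exact singleCoeff_le a m
          · exact hW a
      _ = N * ((2 + 4 / σ ^ 2) ^ 2 * A) * (A * (2 / σ ^ 2)) ^ m := by
          rw [wordBound, mul_pow]; field_simp; ring
      _ ≤ _ := by gcongr; nlinarith [sq_nonneg A]
  · have : (Finset.univ : Finset CorrFactor).card = 4 := rfl
    rw [this, nsmul_eq_mul, seriesConst]
    push_cast
    ring

theorem norm_crossedSum_le {W : (j : ℕ) → (Fin (j + 1) → CorrFactor) → ℂ} (m : ℕ)
    (hW : ‖W (m + 1) (crossedWord m)‖ ≤ N * (wordBound σ m * A ^ (m + 1 + 1))) :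
    ‖crossedSum W m‖ ≤ seriesConst σ A N * (A * (2 / σ ^ 2)) ^ m := by
  have hf : (0 : ℝ) < m.factorial := by positivity
  rw [crossedSum, norm_mul, Complex.norm_real,
    Real.norm_of_nonneg (by positivity : (0 : ℝ) ≤ (m.factorial : ℝ)⁻¹)]
  calc (m.factorial : ℝ)⁻¹ * ‖W (m + 1) (crossedWord m)‖
      ≤ (m.factorial : ℝ)⁻¹ * (N * (wordBound σ m * A ^ (m + 1 + 1))) := by gcongr
    _ = N * ((2 + 4 / σ ^ 2) ^ 2 * A ^ 2) * (A * (2 / σ ^ 2)) ^ m := by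
        rw [wordBound, mul_pow]; field_simp; ring
    _ ≤ N * ((2 + 4 / σ ^ 2) ^ 2 * (A + A ^ 2)) * (A * (2 / σ ^ 2)) ^ m := by gcongr; linarith
    _ ≤ _ := by
        rw [seriesConst]
        have : 0 ≤ N * ((2 + 4 / σ ^ 2) ^ 2 * (A + A ^ 2)) := by positivity
        exact mul_le_mul_of_nonneg_right (le_mul_of_one_le_left this (by norm_num)) (by positivity)

end Bounds

/-- The size of the integrated factors. -/
def spectralMass (α : ℝ) (P : ℝ → ℝ) : ℝ := (1 + α ^ 2) * ∫ h, spectralMajorant P h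

theorem spectralMass_nonneg (α : ℝ) (P : ℝ → ℝ) : 0 ≤ spectralMass α P :=
  mul_nonneg (by positivity) (integral_nonneg (spectralMajorant_nonneg P))

/-- The range of amplitudes of the power spectrum for which the expansion is controlled. -/
def amplitudeRadius (α σ : ℝ) (P : ℝ → ℝ) : ℝ :=
  1 / (2 * (spectralMass α P * (2 / σ ^ 2) + 1))

theorem amplitudeRadius_pos (α σ : ℝ) (P : ℝ → ℝ) : 0 < amplitudeRadius α σ P := by
  have := spectralMass_nonneg α P
  unfold amplitudeRadius; positivity

/-! ### Exchange of series and wave-vector integral at a fixed convergence factor -/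

section Grouping

variable {P : ℝ → ℝ} (h0 : Integrable (fun h : E3 => P ‖h‖))
  (h2 : Integrable (fun h : E3 => P ‖h‖ / ‖h‖ ^ 2)) (α : ℝ) {σ : ℝ} (hσ : 0 < σ) {n : ℕ}

include h0 h2 hσ

theorem norm_groupingSeries_le (g : Fin n → ℝ) (s : Finset (Fin n)) {t : ℝ}
    (ht : |t| ≤ amplitudeRadius α σ P) {ε : ℝ} (hε : 0 < ε) (k : Fin n → E3) (m : ℕ) :
    ‖(t : ℂ) ^ (m + 1) * singleSum (fun _ w => wordTerm α σ P g s w ε k) m +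
      (t : ℂ) ^ (m + 2) * crossedSum (fun _ w => wordTerm α σ P g s w ε k) m‖ ≤
      seriesConst σ (spectralMass α P) ((2 * Real.pi) ^ 6 * heat ε 0 ^ 2) * (1 / 2) ^ m := by
  have hA := spectralMass_nonneg α P
  refine norm_seriesTerm_le (Q := spectralMass α P * (2 / σ ^ 2)) (by positivity) (fun m => ?_)
    (fun m => ?_) ht m
  · refine norm_singleSum_le hA (by positivity) m fun a => ?_
    refine (norm_wordTerm_le h0 h2 α σ g s _ (singleWord_growth_le hσ g s a m) hε k).trans_eq ?_
    rw [spectralMass]; ring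
  · refine norm_crossedSum_le hA (by positivity) m ?_
    refine (norm_wordTerm_le h0 h2 α σ g s _ (crossedWord_growth_le hσ g s m) hε k).trans_eq ?_
    rw [spectralMass]; ring

theorem integrable_singleSum (g : Fin n → ℝ) (s : Finset (Fin n)) (φ : 𝓢(Fin n → E3, ℂ)) {ε : ℝ}
    (hε : 0 < ε) (m : ℕ) :
    Integrable fun k => singleSum (fun _ w => wordTerm α σ P g s w ε k) m * φ k := by
  obtain ⟨C, -, hC⟩ := exists_decay_bound φ
  simp only [singleSum, Finset.sum_mul, mul_assoc]
  exact integrable_finsetSum _ fun a _ => (integrable_wordTerm h0 h2 α σ g s _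
    (singleWord_growth_le hσ g s a m) φ hC hε).const_mul _

theorem integrable_crossedSum (g : Fin n → ℝ) (s : Finset (Fin n)) (φ : 𝓢(Fin n → E3, ℂ)) {ε : ℝ}
    (hε : 0 < ε) (m : ℕ) :
    Integrable fun k => crossedSum (fun _ w => wordTerm α σ P g s w ε k) m * φ k := by
  obtain ⟨C, -, hC⟩ := exists_decay_bound φ
  simp only [crossedSum, mul_assoc]
  exact (integrable_wordTerm h0 h2 α σ g s _ (crossedWord_growth_le hσ g s m) φ hC hε).const_mul _

omit h0 h2 hσ in
theorem integrable_schwartz (φ : 𝓢(Fin n → E3, ℂ)) : Integrable (fun k => φ k) := by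
  obtain ⟨C, -, hC⟩ := exists_decay_bound φ
  exact Integrable.mono' ((integrable_decay n).const_mul C) φ.continuous.aestronglyMeasurable
    (Eventually.of_forall hC)

theorem hasSum_integral_groupingTerm (g : Fin n → ℝ) (s : Finset (Fin n)) (φ : 𝓢(Fin n → E3, ℂ))
    {t : ℝ} (ht : |t| ≤ amplitudeRadius α σ P) {ε : ℝ} (hε : 0 < ε) :
    Integrable (fun k => groupingTerm α σ (fun y => t * P y) g s ε k * φ k) ∧
    HasSum (fun m => (t : ℂ) ^ (m + 1) *
        (∫ k, singleSum (fun _ w => wordTerm α σ P g s w ε k) m * φ k) +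
      (t : ℂ) ^ (m + 2) * ∫ k, crossedSum (fun _ w => wordTerm α σ P g s w ε k) m * φ k)
      (∫ k, groupingTerm α σ (fun y => t * P y) g s ε k * φ k) := by
  set F : ℕ → (Fin n → E3) → ℂ := fun m k =>
    ((t : ℂ) ^ (m + 1) * singleSum (fun _ w => wordTerm α σ P g s w ε k) m +
      (t : ℂ) ^ (m + 2) * crossedSum (fun _ w => wordTerm α σ P g s w ε k) m) * φ k with hF
  have hI : ∀ m, Integrable (F m) := fun m => by
    simp only [hF, add_mul, mul_assoc]
    exact ((integrable_singleSum h0 h2 α hσ g s φ hε m).const_mul _).add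
      ((integrable_crossedSum h0 h2 α hσ g s φ hε m).const_mul _)
  set S := seriesConst σ (spectralMass α P) ((2 * Real.pi) ^ 6 * heat ε 0 ^ 2) with hS
  have hb : ∀ m k, ‖F m k‖ ≤ S * (1 / 2) ^ m * ‖φ k‖ := fun m k => by
    rw [hF, norm_mul]
    gcongr
    exact norm_groupingSeries_le h0 h2 α hσ g s ht hε k m
  have hs : ∀ k, HasSum (fun m => F m k) (groupingTerm α σ (fun y => t * P y) g s ε k * φ k) :=
    fun k => (hasSum_groupingTerm h0 h2 α σ t g s hε k).mul_right (φ k)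
  have hφ : Integrable (fun k => ‖φ k‖) := (integrable_schwartz φ).norm
  constructor
  · refine Integrable.mono' (hφ.const_mul (S * 2)) ?_ (Eventually.of_forall fun k => ?_)
    -- Measurability in the wave vectors is inherited from the partial sums.
    · exact aestronglyMeasurable_of_tendsto_ae atTop
        (fun N => (integrable_finsetSum (Finset.range N) fun m _ => hI m).aestronglyMeasurable)
        (Eventually.of_forall fun k => (hs k).tendsto_sum_nat)
    · rw [← (hs k).tsum_eq]
      refine tsum_of_norm_bounded ?_ fun m => hb m k
      exact (hasSum_geometric_two.mul_left S).mul_right _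
  · have h := hasSum_integral_of_summable_integral_norm hI
      (Summable.of_nonneg_of_le (fun m => integral_nonneg fun q => norm_nonneg _)
        (g := fun m => ∫ k, ‖F m k‖) (f := fun m => (S * (1 / 2) ^ m) * ∫ k, ‖φ k‖)
        (fun m => by
          rw [← integral_const_mul]
          exact integral_mono (hI m).norm (hφ.const_mul _) fun k => hb m k)
        ((summable_geometric_two.mul_left S).mul_right _))
    have he : ∫ k, groupingTerm α σ (fun y => t * P y) g s ε k * φ k = ∫ k, ∑' m, F m k :=
      integral_congr_ae (Eventually.of_forall fun k => (hs k).tsum_eq.symm)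
    rw [he]
    refine h.congr_fun fun m => ?_
    simp only [hF, add_mul, mul_assoc]
    rw [integral_add ((integrable_singleSum h0 h2 α hσ g s φ hε m).const_mul _)
      ((integrable_crossedSum h0 h2 α hσ g s φ hε m).const_mul _), integral_const_mul,
      integral_const_mul]

end Grouping

/-! ### The limit of the series as the convergence factor is removed -/

section GroupingLimit

variable {P : ℝ → ℝ} (h0 : Integrable (fun h : E3 => P ‖h‖))
  (h2 : Integrable (fun h : E3 => P ‖h‖ / ‖h‖ ^ 2)) (α : ℝ) {σ : ℝ} (hσ : 0 < σ) {m : ℕ}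
  (g : Fin (m + 2) → ℝ) (r : Fin (m + 1)) {s : Finset (Fin (m + 2))}
  (hs : (0 : Fin (m + 2)) ∈ s) (hr : r.succ ∉ s) (φ : 𝓢(Fin (m + 2) → E3, ℂ))

include h0 h2 hσ

theorem integral_singleSum (W : (j : ℕ) → (Fin (j + 1) → CorrFactor) → ℂ) {ε : ℝ} (hε : 0 < ε)
    (hW : ∀ j w, W j w = ∫ k, wordTerm α σ P g s w ε k * φ k) (i : ℕ) :
    ∫ k, singleSum (fun _ w => wordTerm α σ P g s w ε k) i * φ k = singleSum W i := by
  obtain ⟨C, -, hC⟩ := exists_decay_bound φ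
  simp only [singleSum, Finset.sum_mul, mul_assoc, hW, ← integral_const_mul]
  exact integral_finsetSum _ fun a _ => (integrable_wordTerm h0 h2 α σ g s _
    (singleWord_growth_le hσ g s a i) φ hC hε).const_mul _

omit h0 h2 hσ in
theorem integral_crossedSum (W : (j : ℕ) → (Fin (j + 1) → CorrFactor) → ℂ) {ε : ℝ}
    (hW : ∀ j w, W j w = ∫ k, wordTerm α σ P g s w ε k * φ k) (i : ℕ) :
    ∫ k, crossedSum (fun _ w => wordTerm α σ P g s w ε k) i * φ k = crossedSum W i := by
  simp only [crossedSum, mul_assoc, hW, integral_const_mul]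

include hs hr

/-- The regularized contribution of a label grouping converges to a power series in the amplitude
of the power spectrum. -/
theorem tendsto_integral_groupingTerm {t : ℝ} (ht : |t| ≤ amplitudeRadius α σ P) :
    Tendsto (fun ε : ℝ => ∫ k, groupingTerm α σ (fun y => t * P y) g s ε k * φ k) (𝓝[>] 0)
      (𝓝 (∑' i, ((t : ℂ) ^ (i + 1) * singleSum (fun _ w => wordLimit α σ P g s w φ) i +
        (t : ℂ) ^ (i + 2) * crossedSum (fun _ w => wordLimit α σ P g s w φ) i))) := by
  obtain ⟨C, hC0, hC⟩ := exists_decay_bound φ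
  have hA := spectralMass_nonneg α P
  have hd : 0 ≤ ∫ z : Fin m → E3, decay z := integral_nonneg decay_nonneg
  set N : ℝ := (2 * Real.pi) ^ 6 * (C * ∫ z : Fin m → E3, decay z) with hN
  set W : ℝ → (j : ℕ) → (Fin (j + 1) → CorrFactor) → ℂ :=
    fun ε j w => ∫ k, wordTerm α σ P g s w ε k * φ k with hWdef
  have heq : ∀ ε ∈ Set.Ioi (0 : ℝ), ∑' i, ((t : ℂ) ^ (i + 1) * singleSum (W ε) i +
      (t : ℂ) ^ (i + 2) * crossedSum (W ε) i) =
      ∫ k, groupingTerm α σ (fun y => t * P y) g s ε k * φ k := by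
    intro ε hε
    have h := (hasSum_integral_groupingTerm h0 h2 α hσ g s φ ht hε).2
    simp only [integral_singleSum h0 h2 α hσ g φ (W ε) hε (fun _ _ => rfl),
      integral_crossedSum α g φ (W ε) (fun _ _ => rfl)] at h
    exact h.tsum_eq
  refine Tendsto.congr' (eventually_nhdsWithin_of_forall heq) ?_
  -- Termwise limits suffice, since the geometric majorant comes from bounds uniform in `ε`.
  refine tendsto_tsum_of_dominated_convergence
    (bound := fun i => seriesConst σ (spectralMass α P) N * (1 / 2) ^ i)
    (summable_geometric_two.mul_left _) (fun i => ?_) ?_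
  · refine Tendsto.add (Tendsto.const_mul _ ?_) (Tendsto.const_mul _ ?_)
    · exact tendsto_finsetSum _ fun a _ => Tendsto.const_mul _
        (tendsto_integral_wordTerm h0 h2 α σ g r hs hr _ (singleWord_growth_le hσ g s a i) φ hC0 hC)
    · exact Tendsto.const_mul _
        (tendsto_integral_wordTerm h0 h2 α σ g r hs hr _ (crossedWord_growth_le hσ g s i) φ hC0 hC)
  · refine eventually_nhdsWithin_of_forall fun ε hε i => ?_
    refine norm_seriesTerm_le (Q := spectralMass α P * (2 / σ ^ 2)) (by positivity) (fun i => ?_)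
      (fun i => ?_) ht i
    · refine norm_singleSum_le hA (by positivity) i fun a => ?_
      refine (norm_integral_wordTerm_le h0 h2 α σ g r hs hr _ (singleWord_growth_le hσ g s a i) φ
        hC0 hC hε).trans_eq ?_
      rw [hN, spectralMass]; ring
    · refine norm_crossedSum_le hA (by positivity) i ?_
      refine (norm_integral_wordTerm_le h0 h2 α σ g r hs hr _ (crossedWord_growth_le hσ g s i) φ
        hC0 hC hε).trans_eq ?_
      rw [hN, spectralMass]; ring

theorem exists_norm_limit_sub_le : ∃ M : ℝ, ∀ t : ℝ, |t| ≤ amplitudeRadius α σ P →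
    ‖(∑' i, ((t : ℂ) ^ (i + 1) * singleSum (fun _ w => wordLimit α σ P g s w φ) i +
        (t : ℂ) ^ (i + 2) * crossedSum (fun _ w => wordLimit α σ P g s w φ) i)) -
      ((t : ℂ) * singleSum (fun _ w => wordLimit α σ P g s w φ) 0 +
        (t : ℂ) ^ 2 * (singleSum (fun _ w => wordLimit α σ P g s w φ) 1 +
          crossedSum (fun _ w => wordLimit α σ P g s w φ) 0))‖ ≤ M * |t| ^ 3 := by
  obtain ⟨C, hC0, hC⟩ := exists_decay_bound φ
  have hA := spectralMass_nonneg α P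
  have hd : 0 ≤ ∫ z : Fin m → E3, decay z := integral_nonneg decay_nonneg
  set N : ℝ := (2 * Real.pi) ^ 6 * (C * ∫ z : Fin m → E3, decay z) with hN
  refine ⟨_, fun t ht => norm_series_sub_le (M := seriesConst σ (spectralMass α P) N)
    (Q := spectralMass α P * (2 / σ ^ 2)) (by positivity) (fun i => ?_) (fun i => ?_) ht⟩
  · refine norm_singleSum_le hA (by positivity) i fun a => ?_
    refine (norm_wordLimit_le h0 h2 α σ g r hs hr _ (singleWord_growth_le hσ g s a i) φ
      hC0 hC).trans_eq ?_
    rw [hN, spectralMass]; ring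
  · refine norm_crossedSum_le hA (by positivity) i ?_
    refine (norm_wordLimit_le h0 h2 α σ g r hs hr _ (crossedWord_growth_le hσ g s i) φ
      hC0 hC).trans_eq ?_
    rw [hN, spectralMass]; ring

end GroupingLimit

/-! ### Exchange of the two particles -/

/-- The factor with the roles of the two particles exchanged. -/
def CorrFactor.swap : CorrFactor → CorrFactor
  | CorrFactor.dp => CorrFactor.pd
  | CorrFactor.pd => CorrFactor.dp
  | a => a

/-- The reflection `h ↦ -h` undoes the reversal of the separation. Factors with one momentum end
change sign, as the opposite signs of `dp` and `pd` require. -/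
theorem factorValue_swap_neg (α : ℝ) (P : ℝ → ℝ) (K L : E3) (a : CorrFactor) (x : E3) :
    factorValue α P L K a.swap (-x) = factorValue α P K L a x := by
  rw [factorValue, factorValue]
  congr 1
  rw [← integral_neg_eq_self]
  refine integral_congr_ae (Eventually.of_forall fun h => ?_)
  cases a <;> simp [factorWeight, CorrFactor.swap] <;> ring_nf
  simp

theorem pairSum_neg {P : ℝ → ℝ} (h0 : Integrable (fun h : E3 => P ‖h‖))
    (h2 : Integrable (fun h : E3 => P ‖h‖ / ‖h‖ ^ 2)) (α : ℝ) (x K L : E3) :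
    pairSum α P (-x) L K = pairSum α P x K L := by
  have h := factorValue_swap_neg α P K L
  rw [pairSum_eq h0 h2, pairSum_eq h0 h2, ← h .dp, ← h .pd, ← h .dd, ← h .pp]
  simp only [CorrFactor.swap]
  ring

theorem separationIntegral_neg (ε : ℝ) (k l : E3) (f : E3 → ℂ) :
    separationIntegral ε l k (fun x => f (-x)) = separationIntegral ε k l f := by
  have h := volume_measurePreserving_piCongrLeft (fun _ : Fin 2 => E3) (Equiv.swap 0 1)
  rw [separationIntegral, separationIntegral, ← h.integral_comp']
  refine integral_congr_ae (Eventually.of_forall fun q => ?_)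
  have h0 : (MeasurableEquiv.piCongrLeft (fun _ : Fin 2 => E3) (Equiv.swap 0 1)) q 0 = q 1 := by
    have e := MeasurableEquiv.piCongrLeft_apply_apply (β := fun _ : Fin 2 => E3)
      (Equiv.swap (0 : Fin 2) 1) q 1
    rwa [Equiv.swap_apply_right] at e
  have h1 : (MeasurableEquiv.piCongrLeft (fun _ : Fin 2 => E3) (Equiv.swap 0 1)) q 1 = q 0 := by
    have e := MeasurableEquiv.piCongrLeft_apply_apply (β := fun _ : Fin 2 => E3)
      (Equiv.swap (0 : Fin 2) 1) q 0
    rwa [Equiv.swap_apply_left] at e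
  simp only [Fin.sum_univ_two, h0, h1, neg_sub]
  rw [add_comm (‖q 1‖ ^ 2), add_comm (inner ℝ l (q 1))]

theorem damping_comm {n : ℕ} (σ : ℝ) (g : Fin n → ℝ) (k : Fin n → E3) (s t : Finset (Fin n)) :
    damping σ g k s t = damping σ g k t s := by
  rw [damping, damping, add_comm]

theorem groupingTerm_compl {P : ℝ → ℝ} (h0 : Integrable (fun h : E3 => P ‖h‖))
    (h2 : Integrable (fun h : E3 => P ‖h‖ / ‖h‖ ^ 2)) {n : ℕ} (α σ : ℝ) (g : Fin n → ℝ)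
    (s : Finset (Fin n)) (ε : ℝ) (k : Fin n → E3) :
    groupingTerm α σ P g sᶜ ε k = groupingTerm α σ P g s ε k := by
  rw [groupingTerm, groupingTerm, compl_compl, damping_comm σ g k sᶜ,
    ← separationIntegral_neg ε (labelSum k s)]
  simp only [pairSum_neg h0 h2]

/-- Complementation pairs the sets that contain label `0` with those that do not. The resulting `2`
cancels the symmetry factor `1/2!`. -/
theorem sum_finset_eq_two_mul {n : ℕ} {f : Finset (Fin (n + 1)) → ℂ} (hf : ∀ s, f sᶜ = f s) :
    ∑ s, f s = 2 * ∑ s with 0 ∈ s, f s := by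
  rw [← Finset.sum_filter_add_sum_filter_not Finset.univ (fun s : Finset (Fin (n + 1)) => 0 ∈ s) f,
    two_mul]
  congr 1
  refine Finset.sum_nbij' (fun s => sᶜ) (fun s => sᶜ) ?_ ?_ ?_ ?_ ?_ <;> simp [hf]

theorem regularizedCumulant_two_eq_sum {P : ℝ → ℝ} (h0 : Integrable (fun h : E3 => P ‖h‖))
    (h2 : Integrable (fun h : E3 => P ‖h‖ / ‖h‖ ^ 2)) {n : ℕ} (ρbar α : ℝ) {σ : ℝ} (hσ : 0 < σ)
    (g : Fin (n + 1) → ℝ) {ε : ℝ} (hε : 0 < ε) (k : Fin (n + 1) → E3) :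
    regularizedCumulant 2 ρbar α σ P g ε k =
      (ρbar : ℂ) ^ 2 * ∑ s with 0 ∈ s, groupingTerm α σ P g s ε k := by
  have h := sum_finset_eq_two_mul (f := fun s => groupingTerm α σ P g s ε k)
    fun s => groupingTerm_compl h0 h2 α σ g s ε k
  rw [regularizedCumulant_two h0 h2 ρbar α hσ g hε k]
  simp only [groupingTerm] at h
  rw [h]
  simp only [groupingTerm]
  ring

/-! ### The grouping of all labels at one particle -/

theorem heat_eq_scale {ε : ℝ} (hε : 0 < ε) (h : E3) :
    heat ε h = (Real.sqrt ε)⁻¹ ^ 3 * heat 1 ((Real.sqrt ε)⁻¹ • h) := by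
  have hs : Real.sqrt ε ≠ 0 := (Real.sqrt_pos.2 hε).ne'
  have := heat_scale hε ((Real.sqrt ε)⁻¹ • h)
  rwa [smul_inv_smul₀ hs, ← inv_pow] at this

theorem tendsto_norm_pow_mul_heat :
    Tendsto (fun h : E3 => ‖h‖ ^ 3 * heat 1 h) (Bornology.cobounded E3) (𝓝 0) := by
  set c : ℝ := ((2 * Real.pi) ^ 3)⁻¹ * (Real.pi / 1) ^ (3 / 2 : ℝ) with hc
  have hlim : Tendsto (fun r : ℝ => c * (r ^ 3 * Real.exp (-r))) atTop (𝓝 0) := by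
    simpa using (Real.tendsto_pow_mul_exp_neg_atTop_nhds_zero 3).const_mul c
  have h := hlim.comp (tendsto_norm_cobounded_atTop (E := E3))
  refine squeeze_zero' (Eventually.of_forall fun h =>
    mul_nonneg (by positivity) (heat_nonneg one_pos h)) ?_ h
  filter_upwards [(tendsto_norm_cobounded_atTop (E := E3)).eventually_ge_atTop 4] with h hh
  simp only [Function.comp]
  have he : heat 1 h = c * Real.exp (-(‖h‖ ^ 2 / (4 * 1))) := by rw [heat, hc]; ring
  have hc0 : 0 ≤ c := by positivity
  rw [he, mul_left_comm]
  gcongr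
  nlinarith

/-- The heat kernels are an approximate identity at the origin, where `|P|` is continuous with value
`0`. One-sided continuity is enough because norms are nonnegative. -/
theorem tendsto_integral_heat_mul_abs {P : ℝ → ℝ} (h0 : Integrable (fun h : E3 => P ‖h‖))
    (hz : P 0 = 0) (hc : ContinuousWithinAt P (Set.Ici 0) 0) :
    Tendsto (fun ε : ℝ => ∫ h : E3, heat ε h * |P ‖h‖|) (𝓝[>] 0) (𝓝 0) := by
  have hcont : ContinuousAt (fun h : E3 => |P ‖h‖|) 0 := by
    have h1 : Tendsto (fun h : E3 => ‖h‖) (𝓝 0) (𝓝[Set.Ici 0] 0) :=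
      tendsto_nhdsWithin_iff.2 ⟨by simpa using continuous_norm.tendsto (0 : E3),
        Eventually.of_forall fun h => norm_nonneg h⟩
    have h2 := (hc.tendsto.comp h1).abs
    simpa [ContinuousAt, Function.comp_def] using h2
  have h := tendsto_integral_comp_smul_smul_of_integrable (μ := (volume : Measure E3))
    (φ := heat 1) (heat_nonneg one_pos) (integral_heat one_pos)
    (by simpa using tendsto_norm_pow_mul_heat) h0.abs hcont
  have hε : Tendsto (fun ε : ℝ => (Real.sqrt ε)⁻¹) (𝓝[>] 0) atTop := by
    refine tendsto_inv_nhdsGT_zero.comp (tendsto_nhdsWithin_iff.2 ⟨?_, ?_⟩)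
    · have := (Real.continuous_sqrt.tendsto 0).mono_left (nhdsWithin_le_nhds (s := Set.Ioi 0))
      simpa using this
    · exact eventually_nhdsWithin_of_forall fun ε hε => Real.sqrt_pos.2 hε
  have h3 := h.comp hε
  simp only [norm_zero, hz, abs_zero, finrank_euclideanSpace, Fintype.card_fin] at h3
  refine h3.congr' (eventually_nhdsWithin_of_forall fun ε hε => ?_)
  simp only [Function.comp, smul_eq_mul, heat_eq_scale (Set.mem_Ioi.1 hε)]

/-- Wave vectors with sum `w.2` whose tail is `w.1`. -/
def totalPoint {n : ℕ} (w : (Fin n → E3) × E3) : Fin (n + 1) → E3 :=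
  Fin.cons (w.2 - ∑ i, w.1 i) w.1

theorem sum_totalPoint {n : ℕ} (w : (Fin n → E3) × E3) : ∑ i, totalPoint w i = w.2 := by
  simp [totalPoint, Fin.sum_univ_succ]

theorem totalPoint_add {n : ℕ} (z : Fin n → E3) (u h : E3) :
    totalPoint (z, u + h) = totalPoint (z, u) + Pi.single 0 h := by
  rw [totalPoint, totalPoint, ← cons_neg_sum_add_single, ← cons_neg_sum_add_single, Pi.single_add,
    add_assoc]

theorem continuous_totalPoint (n : ℕ) : Continuous (totalPoint (n := n)) := by
  unfold totalPoint; fun_prop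

theorem measurableEmbedding_totalPoint (n : ℕ) : MeasurableEmbedding (totalPoint (n := n)) := by
  refine (continuous_totalPoint n).measurableEmbedding fun w w' h => ?_
  have h1 := congrArg (fun k : Fin (n + 1) → E3 => ∑ i, k i) h
  simp only [sum_totalPoint] at h1
  exact Prod.ext (Fin.cons_inj.1 h).2 h1

theorem measurePreserving_totalPoint (n : ℕ) :
    MeasurePreserving (totalPoint (n := n)) volume volume := by
  have h := (measurePreserving_add_single n).comp
    ((measurePreserving_cons_neg_sum n).prod (MeasurePreserving.id (volume : Measure E3)))
  convert! h using 1
  funext w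
  simp [totalPoint, cons_neg_sum_add_single]

/-- For fixed `h` the deviation `u` of the total wave vector from `h` becomes a coordinate, so one
heat kernel integrates to one. The norm is taken outside the `h`-integral, so that cancellations in
it can be exploited. -/
theorem norm_integral_total_le {n : ℕ} {Q : E3 → (Fin (n + 1) → E3) → ℂ} {ε : ℝ} (hε : 0 < ε)
    (hI : Integrable (fun p : (Fin (n + 1) → E3) × E3 =>
      (heat ε (∑ i, p.1 i - p.2) : ℂ) * ((heat ε p.2 : ℂ) * Q p.2 p.1)) (volume.prod volume)) {B : ℝ}
    (hB : ∀ z u, ‖∫ h, (heat ε h : ℂ) * Q h (totalPoint (z, u + h))‖ ≤ B * decay z) :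
    ‖∫ k, (∫ h, (heat ε (∑ i, k i - h) : ℂ) * ((heat ε h : ℂ) * Q h k))‖ ≤
      B * ∫ z : Fin n → E3, decay z := by
  have hg : ∀ h : E3, MeasurePreserving (fun w : (Fin n → E3) × E3 => totalPoint (w.1, w.2 + h))
      volume volume := fun h => (measurePreserving_totalPoint n).comp
        ((MeasurePreserving.id volume).prod (measurePreserving_add_right volume h))
  have hemb : ∀ h : E3, MeasurableEmbedding
      (fun w : (Fin n → E3) × E3 => totalPoint (w.1, w.2 + h)) := fun h =>
    (measurableEmbedding_totalPoint n).comp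
      ((MeasurableEquiv.refl _).prodCongr (MeasurableEquiv.addRight h)).measurableEmbedding
  have hskew : MeasurePreserving (fun p : E3 × ((Fin n → E3) × E3) =>
      (p.1, totalPoint (p.2.1, p.2.2 + p.1))) (volume.prod volume) (volume.prod volume) :=
    (MeasurePreserving.id volume).skew_product
      (g := fun h (w : (Fin n → E3) × E3) => totalPoint (w.1, w.2 + h))
      (((continuous_totalPoint n).comp (by fun_prop)).measurable)
      (Eventually.of_forall fun h => (hg h).map_eq)
  have hI' := hskew.integrable_comp_of_integrable hI.swap
  rw [integral_integral_swap hI]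
  have h1 : ∀ h : E3, ∫ k : Fin (n + 1) → E3,
      (heat ε (∑ i, k i - h) : ℂ) * ((heat ε h : ℂ) * Q h k) =
      ∫ w : (Fin n → E3) × E3, (heat ε w.2 : ℂ) *
        ((heat ε h : ℂ) * Q h (totalPoint (w.1, w.2 + h))) := fun h => by
    rw [← (hg h).integral_comp (hemb h)]
    simp only [sum_totalPoint, add_sub_cancel_right]
  have h2 : Integrable (Function.uncurry fun (h : E3) (w : (Fin n → E3) × E3) =>
      (heat ε w.2 : ℂ) * ((heat ε h : ℂ) * Q h (totalPoint (w.1, w.2 + h))))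
      (volume.prod volume) := by
    refine hI'.congr (Eventually.of_forall fun p => ?_)
    simp [Function.comp, Function.uncurry, sum_totalPoint]
  simp_rw [h1]
  rw [integral_integral_swap h2]
  have hb := (integrable_decay n).mul_prod (integrable_heat hε)
  calc _ ≤ ∫ w : (Fin n → E3) × E3, B * (decay w.1 * heat ε w.2) := by
        refine norm_integral_le_of_norm_le (hb.const_mul B) (Eventually.of_forall fun w => ?_)
        rw [integral_const_mul, norm_mul, Complex.norm_real, Real.norm_of_nonneg (heat_nonneg hε _),
          ← mul_assoc, mul_comm]
        exact mul_le_mul_of_nonneg_right (hB w.1 w.2) (heat_nonneg hε _)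
    _ = _ := by
        rw [integral_const_mul]
        have := integral_prod_mul (μ := (volume : Measure (Fin n → E3))) (ν := (volume : Measure E3))
          decay (heat ε)
        rw [integral_heat hε, mul_one] at this
        rw [← this]
        rfl

theorem decay_le_tail {n : ℕ} (k : Fin (n + 1) → E3) : decay k ≤ decay (Fin.tail k) := by
  have := decay_cons_le (k 0) (Fin.tail k)
  rwa [Fin.cons_self_tail] at this

theorem tail_add_single {n : ℕ} (k : Fin (n + 1) → E3) (v : E3) :
    Fin.tail (k + Pi.single 0 v) = Fin.tail k := by
  funext i; simp [Fin.tail]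

theorem tail_totalPoint {n : ℕ} (w : (Fin n → E3) × E3) : Fin.tail (totalPoint w) = w.1 := by
  simp [totalPoint]

/-- Mean value inequality along a shift of label `0`: the tail of `k` stays fixed, so the decay of
the derivative is uniform along the segment. -/
theorem norm_schwartz_sub_le {n : ℕ} (φ : 𝓢(Fin (n + 1) → E3, ℂ)) : ∃ C : ℝ, 0 ≤ C ∧
    ∀ k v, ‖φ (k + Pi.single 0 v) - φ k‖ ≤ C * decay (Fin.tail k) * ‖v‖ := by
  obtain ⟨C, hC, h⟩ := exists_norm_le_decay φ 1
  refine ⟨C, hC, fun k v => ?_⟩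
  have hs : ‖(Pi.single 0 v : Fin (n + 1) → E3)‖ = ‖v‖ := by simp [Pi.norm_single]
  have := norm_image_sub_le_of_norm_deriv_le_segment_01' (E := ℂ)
    (f := fun τ : ℝ => φ (k + τ • (Pi.single 0 v : Fin (n + 1) → E3)))
    (f' := fun τ => fderiv ℝ φ (k + τ • (Pi.single 0 v : Fin (n + 1) → E3)) (Pi.single 0 v))
    (C := C * decay (Fin.tail k) * ‖v‖) (fun τ _ => ?_) (fun τ _ => ?_)
  · simpa using this
  · have h1 : HasDerivAt (fun τ : ℝ => k + τ • (Pi.single 0 v : Fin (n + 1) → E3))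
        (Pi.single 0 v) τ := by
      simpa using ((hasDerivAt_id τ).smul_const (Pi.single 0 v : Fin (n + 1) → E3)).const_add k
    exact ((φ.differentiableAt.hasFDerivAt).comp_hasDerivAt τ h1).hasDerivWithinAt
  · refine (ContinuousLinearMap.le_opNorm _ _).trans ?_
    rw [hs]
    gcongr
    rw [← norm_iteratedFDeriv_one]
    refine (h _).trans ?_
    gcongr
    refine (decay_le_tail _).trans_eq ?_
    rw [← Pi.single_smul, tail_add_single]

/-- Along the segment the Gaussian's derivative contributes at most `2`, since `σ²‖Y‖² e^{-σ²‖Y‖²/2}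
≤ 2`, and the linear form contributes `1`. The constant is thus independent of `σ` and `X`. -/
theorem abs_gauss_inner_sub_le (σ : ℝ) (X w h : E3) :
    |Real.exp (-(σ ^ 2 / 2) * ‖X + w‖ ^ 2) * inner ℝ (X + w) h -
      Real.exp (-(σ ^ 2 / 2) * ‖X‖ ^ 2) * inner ℝ X h| ≤ 3 * ‖w‖ * ‖h‖ := by
  have := norm_image_sub_le_of_norm_deriv_le_segment_01' (E := ℝ)
    (f := fun τ : ℝ => Real.exp (-(σ ^ 2 / 2) * ‖X + τ • w‖ ^ 2) * inner ℝ (X + τ • w) h)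
    (f' := fun τ => Real.exp (-(σ ^ 2 / 2) * ‖X + τ • w‖ ^ 2) *
      (-(σ ^ 2 / 2) * (2 * inner ℝ (X + τ • w) w)) * inner ℝ (X + τ • w) h +
      Real.exp (-(σ ^ 2 / 2) * ‖X + τ • w‖ ^ 2) * inner ℝ w h)
    (C := 3 * ‖w‖ * ‖h‖) (fun τ _ => ?_) (fun τ _ => ?_)
  · simpa using this
  · have h1 : HasDerivAt (fun τ : ℝ => X + τ • w) w τ := by
      simpa using ((hasDerivAt_id τ).smul_const w).const_add X
    have h2 := (h1.norm_sq.const_mul (-(σ ^ 2 / 2))).exp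
    have h3 := h1.inner ℝ (hasDerivAt_const τ h)
    simp only [inner_zero_right, zero_add] at h3
    exact (h2.mul h3).hasDerivWithinAt
  · set Y := X + τ • w
    have e1 := Real.exp_pos (-(σ ^ 2 / 2) * ‖Y‖ ^ 2)
    have e2 : Real.exp (-(σ ^ 2 / 2) * ‖Y‖ ^ 2) ≤ 1 := Real.exp_le_one_iff.2 (by
      nlinarith [mul_nonneg (sq_nonneg σ) (sq_nonneg ‖Y‖)])
    have e3 : Real.exp (-(σ ^ 2 / 2) * ‖Y‖ ^ 2) * (σ ^ 2 * ‖Y‖ ^ 2) ≤ 2 := by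
      have := Real.add_one_le_exp (σ ^ 2 / 2 * ‖Y‖ ^ 2)
      rw [neg_mul, Real.exp_neg, inv_mul_le_iff₀ (Real.exp_pos _)]
      linarith
    have i1 := abs_real_inner_le_norm Y w
    have i2 := abs_real_inner_le_norm Y h
    have i3 := abs_real_inner_le_norm w h
    rw [Real.norm_eq_abs]
    refine (abs_add_le _ _).trans ?_
    simp only [abs_mul, abs_neg, abs_of_pos e1, abs_two,
      abs_of_nonneg (by positivity : (0 : ℝ) ≤ σ ^ 2 / 2)]
    calc _ ≤ Real.exp (-(σ ^ 2 / 2) * ‖Y‖ ^ 2) * (σ ^ 2 / 2 * (2 * (‖Y‖ * ‖w‖))) * (‖Y‖ * ‖h‖) +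
          1 * (‖w‖ * ‖h‖) := by gcongr
      _ = (Real.exp (-(σ ^ 2 / 2) * ‖Y‖ ^ 2) * (σ ^ 2 * ‖Y‖ ^ 2)) * (‖w‖ * ‖h‖) +
          ‖w‖ * ‖h‖ := by ring
      _ ≤ 2 * (‖w‖ * ‖h‖) + ‖w‖ * ‖h‖ := by gcongr
      _ = _ := by ring

theorem labelSum_univ_compl {n : ℕ} (k : Fin n → E3) :
    labelSum k (Finset.univ : Finset (Fin n))ᶜ = 0 := by
  simp [labelSum]

theorem weightedLabelSum_univ_compl {n : ℕ} (g : Fin n → ℝ) (k : Fin n → E3) :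
    weightedLabelSum g k (Finset.univ : Finset (Fin n))ᶜ = 0 := by
  simp [weightedLabelSum]

theorem weightedLabelSum_add_single {n : ℕ} (g : Fin n → ℝ) (k : Fin n → E3) (r : Fin n) (v : E3) :
    weightedLabelSum g (k + Pi.single r v) Finset.univ =
      weightedLabelSum g k Finset.univ + g r • v := by
  simp only [weightedLabelSum, Pi.add_apply, smul_add, Finset.sum_add_distrib]
  congr 1
  rw [Finset.sum_eq_single r (fun b _ hb => by simp [Pi.single_eq_of_ne hb]) (by simp)]
  simp

/-- The part of the damped Fourier density of a single factor, for the grouping of all labels at the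
first particle, that depends on the wave vectors. -/
def univKernel {n : ℕ} (α σ : ℝ) (g : Fin n → ℝ) (φ : (Fin n → E3) → ℂ) (a : CorrFactor) (h : E3)
    (k : Fin n → E3) : ℂ :=
  ((damping σ g k Finset.univ Finset.univᶜ *
    factorGeom α (weightedLabelSum g k Finset.univ) (weightedLabelSum g k Finset.univᶜ) a h : ℝ) : ℂ) *
      φ k

section

variable {P : ℝ → ℝ} (h0 : Integrable (fun h : E3 => P ‖h‖))
  (h2 : Integrable (fun h : E3 => P ‖h‖ / ‖h‖ ^ 2)) {n : ℕ} (α : ℝ) {σ : ℝ} (hσ : 0 < σ)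
  (g : Fin n → ℝ) (φ : 𝓢(Fin n → E3, ℂ))

include h0 h2

theorem separationIntegral_factorValue {ε : ℝ} (hε : 0 < ε) (k l K L : E3) (a : CorrFactor) :
    separationIntegral ε k l (factorValue α P K L a) =
      (2 * Real.pi) ^ 6 * ((2 * Real.pi) ^ 3 : ℂ)⁻¹ *
        ∫ h, (heat ε (k - h) : ℂ) * (heat ε (l + h) : ℂ) * (factorWeight α P K L a h : ℂ) := by
  have h := separationIntegral_fourier volume hε k l (η := fun h : E3 => h) measurable_id
    (U := fun h => ((2 * Real.pi) ^ 3 : ℂ)⁻¹ * (factorWeight α P K L a h : ℂ))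
    ((integrable_factorWeight h0 h2 α K L a).ofReal.const_mul _)
  have e : factorValue α P K L a = fun x => ∫ h : E3, Complex.exp (Complex.I * (inner ℝ h x : ℝ)) *
      (((2 * Real.pi) ^ 3 : ℂ)⁻¹ * (factorWeight α P K L a h : ℂ)) := by
    funext x
    rw [factorValue, ← integral_const_mul]
    exact integral_congr_ae (Eventually.of_forall fun h => by ring)
  rw [e, h, mul_assoc]
  congr 1
  rw [← integral_const_mul]
  exact integral_congr_ae (Eventually.of_forall fun h => by ring)

/-- Without labels on the second particle its momentum wave vector vanishes, which kills `dp` and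
`pp`. -/
theorem pairSum_zero_right (x K : E3) : pairSum α P x K 0 =
    factorValue α P K 0 CorrFactor.pd x + factorValue α P K 0 CorrFactor.dd x := by
  have hp : factorValue α P K 0 CorrFactor.pp x = 0 := by simp [factorValue, factorWeight]
  have hd : factorValue α P K 0 CorrFactor.dp x = 0 := by simp [factorValue, factorWeight]
  rw [pairSum_eq h0 h2, hp, hd, Complex.exp_zero]
  ring

theorem groupingTerm_univ {ε : ℝ} (hε : 0 < ε) (k : Fin n → E3) :
    groupingTerm α σ P g Finset.univ ε k * φ k = (2 * Real.pi) ^ 6 * ((2 * Real.pi) ^ 3 : ℂ)⁻¹ *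
      ((∫ h, (heat ε (∑ i, k i - h) : ℂ) * ((heat ε h : ℂ) *
        ((P ‖h‖ : ℂ) * univKernel α σ g φ CorrFactor.pd h k))) +
      ∫ h, (heat ε (∑ i, k i - h) : ℂ) * ((heat ε h : ℂ) *
        ((P ‖h‖ : ℂ) * univKernel α σ g φ CorrFactor.dd h k))) := by
  have key : ∀ a, (damping σ g k Finset.univ Finset.univᶜ : ℂ) *
      separationIntegral ε (labelSum k Finset.univ) 0
        (factorValue α P (weightedLabelSum g k Finset.univ) 0 a) * φ k =
      (2 * Real.pi) ^ 6 * ((2 * Real.pi) ^ 3 : ℂ)⁻¹ *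
      ∫ h, (heat ε (∑ i, k i - h) : ℂ) * ((heat ε h : ℂ) *
        ((P ‖h‖ : ℂ) * univKernel α σ g φ a h k)) := by
    intro a
    rw [separationIntegral_factorValue h0 h2 α hε]
    calc _ = (2 * Real.pi) ^ 6 * ((2 * Real.pi) ^ 3 : ℂ)⁻¹ *
          ((damping σ g k Finset.univ Finset.univᶜ : ℂ) * φ k *
          ∫ h, (heat ε (labelSum k Finset.univ - h) : ℂ) * (heat ε (0 + h) : ℂ) *
            (factorWeight α P (weightedLabelSum g k Finset.univ) 0 a h : ℂ)) := by ring
      _ = _ := by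
        rw [← integral_const_mul]
        congr 1
        refine integral_congr_ae (Eventually.of_forall fun h => ?_)
        simp only [univKernel, factorWeight_eq, weightedLabelSum_univ_compl, zero_add, labelSum]
        push_cast
        ring
  rw [groupingTerm, labelSum_univ_compl, weightedLabelSum_univ_compl]
  simp only [pairSum_zero_right h0 h2]
  rw [mul_add, ← key, ← key, ← add_mul, ← mul_add]
  congr 2
  have hi := fun a => integrable_separation hε (labelSum k Finset.univ) 0
    (continuous_factorValue h0 h2 α (weightedLabelSum g k Finset.univ) 0 a)
    (norm_factorValue_le h0 h2 α (weightedLabelSum g k Finset.univ) 0 a)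
  rw [separationIntegral, separationIntegral, separationIntegral, ← integral_add (hi _) (hi _)]
  exact integral_congr_ae (Eventually.of_forall fun q => by simp only; ring)

include hσ

theorem integrable_univKernel {ε : ℝ} (hε : 0 < ε) (a : CorrFactor) :
    Integrable (fun p : (Fin n → E3) × E3 => (heat ε (∑ i, p.1 i - p.2) : ℂ) *
      ((heat ε p.2 : ℂ) * ((P ‖p.2‖ : ℂ) * univKernel α σ g φ a p.2 p.1)))
      (volume.prod volume) := by
  obtain ⟨C, hC0, hC⟩ := exists_decay_bound φ
  set G := wordBound σ 0
  have hG : ∀ k : Fin n → E3, damping σ g k Finset.univ Finset.univᶜ * factorGrowth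
      (weightedLabelSum g k Finset.univ) (weightedLabelSum g k Finset.univᶜ) a ≤ G := fun k => by
    have := singleWord_growth_le hσ g Finset.univ a 0 k
    rwa [prod_singleWord (factorGrowth _ _), pow_zero, mul_one] at this
  have hmeas : Measurable (Function.uncurry (univKernel α σ g φ a)) := by
    have hd := (continuous_damping σ g Finset.univ Finset.univᶜ).measurable.comp
      (measurable_snd : Measurable (Prod.snd : E3 × (Fin n → E3) → _))
    have h1 := (continuous_weightedLabelSum g Finset.univ).measurable.comp
      (measurable_snd : Measurable (Prod.snd : E3 × (Fin n → E3) → _))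
    have h2 := (continuous_weightedLabelSum g Finset.univᶜ).measurable.comp
      (measurable_snd : Measurable (Prod.snd : E3 × (Fin n → E3) → _))
    have hφ := φ.continuous.measurable.comp
      (measurable_snd : Measurable (Prod.snd : E3 × (Fin n → E3) → _))
    exact (Complex.measurable_ofReal.comp
      (hd.mul (measurable_factorGeom α a h1 h2 measurable_fst))).mul hφ
  have hb : ∀ (h : E3) (k : Fin n → E3), ‖(P ‖h‖ : ℂ) * univKernel α σ g φ a h k‖ ≤
      (1 + α ^ 2) * G * C * spectralMajorant P h * decay k := by
    intro h k
    have e : (P ‖h‖ : ℂ) * univKernel α σ g φ a h k =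
        ((damping σ g k Finset.univ Finset.univᶜ * factorWeight α P (weightedLabelSum g k Finset.univ)
          (weightedLabelSum g k Finset.univᶜ) a h : ℝ) : ℂ) * φ k := by
      rw [univKernel, factorWeight_eq]; push_cast; ring
    have hs := spectralMajorant_nonneg P h
    rw [e, norm_mul, Complex.norm_real, Real.norm_eq_abs, abs_mul,
      abs_of_pos (damping_pos _ _ _ _ _)]
    have hd := damping_pos σ g k Finset.univ Finset.univᶜ
    have hf := factorGrowth_nonneg (weightedLabelSum g k Finset.univ)
      (weightedLabelSum g k Finset.univᶜ) a
    calc _ ≤ damping σ g k Finset.univ Finset.univᶜ * ((1 + α ^ 2) * factorGrowth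
          (weightedLabelSum g k Finset.univ) (weightedLabelSum g k Finset.univᶜ) a *
          spectralMajorant P h) * (C * decay k) := by
          gcongr
          · exact abs_factorWeight_le _ _ _ _ _ _
          · exact hC k
      _ = (damping σ g k Finset.univ Finset.univᶜ * factorGrowth (weightedLabelSum g k Finset.univ)
          (weightedLabelSum g k Finset.univᶜ) a) *
          ((1 + α ^ 2) * spectralMajorant P h * (C * decay k)) := by ring
      _ ≤ G * ((1 + α ^ 2) * spectralMajorant P h * (C * decay k)) := by
          have := decay_nonneg k
          gcongr
          exact hG k
      _ = _ := by ring
  have hρ : AEStronglyMeasurable (fun h : E3 => (P ‖h‖ : ℂ)) := h0.ofReal.aestronglyMeasurable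
  have h := integrable_mollified_kernel (μ := volume) (η := fun h : E3 => h) measurable_id
    hρ hmeas
    (((integrable_spectralMajorant h0 h2).const_mul ((1 + α ^ 2) * G * C)))
    hb hε Finset.univ Finset.univᶜ
  refine h.congr (Eventually.of_forall fun p => ?_)
  simp only [labelSum_univ_compl, zero_add]
  simp only [labelSum]
  ring

end

section

variable {n : ℕ} (α : ℝ) {σ : ℝ} (hσ : 0 < σ) (g : Fin (n + 1) → ℝ) (φ : 𝓢(Fin (n + 1) → E3, ℂ))

theorem exists_norm_univKernel_dd_le : ∃ C : ℝ, 0 ≤ C ∧ ∀ h k,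
    ‖univKernel α σ g φ CorrFactor.dd h k‖ ≤ C * decay (Fin.tail k) := by
  obtain ⟨C, hC0, hC⟩ := exists_decay_bound φ
  refine ⟨C, hC0, fun h k => ?_⟩
  have hd : damping σ g k Finset.univ Finset.univᶜ ≤ 1 := Real.exp_le_one_iff.2 (by
    have : 0 ≤ ‖weightedLabelSum g k Finset.univ‖ ^ 2 + ‖weightedLabelSum g k Finset.univᶜ‖ ^ 2 := by
      positivity
    nlinarith [mul_nonneg (sq_nonneg σ) this])
  rw [univKernel, factorGeom, mul_one, norm_mul, Complex.norm_real,
    Real.norm_of_nonneg (damping_pos _ _ _ _ _).le]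
  refine (mul_le_of_le_one_left (norm_nonneg _) hd).trans ((hC k).trans ?_)
  gcongr
  exact decay_le_tail k

include hσ in
-- The `pd` kernel has a singularity of order `‖h‖⁻¹`. A shift by `h` gains a factor `‖h‖`, the
-- damped linear form and `φ` being Lipschitz, so the difference is bounded although the kernel is
-- not.
theorem exists_norm_univKernel_pd_sub_le : ∃ C : ℝ, 0 ≤ C ∧ ∀ h k,
    ‖univKernel α σ g φ CorrFactor.pd h (k + Pi.single 0 h) - univKernel α σ g φ CorrFactor.pd h k‖ ≤
      C * decay (Fin.tail k) := by
  obtain ⟨C, hC0, hC⟩ := exists_decay_bound φ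
  obtain ⟨M, hM0, hM⟩ := norm_schwartz_sub_le φ
  set G := wordBound σ 0 with hGdef
  -- The growth bound for words of length one, read for a single label of weight one with wave
  -- vector `X`.
  have hG : ∀ X : E3, Real.exp (-(σ ^ 2 / 2) * ‖X‖ ^ 2) * ‖X‖ ≤ G := fun X => by
    have := singleWord_growth_le hσ (fun _ => 1) Finset.univ CorrFactor.pd 0 (fun _ : Fin 1 => X)
    rw [prod_singleWord (factorGrowth _ _), pow_zero, mul_one] at this
    simp only [damping, weightedLabelSum_univ_compl] at this
    simpa [factorGrowth, weightedLabelSum] using this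
  have hG0 : 0 ≤ G := (mul_nonneg (Real.exp_pos _).le (norm_nonneg _)).trans (hG 0)
  refine ⟨|α| * (3 * |g 0| * C + G * M), by positivity, fun h k => ?_⟩
  rcases eq_or_ne h 0 with rfl | hh
  · simp only [Pi.single_zero, add_zero, sub_self, norm_zero]
    have := decay_nonneg (Fin.tail k)
    positivity
  have hh' : 0 < ‖h‖ := norm_pos_iff.2 hh
  set ξ : E3 → ℝ := fun X => Real.exp (-(σ ^ 2 / 2) * ‖X‖ ^ 2) * inner ℝ X h with hξ
  have e : ∀ k : Fin (n + 1) → E3, univKernel α σ g φ CorrFactor.pd h k =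
      ((α / ‖h‖ ^ 2 : ℝ) : ℂ) * ((ξ (weightedLabelSum g k Finset.univ) : ℂ) * φ k) := fun k => by
    simp only [univKernel, factorGeom, damping, weightedLabelSum_univ_compl, hξ, norm_zero]
    simp only [ne_eq, OfNat.ofNat_ne_zero, not_false_eq_true, zero_pow, add_zero]
    push_cast
    ring
  set X := weightedLabelSum g k Finset.univ with hX
  have hd := decay_nonneg (Fin.tail k)
  have h1 : |ξ (X + g 0 • h) - ξ X| ≤ 3 * (|g 0| * ‖h‖) * ‖h‖ := by
    have := abs_gauss_inner_sub_le σ X (g 0 • h) h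
    rwa [norm_smul, Real.norm_eq_abs] at this
  have h2 : |ξ X| ≤ G * ‖h‖ := by
    simp only [hξ]
    rw [abs_mul, abs_of_pos (Real.exp_pos _)]
    calc _ ≤ Real.exp (-(σ ^ 2 / 2) * ‖X‖ ^ 2) * (‖X‖ * ‖h‖) := by
          gcongr; exact abs_real_inner_le_norm X h
      _ = Real.exp (-(σ ^ 2 / 2) * ‖X‖ ^ 2) * ‖X‖ * ‖h‖ := by ring
      _ ≤ _ := by gcongr; exact hG X
  have h3 : ‖φ (k + Pi.single 0 h)‖ ≤ C * decay (Fin.tail k) := by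
    refine (hC _).trans ?_
    gcongr
    exact (decay_le_tail _).trans_eq (by rw [tail_add_single])
  have h4 : ((ξ (X + g 0 • h) : ℂ) * φ (k + Pi.single 0 h) - (ξ X : ℂ) * φ k) =
      ((ξ (X + g 0 • h) - ξ X : ℝ) : ℂ) * φ (k + Pi.single 0 h) +
        (ξ X : ℂ) * (φ (k + Pi.single 0 h) - φ k) := by push_cast; ring
  rw [e, e, weightedLabelSum_add_single, ← mul_sub, h4, norm_mul, Complex.norm_real,
    Real.norm_eq_abs, abs_div, abs_of_nonneg (sq_nonneg ‖h‖)]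
  calc _ ≤ |α| / ‖h‖ ^ 2 * (3 * (|g 0| * ‖h‖) * ‖h‖ * (C * decay (Fin.tail k)) +
        G * ‖h‖ * (M * decay (Fin.tail k) * ‖h‖)) := by
        gcongr
        refine (norm_add_le _ _).trans ?_
        rw [norm_mul, norm_mul, Complex.norm_real, Complex.norm_real, Real.norm_eq_abs,
          Real.norm_eq_abs]
        gcongr
        exact hM k h
    _ = _ := by field_simp

end

section

variable {P : ℝ → ℝ} (h0 : Integrable (fun h : E3 => P ‖h‖))
  (h2 : Integrable (fun h : E3 => P ‖h‖ / ‖h‖ ^ 2)) {n : ℕ} (α : ℝ) {σ : ℝ} (hσ : 0 < σ)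
  (g : Fin (n + 1) → ℝ) (φ : 𝓢(Fin (n + 1) → E3, ℂ))

include h0 in
theorem integrable_heat_mul_abs {ε : ℝ} (hε : 0 < ε) :
    Integrable fun h : E3 => heat ε h * |P ‖h‖| :=
  h0.abs.bdd_mul (c := heat ε 0) (continuous_heat ε).aestronglyMeasurable
    (Eventually.of_forall fun h => by
      rw [Real.norm_of_nonneg (heat_nonneg hε h)]; exact heat_le hε h)

include h0 in
theorem norm_integral_heat_mul_le {ε : ℝ} (hε : 0 < ε) {F : E3 → ℂ} {B : ℝ}
    (hF : ∀ h, ‖F h‖ ≤ B) :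
    ‖∫ h, (heat ε h : ℂ) * ((P ‖h‖ : ℂ) * F h)‖ ≤ B * ∫ h : E3, heat ε h * |P ‖h‖| := by
  rw [← integral_const_mul]
  refine norm_integral_le_of_norm_le ((integrable_heat_mul_abs h0 hε).const_mul B)
    (Eventually.of_forall fun h => ?_)
  rw [norm_mul, norm_mul, Complex.norm_real, Complex.norm_real,
    Real.norm_of_nonneg (heat_nonneg hε h), Real.norm_eq_abs, ← mul_assoc, mul_comm]
  exact mul_le_mul_of_nonneg_right (hF h)
    (mul_nonneg (heat_nonneg hε h) (abs_nonneg _))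

include h0 h2 in
-- With the wave vectors frozen at `k` the integrand is odd in `h` and integrates to zero.
-- Subtracting it leaves only the bounded difference.
theorem norm_integral_univKernel_pd_le {ε : ℝ} (hε : 0 < ε) {C : ℝ}
    (hC : ∀ h k, ‖univKernel α σ g φ CorrFactor.pd h (k + Pi.single 0 h) -
      univKernel α σ g φ CorrFactor.pd h k‖ ≤ C * decay (Fin.tail k)) (k : Fin (n + 1) → E3) :
    ‖∫ h, (heat ε h : ℂ) * ((P ‖h‖ : ℂ) * univKernel α σ g φ CorrFactor.pd h
      (k + Pi.single 0 h))‖ ≤ C * decay (Fin.tail k) * ∫ h : E3, heat ε h * |P ‖h‖| := by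
  set F : E3 → ℂ := fun h => (heat ε h : ℂ) * ((P ‖h‖ : ℂ) * univKernel α σ g φ CorrFactor.pd h
    (k + Pi.single 0 h)) with hF
  set F' : E3 → ℂ := fun h => (heat ε h : ℂ) * ((P ‖h‖ : ℂ) *
    univKernel α σ g φ CorrFactor.pd h k) with hF'
  have hodd : ∫ h, F' h = 0 := by
    have : ∫ h, F' h = -∫ h, F' h := by
      conv_lhs => rw [← integral_neg_eq_self]
      rw [← integral_neg]
      refine integral_congr_ae (Eventually.of_forall fun h => ?_)
      simp only [hF', heat_neg, norm_neg, univKernel, factorGeom, inner_neg_right]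
      push_cast
      ring
    exact self_eq_neg.1 this
  have hint : Integrable F' := by
    have hw : Integrable fun h => (factorWeight α P (weightedLabelSum g k Finset.univ) 0
        CorrFactor.pd h : ℂ) := (integrable_factorWeight h0 h2 α _ 0 CorrFactor.pd).ofReal
    have h := hw.mul_const ((damping σ g k Finset.univ Finset.univᶜ : ℂ) * φ k)
    have h' := h.bdd_mul (c := heat ε 0) (f := fun h => (heat ε h : ℂ))
      (Complex.continuous_ofReal.comp (continuous_heat ε)).aestronglyMeasurable
      (Eventually.of_forall fun h => by
        rw [Complex.norm_real, Real.norm_of_nonneg (heat_nonneg hε h)]; exact heat_le hε h)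
    refine h'.congr (Eventually.of_forall fun h => ?_)
    simp only [hF', univKernel, factorWeight, factorGeom]
    push_cast
    ring
  by_cases hi : Integrable F
  · have : ∫ h, F h = ∫ h, (heat ε h : ℂ) * ((P ‖h‖ : ℂ) * (univKernel α σ g φ CorrFactor.pd h
        (k + Pi.single 0 h) - univKernel α σ g φ CorrFactor.pd h k)) := by
      rw [← sub_zero (∫ h, F h), ← hodd, ← integral_sub hi hint]
      refine integral_congr_ae (Eventually.of_forall fun h => ?_)
      simp only [hF, hF']
      ring
    rw [this]
    exact norm_integral_heat_mul_le h0 hε fun h => hC h k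
  -- The integral of a non-integrable function is `0` by convention, and the bound is nonnegative.
  · rw [integral_undef hi, norm_zero]
    have := (norm_nonneg _).trans (hC 0 k)
    exact mul_nonneg this (integral_nonneg fun h => mul_nonneg (heat_nonneg hε h) (abs_nonneg _))

include h0 h2 hσ in
/-- The grouping of all labels at one particle does not contribute to the cumulant. -/
theorem tendsto_integral_groupingTerm_univ (hz : P 0 = 0)
    (hc : ContinuousWithinAt P (Set.Ici 0) 0) :
    Tendsto (fun ε : ℝ => ∫ k, groupingTerm α σ P g Finset.univ ε k * φ k) (𝓝[>] 0) (𝓝 0) := by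
  obtain ⟨C, hC0, hC⟩ := exists_norm_univKernel_dd_le α (σ := σ) g φ
  obtain ⟨M, hM0, hM⟩ := exists_norm_univKernel_pd_sub_le α hσ g φ
  set c : ℂ := (2 * Real.pi) ^ 6 * ((2 * Real.pi) ^ 3 : ℂ)⁻¹ with hcdef
  set I : ℝ := ∫ z : Fin n → E3, decay z
  have hlim : Tendsto (fun ε : ℝ => ‖c‖ * ((M * (∫ h : E3, heat ε h * |P ‖h‖|)) * I +
      (C * ∫ h : E3, heat ε h * |P ‖h‖|) * I)) (𝓝[>] 0) (𝓝 0) := by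
    have h := tendsto_integral_heat_mul_abs h0 hz hc
    have := (((h.const_mul M).mul_const I).add ((h.const_mul C).mul_const I)).const_mul ‖c‖
    simpa using this
  refine squeeze_zero_norm' (eventually_nhdsWithin_of_forall fun ε hε => ?_) hlim
  have hε : 0 < ε := hε
  simp_rw [groupingTerm_univ h0 h2 α g φ hε]
  have hI := fun a => integrable_univKernel h0 h2 α hσ g φ hε a
  rw [integral_const_mul, norm_mul,
    integral_add (hI .pd).integral_prod_left (hI .dd).integral_prod_left]
  gcongr
  refine (norm_add_le _ _).trans (add_le_add ?_ ?_)
  · refine norm_integral_total_le (Q := fun h k => (P ‖h‖ : ℂ) * univKernel α σ g φ .pd h k) hε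
      (hI .pd) fun z u => ?_
    simp only [totalPoint_add]
    refine (norm_integral_univKernel_pd_le h0 h2 α g φ hε hM _).trans_eq ?_
    rw [tail_totalPoint]
    ring
  · refine norm_integral_total_le (Q := fun h k => (P ‖h‖ : ℂ) * univKernel α σ g φ .dd h k) hε
      (hI .dd) fun z u => ?_
    refine (norm_integral_heat_mul_le h0 hε (B := C * decay z) fun h => ?_).trans_eq (by ring)
    exact (hC _ _).trans_eq (by rw [tail_totalPoint])
end

/-! ### Identification of the limits -/

theorem integral_fin_zero (f : (Fin 0 → E3) → ℂ) : ∫ y, f y = f Fin.elim0 := by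
  rw [Measure.volume_pi_eq_dirac (Fin.elim0 : Fin 0 → E3), integral_dirac]

theorem measurePreserving_const_fin_one :
    MeasurePreserving (fun h : E3 => (fun _ : Fin 1 => h)) volume volume :=
  (volume_preserving_funUnique (Fin 1) E3).symm

theorem measurableEmbedding_const_fin_one : MeasurableEmbedding (fun h : E3 => (fun _ : Fin 1 => h)) :=
  (MeasurableEquiv.funUnique (Fin 1) E3).symm.measurableEmbedding

theorem integral_fin_one (f : (Fin 1 → E3) → ℂ) : ∫ y, f y = ∫ h : E3, f (fun _ => h) :=
  (measurePreserving_const_fin_one.integral_comp measurableEmbedding_const_fin_one f).symm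

theorem ae_diracSum_sum_eq_zero (n : ℕ) : ∀ᵐ k ∂diracSum n, ∑ i, k i = 0 := by
  rw [diracSum, (measurableEmbedding_cons_neg_sum n).ae_map_iff]
  exact Eventually.of_forall fun k => by simp [Fin.sum_univ_succ]

theorem wordWeight_singleWord_zero (α : ℝ) (P : ℝ → ℝ) (K L : E3) (a : CorrFactor) (v : E3)
    (y : Fin 0 → E3) : wordWeight α P K L (singleWord a 0) (Fin.cons v y) =
      factorWeight α P K L a v := by
  rw [wordWeight, Fin.prod_univ_succ]
  simp [singleWord]

theorem wordWeight_singleWord_one (α : ℝ) (P : ℝ → ℝ) (K L : E3) (a : CorrFactor) (v h : E3) :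
    wordWeight α P K L (singleWord a 1) (Fin.cons v fun _ => h) =
      factorWeight α P K L a v * factorWeight α P K L CorrFactor.pp h := by
  rw [wordWeight, Fin.prod_univ_succ]
  simp [singleWord]

theorem wordWeight_crossedWord_zero (α : ℝ) (P : ℝ → ℝ) (K L : E3) (v h : E3) :
    wordWeight α P K L (crossedWord 0) (Fin.cons v fun _ => h) =
      factorWeight α P K L CorrFactor.dp v * factorWeight α P K L CorrFactor.pd h := by
  rw [wordWeight, Fin.prod_univ_succ]
  simp [crossedWord]

/-- In a word of length one the only separation variable is `k_s`. The vanishing total replaces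
`k_{sᶜ}` by `-k_s`, which accounts for the signs in `T21`. -/
theorem sum_dampedWeight_zero {n : ℕ} (α σ : ℝ) (P : ℝ → ℝ) (g : Fin n → ℝ) (s : Finset (Fin n))
    {k : Fin n → E3} (hk : ∑ i, k i = 0) (y : Fin 0 → E3) :
    ∑ a, singleCoeff a 0 * dampedWeight α σ P g s (singleWord a 0) k
      (Fin.cons (labelSum k s - ∑ i, y i) y) = T21 α σ P g k s sᶜ := by
  have h2 : labelSum k sᶜ = -labelSum k s := by rw [labelSum_compl, hk, zero_sub]
  simp only [sum_corrFactor, dampedWeight, wordWeight_singleWord_zero, Finset.univ_eq_empty,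
    Finset.sum_empty, sub_zero, factorWeight, singleCoeff, T21, h2, inner_neg_left, inner_neg_right,
    norm_neg]
  rw [real_inner_comm (weightedLabelSum g k sᶜ), real_inner_comm (weightedLabelSum g k s)]
  simp only [zero_add, Nat.factorial_one, Nat.factorial_zero, Nat.cast_one, inv_one]
  ring

/-- The trailing factor carries `h` and the leading one `l = k_s - h`. The crossed word yields the
first term of `T22Integrand`; the `1/2` in the last term is the coefficient `1/2!` of the double
`pp` word. -/
theorem sum_dampedWeight_one {n : ℕ} (α σ : ℝ) (P : ℝ → ℝ) (g : Fin n → ℝ) (s : Finset (Fin n))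
    (k : Fin n → E3) (h : E3) :
    ∑ a, singleCoeff a 1 * dampedWeight α σ P g s (singleWord a 1) k
        (Fin.cons (labelSum k s - h) (fun _ => h)) +
      dampedWeight α σ P g s (crossedWord 0) k (Fin.cons (labelSum k s - h) (fun _ => h)) =
      damping σ g k s sᶜ * T22Integrand α P g k s sᶜ h := by
  simp only [sum_corrFactor, dampedWeight, wordWeight_singleWord_one, wordWeight_crossedWord_zero,
    factorWeight, singleCoeff, T22Integrand]
  norm_num [Nat.factorial]
  ring

section

variable {P : ℝ → ℝ} (h0 : Integrable (fun h : E3 => P ‖h‖))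
  (h2 : Integrable (fun h : E3 => P ‖h‖ / ‖h‖ ^ 2)) {m : ℕ} (α : ℝ) {σ : ℝ} (hσ : 0 < σ)
  (g : Fin (m + 2) → ℝ)
  (r : Fin (m + 1)) {s : Finset (Fin (m + 2))} (hs : (0 : Fin (m + 2)) ∈ s)
  (hr : r.succ ∉ s) {φ : (Fin (m + 2) → E3) → ℂ} (hφ : Continuous φ) {C : ℝ} (hC0 : 0 ≤ C)
  (hC : ∀ k, ‖φ k‖ ≤ C * decay k)

include h0 h2 hs hr hφ hC0 hC

theorem integrable_dampedWeight_zero (w : Fin 1 → CorrFactor) {G : ℝ}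
    (hG : ∀ k, damping σ g k s sᶜ *
      ∏ i, factorGrowth (weightedLabelSum g k s) (weightedLabelSum g k sᶜ) (w i) ≤ G) :
    Integrable (fun k => (dampedWeight α σ P g s w k
      (Fin.cons (labelSum k s - ∑ i, (Fin.elim0 : Fin 0 → E3) i) Fin.elim0) : ℂ) * φ k)
      (diracSum (m + 1)) := by
  have h := (integrable_dampedWeight_diracSum h0 h2 α σ g r hs hr w hG hC0 hφ hC).integral_prod_left
  simpa only [integral_fin_zero] using h

theorem integrable_dampedWeight_one (w : Fin 2 → CorrFactor) {G : ℝ}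
    (hG : ∀ k, damping σ g k s sᶜ *
      ∏ i, factorGrowth (weightedLabelSum g k s) (weightedLabelSum g k sᶜ) (w i) ≤ G) :
    Integrable (fun p : (Fin (m + 2) → E3) × E3 => (dampedWeight α σ P g s w p.1
      (Fin.cons (labelSum p.1 s - p.2) (fun _ => p.2)) : ℂ) * φ p.1)
      ((diracSum (m + 1)).prod volume) := by
  have h := integrable_dampedWeight_diracSum h0 h2 α σ g r hs hr w hG hC0 hφ hC
  have h' := ((MeasurePreserving.id (diracSum (m + 1))).prod
    measurePreserving_const_fin_one).integrable_comp_of_integrable h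
  refine h'.congr (Eventually.of_forall fun p => ?_)
  simp [Function.comp]

include hσ

theorem integrable_T21 : Integrable (fun k => (T21 α σ P g k s sᶜ : ℂ) * φ k)
    (diracSum (m + 1)) := by
  have h := integrable_finsetSum Finset.univ fun (a : CorrFactor) _ =>
    (integrable_dampedWeight_zero h0 h2 α g r hs hr hφ hC0 hC (singleWord a 0)
      (singleWord_growth_le hσ g s a 0)).const_mul (singleCoeff a 0 : ℂ)
  refine h.congr ?_
  filter_upwards [ae_diracSum_sum_eq_zero (m + 1)] with k hk
  rw [← sum_dampedWeight_zero α σ P g s hk Fin.elim0, Complex.ofReal_sum, Finset.sum_mul]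
  refine Finset.sum_congr rfl fun a _ => ?_
  push_cast
  ring

theorem integrable_damped_T22Integrand :
    Integrable (fun p : (Fin (m + 2) → E3) × E3 =>
      ((damping σ g p.1 s sᶜ * T22Integrand α P g p.1 s sᶜ p.2 : ℝ) : ℂ) * φ p.1)
      ((diracSum (m + 1)).prod volume) := by
  have h := (integrable_finsetSum Finset.univ fun (a : CorrFactor) _ =>
    (integrable_dampedWeight_one h0 h2 α g r hs hr hφ hC0 hC (singleWord a 1)
      (singleWord_growth_le hσ g s a 1)).const_mul (singleCoeff a 1 : ℂ)).add
    (integrable_dampedWeight_one h0 h2 α g r hs hr hφ hC0 hC (crossedWord 0)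
      (crossedWord_growth_le hσ g s 0))
  refine h.congr (Eventually.of_forall fun p => ?_)
  simp only [← sum_dampedWeight_one, Complex.ofReal_add, Complex.ofReal_sum, add_mul, Finset.sum_mul,
    Pi.add_apply]
  congr 1
  refine Finset.sum_congr rfl fun a _ => ?_
  push_cast
  ring

omit h0 h2 hσ hs hr hφ hC0 hC in
theorem T22_mul_eq {n : ℕ} (α σ : ℝ) (P : ℝ → ℝ) (g : Fin n → ℝ) (s : Finset (Fin n))
    (k : Fin n → E3) (c : ℂ) : (T22 α σ P g k s sᶜ : ℂ) * c = ((2 * Real.pi) ^ 3 : ℂ)⁻¹ *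
      ∫ h : E3, ((damping σ g k s sᶜ * T22Integrand α P g k s sᶜ h : ℝ) : ℂ) * c := by
  rw [integral_mul_const, integral_complex_ofReal, integral_const_mul, T22]
  push_cast
  ring

theorem integrable_T22 : Integrable (fun k => (T22 α σ P g k s sᶜ : ℂ) * φ k)
    (diracSum (m + 1)) := by
  simp only [T22_mul_eq]
  exact (integrable_damped_T22Integrand h0 h2 α hσ g r hs hr hφ hC0 hC).integral_prod_left.const_mul _

end

section

variable {P : ℝ → ℝ} (h0 : Integrable (fun h : E3 => P ‖h‖))
  (h2 : Integrable (fun h : E3 => P ‖h‖ / ‖h‖ ^ 2)) {m : ℕ} (α : ℝ) {σ : ℝ} (hσ : 0 < σ)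
  (g : Fin (m + 2) → ℝ)
  (r : Fin (m + 1)) {s : Finset (Fin (m + 2))} (hs : (0 : Fin (m + 2)) ∈ s)
  (hr : r.succ ∉ s) (φ : 𝓢(Fin (m + 2) → E3, ℂ))

include h0 h2 hσ hs hr

/-- With the strictly positive weight `decay` as test function, Fubini gives integrability of almost
every section, and the positive prefactor is then divided out. -/
theorem ae_integrable_T22Integrand :
    ∀ᵐ k ∂diracSum (m + 1), Integrable (T22Integrand α P g k s sᶜ) := by
  have h := integrable_damped_T22Integrand h0 h2 α hσ g r hs hr
    (φ := fun k => (decay k : ℂ)) (C := 1)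
    (Complex.continuous_ofReal.comp (continuous_decay _)) zero_le_one
    (fun k => by rw [Complex.norm_real, Real.norm_of_nonneg (decay_nonneg k), one_mul])
  filter_upwards [h.prod_right_ae] with k hk
  have hd : damping σ g k s sᶜ * decay k ≠ 0 := by
    refine mul_ne_zero (damping_pos _ _ _ _ _).ne' (Finset.prod_pos fun i _ => ?_).ne'
    positivity
  have hk' := hk.re.const_mul (damping σ g k s sᶜ * decay k)⁻¹
  refine hk'.congr (Eventually.of_forall fun h => ?_)
  simp only [← Complex.ofReal_mul, RCLike.re_eq_complex_re, Complex.ofReal_re]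
  rw [mul_right_comm, inv_mul_cancel_left₀ hd]

theorem singleSum_wordLimit_zero :
    singleSum (fun _ w => wordLimit α σ P g s w φ) 0 = (2 * Real.pi : ℂ) ^ 3 *
      ∫ k, (T21 α σ P g k s sᶜ : ℂ) * φ k ∂diracSum (m + 1) := by
  obtain ⟨C, hC0, hC⟩ := exists_decay_bound φ
  have hpi : (2 * Real.pi : ℂ) ≠ 0 := by simp [Real.pi_ne_zero]
  have hI := fun a => integrable_dampedWeight_zero h0 h2 α g r hs hr φ.continuous hC0 hC
    (singleWord a 0) (singleWord_growth_le hσ g s a 0)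
  have e : ∫ k, (T21 α σ P g k s sᶜ : ℂ) * φ k ∂diracSum (m + 1) =
      ∑ a, (singleCoeff a 0 : ℂ) * ∫ k, (dampedWeight α σ P g s (singleWord a 0) k
        (Fin.cons (labelSum k s - ∑ i, (Fin.elim0 : Fin 0 → E3) i) Fin.elim0) : ℂ) * φ k
          ∂diracSum (m + 1) := by
    simp_rw [← integral_const_mul]
    rw [← integral_finsetSum _ fun a _ => (hI a).const_mul _]
    refine integral_congr_ae ?_
    filter_upwards [ae_diracSum_sum_eq_zero (m + 1)] with k hk
    rw [← sum_dampedWeight_zero α σ P g s hk Fin.elim0, Complex.ofReal_sum, Finset.sum_mul]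
    refine Finset.sum_congr rfl fun a _ => ?_
    push_cast
    ring
  rw [e, singleSum, Finset.mul_sum]
  refine Finset.sum_congr rfl fun a _ => ?_
  -- The position integrals give `(2π)⁶` and each factor gives `(2π)⁻³`.
  have hc : (2 * Real.pi : ℂ) ^ 6 * ((2 * Real.pi : ℂ) ^ 3)⁻¹ ^ (0 + 1) = (2 * Real.pi) ^ 3 := by
    rw [zero_add, pow_one]; field_simp
  rw [wordLimit, hc]
  simp only [integral_fin_zero]
  ring

theorem singleSum_add_crossedSum_wordLimit :
    singleSum (fun _ w => wordLimit α σ P g s w φ) 1 +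
      crossedSum (fun _ w => wordLimit α σ P g s w φ) 0 = (2 * Real.pi : ℂ) ^ 3 *
      ∫ k, (T22 α σ P g k s sᶜ : ℂ) * φ k ∂diracSum (m + 1) := by
  obtain ⟨C, hC0, hC⟩ := exists_decay_bound φ
  have hpi : (2 * Real.pi : ℂ) ≠ 0 := by simp [Real.pi_ne_zero]
  have hS := fun a => integrable_dampedWeight_one h0 h2 α g r hs hr φ.continuous hC0 hC
    (singleWord a 1) (singleWord_growth_le hσ g s a 1)
  have hX := integrable_dampedWeight_one h0 h2 α g r hs hr φ.continuous hC0 hC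
    (crossedWord 0) (crossedWord_growth_le hσ g s 0)
  have hw : ∀ w : Fin 2 → CorrFactor, Integrable (fun p : (Fin (m + 2) → E3) × E3 =>
      (dampedWeight α σ P g s w p.1 (Fin.cons (labelSum p.1 s - p.2) (fun _ => p.2)) : ℂ) * φ p.1)
      ((diracSum (m + 1)).prod volume) → wordLimit α σ P g s w φ =
      ∫ p : (Fin (m + 2) → E3) × E3, (dampedWeight α σ P g s w p.1
        (Fin.cons (labelSum p.1 s - p.2) (fun _ => p.2)) : ℂ) * φ p.1
          ∂((diracSum (m + 1)).prod volume) := by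
    intro w hI
    -- For two factors the prefactors cancel; the remaining `(2π)³` of the statement is offset by
    -- the inverse inside `T22`.
    have hc : (2 * Real.pi : ℂ) ^ 6 * ((2 * Real.pi : ℂ) ^ 3)⁻¹ ^ (1 + 1) = 1 := by
      rw [one_add_one_eq_two]; field_simp
    rw [wordLimit, integral_prod _ hI, hc, one_mul]
    simp only [integral_fin_one, Finset.univ_unique, Finset.sum_const, Finset.card_singleton, one_smul]
  have e : (2 * Real.pi : ℂ) ^ 3 * ∫ k, (T22 α σ P g k s sᶜ : ℂ) * φ k ∂diracSum (m + 1) =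
      ∫ p : (Fin (m + 2) → E3) × E3,
        ((damping σ g p.1 s sᶜ * T22Integrand α P g p.1 s sᶜ p.2 : ℝ) : ℂ) * φ p.1
          ∂((diracSum (m + 1)).prod volume) := by
    rw [integral_prod _ (integrable_damped_T22Integrand h0 h2 α hσ g r hs hr φ.continuous hC0 hC)]
    simp only [T22_mul_eq]
    rw [integral_const_mul]
    field_simp
  rw [e, singleSum, crossedSum, hw _ hX]
  simp_rw [fun a => hw _ (hS a), ← integral_const_mul]
  rw [← integral_finsetSum _ fun a _ => (hS a).const_mul _,
    ← integral_add (integrable_finsetSum _ fun a _ => (hS a).const_mul _) (hX.const_mul _)]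
  refine integral_congr_ae (Eventually.of_forall fun p => ?_)
  simp only [← sum_dampedWeight_one, Complex.ofReal_add, Complex.ofReal_sum, add_mul, Finset.sum_mul]
  congr 1
  · refine Finset.sum_congr rfl fun a _ => ?_
    push_cast
    ring
  · simp

end

/-! ### Exchange symmetry of the label groupings -/

theorem T21_comm {n : ℕ} (α σ : ℝ) (P : ℝ → ℝ) (g : Fin n → ℝ) {k : Fin n → E3}
    (hk : ∑ i, k i = 0) (s : Finset (Fin n)) :
    T21 α σ P g k sᶜ s = T21 α σ P g k s sᶜ := by
  have h2 : labelSum k sᶜ = -labelSum k s := by rw [labelSum_compl, hk, zero_sub]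
  simp only [T21, h2, norm_neg, damping_comm σ g k sᶜ s]
  ring

/-- The part of the integrand of `T^{(2,2)}` that is due to two crossed density-momentum lines. -/
def crossedIntegrand {n : ℕ} (α : ℝ) (P : ℝ → ℝ) (g : Fin n → ℝ) (k : Fin n → E3)
    (s : Finset (Fin n)) (h : E3) : ℝ :=
  factorWeight α P (weightedLabelSum g k s) (weightedLabelSum g k sᶜ) CorrFactor.dp
      (labelSum k s - h) *
    factorWeight α P (weightedLabelSum g k s) (weightedLabelSum g k sᶜ) CorrFactor.pd h

/-- After `h ↦ -h` all terms containing a `pp` factor are invariant under the exchange; only in the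
crossed pair do the two wave vectors `h` and `l` change places. -/
theorem T22Integrand_compl {n : ℕ} (α : ℝ) (P : ℝ → ℝ) (g : Fin n → ℝ) {k : Fin n → E3}
    (hk : ∑ i, k i = 0) (s : Finset (Fin n)) (h : E3) :
    T22Integrand α P g k sᶜ s h = T22Integrand α P g k s sᶜ (-h) +
      (crossedIntegrand α P g k s (labelSum k s - -h) - crossedIntegrand α P g k s (-h)) := by
  have h2 : labelSum k sᶜ = -labelSum k s := by rw [labelSum_compl, hk, zero_sub]
  have h3 : -labelSum k s - h = -(labelSum k s - -h) := by abel
  have h4 : labelSum k s - (labelSum k s - -h) = -h := by abel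
  simp only [T22Integrand, crossedIntegrand, factorWeight, h2, h3, h4, norm_neg, inner_neg_right]
  ring

/-- The defect of symmetry vanishes only after integration, by the substitution `h ↦ k_s - h`;
splitting it off requires the crossed part to be integrable by itself. -/
theorem integrable_T22Integrand_compl {n : ℕ} {α : ℝ} {P : ℝ → ℝ} {g : Fin n → ℝ} {k : Fin n → E3}
    (hk : ∑ i, k i = 0) {s : Finset (Fin n)} (hT : Integrable (T22Integrand α P g k s sᶜ))
    (hA : Integrable (crossedIntegrand α P g k s)) : Integrable (T22Integrand α P g k sᶜ s) ∧
      ∫ h, T22Integrand α P g k sᶜ s h = ∫ h, T22Integrand α P g k s sᶜ h := by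
  have hA' := hA.comp_sub_left (labelSum k s)
  have e : T22Integrand α P g k sᶜ s = fun h => (T22Integrand α P g k s sᶜ (-h) +
      (crossedIntegrand α P g k s (labelSum k s - -h) - crossedIntegrand α P g k s (-h))) :=
    funext fun h => T22Integrand_compl α P g hk s h
  have hS : Integrable fun h => crossedIntegrand α P g k s (labelSum k s - h) -
      crossedIntegrand α P g k s h := hA'.sub hA
  have hI : Integrable fun h => T22Integrand α P g k s sᶜ h +
      (crossedIntegrand α P g k s (labelSum k s - h) - crossedIntegrand α P g k s h) := hT.add hS
  rw [e]
  refine ⟨hI.comp_neg, ?_⟩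
  rw [integral_neg_eq_self (fun h => T22Integrand α P g k s sᶜ h +
      (crossedIntegrand α P g k s (labelSum k s - h) - crossedIntegrand α P g k s h)),
    integral_add hT hS, integral_sub hA' hA, integral_sub_left_eq_self, sub_self, add_zero]

section

variable {P : ℝ → ℝ} (h0 : Integrable (fun h : E3 => P ‖h‖))
  (h2 : Integrable (fun h : E3 => P ‖h‖ / ‖h‖ ^ 2)) {n : ℕ} (α : ℝ) {σ : ℝ} (hσ : 0 < σ)

include h0 h2 hσ

theorem ae_integrable_crossedIntegrand {m : ℕ} (g : Fin (m + 2) → ℝ)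
    (r : Fin (m + 1)) {s : Finset (Fin (m + 2))} (hs : (0 : Fin (m + 2)) ∈ s) (hr : r.succ ∉ s) :
    ∀ᵐ k ∂diracSum (m + 1), Integrable (crossedIntegrand α P g k s) := by
  have h := integrable_dampedWeight_one h0 h2 α g r hs hr
    (φ := fun k => (decay k : ℂ)) (C := 1)
    (Complex.continuous_ofReal.comp (continuous_decay _)) zero_le_one
    (fun k => by rw [Complex.norm_real, Real.norm_of_nonneg (decay_nonneg k), one_mul])
    (crossedWord 0) (crossedWord_growth_le hσ g s 0)
  filter_upwards [h.prod_right_ae] with k hk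
  have hd : damping σ g k s sᶜ * decay k ≠ 0 := by
    refine mul_ne_zero (damping_pos _ _ _ _ _).ne' (Finset.prod_pos fun i _ => ?_).ne'
    positivity
  have hk' := hk.re.const_mul (damping σ g k s sᶜ * decay k)⁻¹
  refine hk'.congr (Eventually.of_forall fun h => ?_)
  simp only [← Complex.ofReal_mul, RCLike.re_eq_complex_re, Complex.ofReal_re, dampedWeight,
    wordWeight_crossedWord_zero]
  rw [mul_right_comm, inv_mul_cancel_left₀ hd, crossedIntegrand]

theorem ae_T_compl (g : Fin (n + 1) → ℝ) {s : Finset (Fin (n + 1))}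
    (hs : (0 : Fin (n + 1)) ∈ s) (hne : s ≠ Finset.univ) :
    ∀ᵐ k ∂diracSum n, Integrable (T22Integrand α P g k s sᶜ) ∧
      Integrable (T22Integrand α P g k sᶜ s) ∧
      T21 α σ P g k sᶜ s = T21 α σ P g k s sᶜ ∧ T22 α σ P g k sᶜ s = T22 α σ P g k s sᶜ := by
  obtain ⟨i, hi⟩ : ∃ i, i ∉ s := by simpa [Finset.eq_univ_iff_forall] using hne
  cases n with
  | zero => exact absurd (Fin.fin_one_eq_zero i ▸ hs) hi
  | succ m =>
    obtain ⟨r, rfl⟩ := Fin.exists_succ_eq.2 (fun h : i = 0 => hi (h ▸ hs))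
    filter_upwards [ae_diracSum_sum_eq_zero (m + 1), ae_integrable_T22Integrand h0 h2 α hσ g r hs hi,
      ae_integrable_crossedIntegrand h0 h2 α hσ g r hs hi] with k hk hT hA
    obtain ⟨h1, h2⟩ := integrable_T22Integrand_compl hk hT hA
    exact ⟨hT, h1, T21_comm α σ P g hk s, by rw [T22, T22, h2, damping_comm σ g k sᶜ s]⟩

theorem integrable_T (g : Fin (n + 1) → ℝ) {s : Finset (Fin (n + 1))}
    (hs : (0 : Fin (n + 1)) ∈ s) (hne : s ≠ Finset.univ) (φ : 𝓢(Fin (n + 1) → E3, ℂ)) :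
    Integrable (fun k => (T21 α σ P g k s sᶜ : ℂ) * φ k) (diracSum n) ∧
    Integrable (fun k => (T22 α σ P g k s sᶜ : ℂ) * φ k) (diracSum n) := by
  obtain ⟨i, hi⟩ : ∃ i, i ∉ s := by simpa [Finset.eq_univ_iff_forall] using hne
  cases n with
  | zero => exact absurd (Fin.fin_one_eq_zero i ▸ hs) hi
  | succ m =>
    obtain ⟨r, rfl⟩ := Fin.exists_succ_eq.2 (fun h : i = 0 => hi (h ▸ hs))
    obtain ⟨C, hC0, hC⟩ := exists_decay_bound φ
    exact ⟨integrable_T21 h0 h2 α hσ g r hs hi φ.continuous hC0 hC,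
      integrable_T22 h0 h2 α hσ g r hs hi φ.continuous hC0 hC⟩

/-- The limit of the contribution of a label grouping and its expansion to second order. -/
theorem exists_limit_groupingTerm (g : Fin (n + 1) → ℝ) {s : Finset (Fin (n + 1))}
    (hs : (0 : Fin (n + 1)) ∈ s) (hne : s ≠ Finset.univ) (φ : 𝓢(Fin (n + 1) → E3, ℂ)) :
    ∃ (F : ℝ → ℂ) (M : ℝ), ∀ t : ℝ, |t| ≤ amplitudeRadius α σ P →
      Tendsto (fun ε : ℝ => ∫ k, groupingTerm α σ (fun y => t * P y) g s ε k * φ k) (𝓝[>] 0)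
        (𝓝 (F t)) ∧
      ‖F t - (2 * Real.pi : ℂ) ^ 3 * (t * (∫ k, (T21 α σ P g k s sᶜ : ℂ) * φ k ∂diracSum n) +
        t ^ 2 * ∫ k, (T22 α σ P g k s sᶜ : ℂ) * φ k ∂diracSum n)‖ ≤ M * |t| ^ 3 := by
  obtain ⟨i, hi⟩ : ∃ i, i ∉ s := by simpa [Finset.eq_univ_iff_forall] using hne
  cases n with
  | zero => exact absurd (Fin.fin_one_eq_zero i ▸ hs) hi
  | succ m =>
    obtain ⟨r, rfl⟩ := Fin.exists_succ_eq.2 (fun h : i = 0 => hi (h ▸ hs))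
    obtain ⟨M, hM⟩ := exists_norm_limit_sub_le h0 h2 α hσ g r hs hi φ
    refine ⟨_, M, fun t ht => ⟨tendsto_integral_groupingTerm h0 h2 α hσ g r hs hi φ ht, ?_⟩⟩
    refine le_trans (le_of_eq ?_) (hM t ht)
    rw [singleSum_wordLimit_zero h0 h2 α hσ g r hs hi φ,
      singleSum_add_crossedSum_wordLimit h0 h2 α hσ g r hs hi φ]
    congr 2
    ring

end

/-! ### Enumeration of the label groupings -/

/-- One enumeration represents a grouping by its smaller block, the other by the block containing
label `0`. The tie rule of `labelGroupings` makes the passage bijective when the blocks have equal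
size. -/
theorem sum_labelGroupings {M : Type*} [AddCommMonoid M] {n : ℕ} {f : Finset (Fin (n + 1)) → M}
    (hf : ∀ s : Finset (Fin (n + 1)), 0 ∈ s → s ≠ Finset.univ → f sᶜ = f s) :
    ∑ m ∈ Finset.Icc 1 ((n + 1) / 2), ∑ s ∈ labelGroupings n m, f s =
      ∑ s with 0 ∈ s ∧ s ≠ Finset.univ, f s := by
  set A : Finset (Finset (Fin (n + 1))) := Finset.univ.filter fun s =>
    1 ≤ s.card ∧ 2 * s.card ≤ n + 1 ∧ (2 * s.card = n + 1 → 0 ∈ s) with hA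
  have h1 : ∑ m ∈ Finset.Icc 1 ((n + 1) / 2), ∑ s ∈ labelGroupings n m, f s = ∑ s ∈ A, f s := by
    rw [← Finset.sum_fiberwise_of_maps_to (s := A) (t := Finset.Icc 1 ((n + 1) / 2))
      (g := Finset.card) (fun s hs => by
        simp only [hA, Finset.mem_filter, Finset.mem_univ, true_and, Finset.mem_Icc] at hs ⊢
        omega)]
    refine Finset.sum_congr rfl fun m hm => Finset.sum_congr ?_ fun _ _ => rfl
    ext s
    simp only [hA, labelGroupings, Finset.mem_filter, Finset.mem_univ, true_and, Finset.mem_Icc]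
      at hm ⊢
    constructor
    · rintro ⟨rfl, h⟩
      exact ⟨⟨hm.1, by omega, h⟩, rfl⟩
    · rintro ⟨⟨-, -, h⟩, rfl⟩
      exact ⟨rfl, h⟩
  have hcard : ∀ s : Finset (Fin (n + 1)), sᶜ.card = n + 1 - s.card := fun s => by
    rw [Finset.card_compl, Fintype.card_fin]
  have hle : ∀ s : Finset (Fin (n + 1)), s.card ≤ n + 1 := fun s => by
    simpa using Finset.card_le_univ s
  have huniv : ∀ s : Finset (Fin (n + 1)), s = Finset.univ ↔ s.card = n + 1 := fun s => by
    rw [← Finset.card_eq_iff_eq_univ, Fintype.card_fin]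
  have hpos : ∀ s : Finset (Fin (n + 1)), 0 ∈ s → 1 ≤ s.card := fun s hs =>
    Finset.card_pos.2 ⟨0, hs⟩
  rw [h1]
  refine Finset.sum_nbij' (fun s => if 0 ∈ s then s else sᶜ)
    (fun s => if 2 * s.card ≤ n + 1 then s else sᶜ) ?_ ?_ ?_ ?_ ?_
  · intro s hs
    simp only [hA, Finset.mem_filter, Finset.mem_univ, true_and, ne_eq, huniv] at hs ⊢
    have := hcard s
    split_ifs with h
    · exact ⟨h, by omega⟩
    · exact ⟨by simpa using h, by omega⟩
  · intro s hs
    simp only [hA, Finset.mem_filter, Finset.mem_univ, true_and, ne_eq, huniv] at hs ⊢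
    have := hcard s
    have := hle s
    have := hpos s hs.1
    split_ifs with h
    · exact ⟨by omega, h, fun _ => hs.1⟩
    · exact ⟨by omega, by omega, fun _ => by omega⟩
  · intro s hs
    simp only [hA, Finset.mem_filter, Finset.mem_univ, true_and] at hs
    have := hcard s
    by_cases h : 0 ∈ s
    · simp [h, hs.2.1]
    -- By the tie rule a listed set without label `0` is strictly the smaller block.
    · have h' : ¬ 2 * sᶜ.card ≤ n + 1 := fun hc => h (hs.2.2 (by omega))
      simp only [h, if_false, h', compl_compl]
  · intro s hs
    simp only [Finset.mem_filter, Finset.mem_univ, true_and] at hs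
    by_cases h : 2 * s.card ≤ n + 1
    · simp [h, hs.1]
    · simp [h, hs.1]
  · intro s hs
    simp only [hA, Finset.mem_filter, Finset.mem_univ, true_and] at hs
    by_cases h : 0 ∈ s
    · simp [h]
    · simp only [h, if_false]
      have := hf sᶜ (by simpa using h) (by rw [ne_eq, huniv, hcard]; omega)
      rwa [compl_compl] at this

theorem T21_const_mul {n : ℕ} (x α σ : ℝ) (P : ℝ → ℝ) (g : Fin n → ℝ) (k : Fin n → E3)
    (s t : Finset (Fin n)) : T21 α σ (fun y => x * P y) g k s t = x * T21 α σ P g k s t := by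
  simp only [T21]
  ring

theorem T22_const_mul {n : ℕ} (x α σ : ℝ) (P : ℝ → ℝ) (g : Fin n → ℝ) (k : Fin n → E3)
    (s t : Finset (Fin n)) : T22 α σ (fun y => x * P y) g k s t = x ^ 2 * T22 α σ P g k s t := by
  have h : ∀ h, T22Integrand α (fun y => x * P y) g k s t h = x ^ 2 * T22Integrand α P g k s t h :=
    fun h => by simp only [T22Integrand]; ring
  simp only [T22, h, integral_const_mul]
  ring

section

variable {P : ℝ → ℝ} (h0 : Integrable (fun h : E3 => P ‖h‖))
  (h2 : Integrable (fun h : E3 => P ‖h‖ / ‖h‖ ^ 2)) {n : ℕ} (α : ℝ) {σ : ℝ} (hσ : 0 < σ)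
  (g : Fin (n + 1) → ℝ)

include h0 h2 hσ

theorem ae_integrable_T22Integrand_labelGroupings {m : ℕ} (hm : m ∈ Finset.Icc 1 ((n + 1) / 2))
    {s : Finset (Fin (n + 1))} (hs : s ∈ labelGroupings n m) :
    ∀ᵐ k ∂diracSum n, Integrable (T22Integrand α P g k s sᶜ) := by
  simp only [Finset.mem_Icc, labelGroupings, Finset.mem_filter, Finset.mem_univ, true_and] at hm hs
  by_cases h : 0 ∈ s
  · have hne : s ≠ Finset.univ := by
      rintro rfl
      simp only [Finset.card_univ, Fintype.card_fin] at hs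
      omega
    filter_upwards [ae_T_compl h0 h2 α hσ g h hne] with k hk using hk.1
  · have hne : sᶜ ≠ Finset.univ := by
      intro hc
      rw [Finset.compl_eq_univ_iff] at hc
      simp [hc] at hs
      omega
    filter_upwards [ae_T_compl h0 h2 α hσ g (s := sᶜ) (by simpa using h) hne] with k hk
    simpa using hk.2.1

theorem ae_groupingSum_eq (x : ℝ) : ∀ᵐ k ∂diracSum n, groupingSum α σ (fun y => x * P y) g k =
    ∑ s with 0 ∈ s ∧ s ≠ Finset.univ,
      (x * T21 α σ P g k s sᶜ + x ^ 2 * T22 α σ P g k s sᶜ) := by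
  have h : ∀ᵐ k ∂diracSum n, ∀ s : Finset (Fin (n + 1)), 0 ∈ s → s ≠ Finset.univ →
      T21 α σ P g k sᶜ s = T21 α σ P g k s sᶜ ∧ T22 α σ P g k sᶜ s = T22 α σ P g k s sᶜ := by
    refine ae_all_iff.2 fun s => ?_
    by_cases hs : 0 ∈ s ∧ s ≠ Finset.univ
    · filter_upwards [ae_T_compl h0 h2 α hσ g hs.1 hs.2] with k hk _ _ using hk.2.2
    · exact Eventually.of_forall fun k h1 h2 => absurd ⟨h1, h2⟩ hs
  filter_upwards [h] with k hk
  simp only [groupingSum, T21_const_mul, T22_const_mul]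
  refine sum_labelGroupings fun s h1 h2 => ?_
  rw [compl_compl, (hk s h1 h2).1, (hk s h1 h2).2]

theorem integrable_sum_T (x : ℝ) (φ : 𝓢(Fin (n + 1) → E3, ℂ)) :
    Integrable (fun k => (groupingSum α σ (fun y => x * P y) g k : ℂ) * φ k) (diracSum n) ∧
    ∫ k, (groupingSum α σ (fun y => x * P y) g k : ℂ) * φ k ∂diracSum n =
      ∑ s with 0 ∈ s ∧ s ≠ Finset.univ, (x * (∫ k, (T21 α σ P g k s sᶜ : ℂ) * φ k ∂diracSum n) +
        x ^ 2 * ∫ k, (T22 α σ P g k s sᶜ : ℂ) * φ k ∂diracSum n) := by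
  have hI : ∀ s ∈ Finset.univ.filter fun s : Finset (Fin (n + 1)) => 0 ∈ s ∧ s ≠ Finset.univ,
      Integrable (fun k => (x : ℂ) * ((T21 α σ P g k s sᶜ : ℂ) * φ k)) (diracSum n) ∧
      Integrable (fun k => (x : ℂ) ^ 2 * ((T22 α σ P g k s sᶜ : ℂ) * φ k)) (diracSum n) := by
    intro s hs
    obtain ⟨h1, h2⟩ := (Finset.mem_filter.1 hs).2
    obtain ⟨i1, i2⟩ := integrable_T h0 ‹_› α hσ g h1 h2 φ
    exact ⟨i1.const_mul _, i2.const_mul _⟩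
  have e : (fun k => (groupingSum α σ (fun y => x * P y) g k : ℂ) * φ k) =ᵐ[diracSum n]
      fun k => ∑ s with 0 ∈ s ∧ s ≠ Finset.univ, ((x : ℂ) * ((T21 α σ P g k s sᶜ : ℂ) * φ k) +
        (x : ℂ) ^ 2 * ((T22 α σ P g k s sᶜ : ℂ) * φ k)) := by
    filter_upwards [ae_groupingSum_eq h0 h2 α hσ g x] with k hk
    rw [hk, Complex.ofReal_sum, Finset.sum_mul]
    refine Finset.sum_congr rfl fun s _ => ?_
    push_cast
    ring
  have hS : ∀ s ∈ Finset.univ.filter fun s : Finset (Fin (n + 1)) => 0 ∈ s ∧ s ≠ Finset.univ,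
      Integrable (fun k => (x : ℂ) * ((T21 α σ P g k s sᶜ : ℂ) * φ k) +
        (x : ℂ) ^ 2 * ((T22 α σ P g k s sᶜ : ℂ) * φ k)) (diracSum n) := fun s hs =>
    (hI s hs).1.add (hI s hs).2
  refine ⟨(integrable_finsetSum _ hS).congr e.symm, ?_⟩
  rw [integral_congr_ae e, integral_finsetSum _ hS]
  refine Finset.sum_congr rfl fun s hs => ?_
  rw [integral_add (hI s hs).1 (hI s hs).2, integral_const_mul, integral_const_mul]

end

/-! ### The cumulants -/

section

variable {P : ℝ → ℝ} (h0 : Integrable (fun h : E3 => P ‖h‖))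
  (h2 : Integrable (fun h : E3 => P ‖h‖ / ‖h‖ ^ 2)) (hz : P 0 = 0)
  (hc : ContinuousWithinAt P (Set.Ici 0) 0) {n : ℕ} (ρbar α : ℝ) {σ : ℝ} (hσ : 0 < σ)
  (g : Fin (n + 1) → ℝ)

include h0 h2 in
theorem regularizedCumulant_mul_eq {ε : ℝ} (hε : 0 < ε) (hσ : 0 < σ) (x : ℝ)
    (φ : (Fin (n + 1) → E3) → ℂ) (k : Fin (n + 1) → E3) :
    regularizedCumulant 2 ρbar α σ (fun y => x * P y) g ε k * φ k =
      (ρbar : ℂ) ^ 2 * ∑ s with 0 ∈ s, groupingTerm α σ (fun y => x * P y) g s ε k * φ k := by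
  rw [regularizedCumulant_two_eq_sum (h0.const_mul x)
    (by simpa only [mul_div_assoc] using h2.const_mul x) ρbar α hσ g hε k, mul_assoc, Finset.sum_mul]

include h0 h2 hz hc hσ

theorem exists_freeDensityCumulant : ∃ G : ℝ → 𝓢(Fin (n + 1) → E3, ℂ) → ℂ,
    (∀ x : ℝ, |x| ≤ amplitudeRadius α σ P →
      IsFreeDensityCumulant 2 ρbar α σ (fun y => x * P y) g (G x)) ∧
    ∀ φ : 𝓢(Fin (n + 1) → E3, ℂ), ∃ M : ℝ, ∀ x : ℝ, |x| ≤ amplitudeRadius α σ P →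
      ‖G x φ - (ρbar : ℂ) ^ 2 * (2 * Real.pi : ℂ) ^ 3 *
        ∫ k, (groupingSum α σ (fun y => x * P y) g k : ℂ) * φ k ∂diracSum n‖ ≤ M * |x| ^ 3 := by
  have hF : ∀ (s : Finset (Fin (n + 1))) (φ : 𝓢(Fin (n + 1) → E3, ℂ)), ∃ (F : ℝ → ℂ) (M : ℝ),
      0 ∈ s ∧ s ≠ Finset.univ → ∀ t : ℝ, |t| ≤ amplitudeRadius α σ P →
      Tendsto (fun ε : ℝ => ∫ k, groupingTerm α σ (fun y => t * P y) g s ε k * φ k) (𝓝[>] 0)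
        (𝓝 (F t)) ∧
      ‖F t - (2 * Real.pi : ℂ) ^ 3 * (t * (∫ k, (T21 α σ P g k s sᶜ : ℂ) * φ k ∂diracSum n) +
        t ^ 2 * ∫ k, (T22 α σ P g k s sᶜ : ℂ) * φ k ∂diracSum n)‖ ≤ M * |t| ^ 3 := by
    intro s φ
    by_cases hs : 0 ∈ s ∧ s ≠ Finset.univ
    · obtain ⟨F, M, h⟩ := exists_limit_groupingTerm h0 h2 α hσ g hs.1 hs.2 φ
      exact ⟨F, M, fun _ => h⟩
    -- Dummy values for the sets outside the sum, so that the choice is defined on all label sets.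
    · exact ⟨0, 0, fun h => absurd h hs⟩
  choose F M hFM using hF
  have hsum : ∀ f : Finset (Fin (n + 1)) → ℂ, ∑ s with 0 ∈ s, f s =
      f Finset.univ + ∑ s with 0 ∈ s ∧ s ≠ Finset.univ, f s := by
    intro f
    rw [Finset.sum_eq_add_sum_sdiff_singleton_of_mem (i := Finset.univ) (by simp)]
    congr 1
    refine Finset.sum_congr ?_ fun _ _ => rfl
    ext s
    simp
  refine ⟨fun x φ => (ρbar : ℂ) ^ 2 * ∑ s with 0 ∈ s ∧ s ≠ Finset.univ, F s φ x,
    fun x hx φ => ⟨fun ε hε => ?_, ?_⟩, fun φ => ?_⟩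
  · simp only [regularizedCumulant_mul_eq h0 h2 ρbar α g hε hσ]
    exact (integrable_finsetSum _ fun s _ =>
      (hasSum_integral_groupingTerm h0 h2 α hσ g s φ hx hε).1).const_mul _
  · have hu : Tendsto (fun ε : ℝ => ∫ k, groupingTerm α σ (fun y => x * P y) g Finset.univ ε k * φ k)
        (𝓝[>] 0) (𝓝 0) :=
      tendsto_integral_groupingTerm_univ (h0.const_mul x)
        (by simpa only [mul_div_assoc] using h2.const_mul x) α hσ g φ (by simp [hz])
        (continuousWithinAt_const.mul hc)
    have hs := hu.add (tendsto_finsetSum (Finset.univ.filter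
      fun s : Finset (Fin (n + 1)) => 0 ∈ s ∧ s ≠ Finset.univ)
      fun s hs => (hFM s φ (Finset.mem_filter.1 hs).2 x hx).1)
    rw [zero_add] at hs
    refine (hs.const_mul ((ρbar : ℂ) ^ 2)).congr' (eventually_nhdsWithin_of_forall fun ε hε => ?_)
    simp only [regularizedCumulant_mul_eq h0 h2 ρbar α g hε hσ]
    rw [integral_const_mul, integral_finsetSum _ fun s _ =>
      (hasSum_integral_groupingTerm h0 h2 α hσ g s φ hx hε).1, hsum]
  · refine ⟨‖(ρbar : ℂ) ^ 2‖ * ∑ s with 0 ∈ s ∧ s ≠ Finset.univ, M s φ, fun x hx => ?_⟩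
    rw [(integrable_sum_T h0 h2 α hσ g x φ).2, mul_assoc, ← mul_sub, Finset.mul_sum,
      ← Finset.sum_sub_distrib, norm_mul, mul_assoc, Finset.sum_mul]
    gcongr
    exact (norm_sum_le _ _).trans (Finset.sum_le_sum fun s hs =>
      (hFM s φ (Finset.mem_filter.1 hs).2 x hx).2)

omit h0 h2 hz hc hσ in
theorem eventually_abs_le_amplitudeRadius (α σ : ℝ) (P : ℝ → ℝ) :
    ∀ᶠ x in 𝓝 (0 : ℝ), |x| ≤ amplitudeRadius α σ P := by
  filter_upwards [Metric.closedBall_mem_nhds (0 : ℝ) (amplitudeRadius_pos α σ P)] with x hx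
  simpa using hx

/-- The cumulant is a limit, hence unique, so any family agrees near `x = 0` with the constructed
one. -/
theorem freeDensityCumulant_isBigO {G : ℝ → 𝓢(Fin (n + 1) → E3, ℂ) → ℂ}
    (hG : ∀ᶠ x in 𝓝 (0 : ℝ), IsFreeDensityCumulant 2 ρbar α σ (fun y => x * P y) g (G x))
    (φ : 𝓢(Fin (n + 1) → E3, ℂ)) :
    (fun x : ℝ => G x φ - (ρbar : ℂ) ^ 2 * (2 * Real.pi : ℂ) ^ 3 *
      ∫ k, (groupingSum α σ (fun y => x * P y) g k : ℂ) * φ k ∂(diracSum n))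
      =O[𝓝 0] fun x : ℝ => x ^ 3 := by
  obtain ⟨G', hG', hM⟩ := exists_freeDensityCumulant h0 h2 hz hc ρbar α hσ g
  obtain ⟨M, hM⟩ := hM φ
  refine IsBigO.of_bound M ?_
  filter_upwards [hG, eventually_abs_le_amplitudeRadius α σ P] with x hx hr
  rw [tendsto_nhds_unique (hx φ).2 (hG' x hr φ).2, Real.norm_eq_abs, abs_pow]
  exact hM x hr

end

/-! ### The two-point cumulant -/

section TwoPoint

theorem labelSum_pair_zero (k : E3) : labelSum ![k, -k] {0} = k := by simp [labelSum]

theorem labelSum_pair_one (k : E3) : labelSum ![k, -k] {1} = -k := by simp [labelSum]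

theorem weightedLabelSum_pair_zero (g : Fin 2 → ℝ) (k : E3) :
    weightedLabelSum g ![k, -k] {0} = g 0 • k := by simp [weightedLabelSum]

theorem weightedLabelSum_pair_one (g : Fin 2 → ℝ) (k : E3) :
    weightedLabelSum g ![k, -k] {1} = -(g 1 • k) := by simp [weightedLabelSum]

theorem damping_pair (σ : ℝ) (g : Fin 2 → ℝ) (k : E3) : damping σ g ![k, -k] {0} {1} =
    Real.exp (-(σ ^ 2 / 2) * ‖k‖ ^ 2 * (g 0 ^ 2 + g 1 ^ 2)) := by
  rw [damping, weightedLabelSum_pair_zero, weightedLabelSum_pair_one, norm_neg, norm_smul, norm_smul,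
    mul_pow, mul_pow, Real.norm_eq_abs, Real.norm_eq_abs, sq_abs, sq_abs]
  congr 1
  ring

/-- At `k = 0` the quotients by `‖k‖²` are `0` by convention and do not cancel to `g`; both sides
agree there because `P 0 = 0`. -/
theorem T21_pair {P : ℝ → ℝ} (hz : P 0 = 0) (α σ : ℝ) (g : Fin 2 → ℝ) (k : E3) :
    T21 α σ P g ![k, -k] {0} {1} = linearSpectrum α σ P (g 0) (g 1) k := by
  rcases eq_or_ne k 0 with rfl | hk
  · simp only [T21, linearSpectrum, labelSum_pair_zero, norm_zero, hz, mul_zero, zero_mul]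
  have hk' : ‖k‖ ^ 2 ≠ 0 := by simpa using hk
  simp only [T21, linearSpectrum, damping_pair, labelSum_pair_zero, labelSum_pair_one,
    weightedLabelSum_pair_zero, weightedLabelSum_pair_one, inner_neg_left, inner_neg_right,
    real_inner_smul_left, real_inner_smul_right, real_inner_self_eq_norm_sq, norm_neg]
  field_simp
  ring

theorem T22Integrand_pair (α : ℝ) (P : ℝ → ℝ) (g : Fin 2 → ℝ) (k h : E3) :
    T22Integrand α P g ![k, -k] {0} {1} h = modeCouplingIntegrand α P (g 0) (g 1) k h := by
  simp only [T22Integrand, modeCouplingIntegrand, labelSum_pair_zero,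
    weightedLabelSum_pair_zero, weightedLabelSum_pair_one, inner_neg_left, real_inner_smul_left]
  ring

theorem T22_pair (α σ : ℝ) (P : ℝ → ℝ) (g : Fin 2 → ℝ) (k : E3) :
    T22 α σ P g ![k, -k] {0} {1} = modeCoupling α σ P (g 0) (g 1) k := by
  simp only [T22, modeCoupling, damping_pair, T22Integrand_pair]

theorem cons_neg_sum_const_neg (k : E3) :
    (Fin.cons (-∑ _i : Fin 1, -k) (fun _ => -k) : Fin 2 → E3) = ![k, -k] := by
  funext i
  fin_cases i <;> simp

/-- `diracSum 1` is parametrized by the wave vector of the second label, here `-k`, and reflection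
preserves volume. -/
theorem measurePreserving_pair :
    MeasurePreserving (fun k : E3 => (![k, -k] : Fin 2 → E3)) volume (diracSum 1) := by
  have h := (measurePreserving_cons_neg_sum 1).comp
    (measurePreserving_const_fin_one.comp (Measure.measurePreserving_neg (volume : Measure E3)))
  simpa only [Function.comp_def, cons_neg_sum_const_neg] using h

theorem measurableEmbedding_pair : MeasurableEmbedding fun k : E3 => (![k, -k] : Fin 2 → E3) := by
  have h : Continuous fun k : E3 => (![k, -k] : Fin 2 → E3) := by fun_prop
  exact h.measurableEmbedding fun _ _ h => by simpa using congrFun h 0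

theorem labelGroupings_one_one : labelGroupings 1 1 = {{0}} := by decide

theorem compl_zero_fin_two : ({0} : Finset (Fin 2))ᶜ = {1} := by decide

theorem groupingSum_pair {P : ℝ → ℝ} (hz : P 0 = 0) (x α σ : ℝ) (g : Fin 2 → ℝ) (k : E3) :
    groupingSum α σ (fun y => x * P y) g ![k, -k] =
      x * linearSpectrum α σ P (g 0) (g 1) k + x ^ 2 * modeCoupling α σ P (g 0) (g 1) k := by
  have h : Finset.Icc 1 ((1 + 1) / 2) = {1} := by decide
  rw [groupingSum, h, Finset.sum_singleton, labelGroupings_one_one, Finset.sum_singleton,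
    compl_zero_fin_two, T21_const_mul, T22_const_mul, T21_pair hz, T22_pair]

end TwoPoint
end

theorem mainTheorem6
    (P₀ : ℝ → ℝ) (ρbar α σ : ℝ) (hσ : 0 < σ)
    (hP_zero : P₀ 0 = 0)
    (hP_cont : ContinuousWithinAt P₀ (Set.Ici 0) 0)
    (hP_int : Integrable (fun h : E3 => P₀ ‖h‖))
    (hP_int_two : Integrable (fun h : E3 => P₀ ‖h‖ / ‖h‖ ^ 2)) :
    -- the general `(n + 1)`-point cumulant, for the power spectrum `x P₀` as `x → 0`
    (∀ (n : ℕ) (g : Fin (n + 1) → ℝ),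
      (∃ G : ℝ → 𝓢(Fin (n + 1) → E3, ℂ) → ℂ,
        ∀ᶠ x in 𝓝 (0 : ℝ), IsFreeDensityCumulant 2 ρbar α σ (fun y => x * P₀ y) g (G x)) ∧
      (∀ m ∈ Finset.Icc 1 ((n + 1) / 2), ∀ s ∈ labelGroupings n m,
        ∀ᵐ k ∂(diracSum n), Integrable (T22Integrand α P₀ g k s sᶜ)) ∧
      (∀ (x : ℝ) (φ : 𝓢(Fin (n + 1) → E3, ℂ)),
        Integrable (fun k => (groupingSum α σ (fun y => x * P₀ y) g k : ℂ) * φ k) (diracSum n)) ∧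
      (∀ G : ℝ → 𝓢(Fin (n + 1) → E3, ℂ) → ℂ,
        (∀ᶠ x in 𝓝 (0 : ℝ), IsFreeDensityCumulant 2 ρbar α σ (fun y => x * P₀ y) g (G x)) →
        ∀ φ : 𝓢(Fin (n + 1) → E3, ℂ),
          (fun x : ℝ => G x φ - (ρbar : ℂ) ^ 2 * (2 * Real.pi : ℂ) ^ 3 *
            ∫ k, (groupingSum α σ (fun y => x * P₀ y) g k : ℂ) * φ k ∂(diracSum n))
          =O[𝓝 0] fun x : ℝ => x ^ 3)) ∧
    -- the two-point cumulant
    (∀ g : Fin 2 → ℝ,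
      (∀ k : E3, T21 α σ P₀ g ![k, -k] {0} {1} = linearSpectrum α σ P₀ (g 0) (g 1) k) ∧
      (∀ k : E3, T22 α σ P₀ g ![k, -k] {0} {1} = modeCoupling α σ P₀ (g 0) (g 1) k) ∧
      (∀ᵐ k : E3, Integrable (modeCouplingIntegrand α P₀ (g 0) (g 1) k)) ∧
      (∀ G : ℝ → 𝓢(Fin 2 → E3, ℂ) → ℂ,
        (∀ᶠ x in 𝓝 (0 : ℝ), IsFreeDensityCumulant 2 ρbar α σ (fun y => x * P₀ y) g (G x)) →
        ∀ φ : 𝓢(Fin 2 → E3, ℂ),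
          (fun x : ℝ => G x φ - (ρbar : ℂ) ^ 2 * (2 * Real.pi : ℂ) ^ 3 *
            ∫ k : E3, ((x * linearSpectrum α σ P₀ (g 0) (g 1) k
              + x ^ 2 * modeCoupling α σ P₀ (g 0) (g 1) k : ℝ) : ℂ) * φ ![k, -k])
          =O[𝓝 0] fun x : ℝ => x ^ 3)) := by
  refine ⟨fun n g => ⟨?_, fun m hm s hs => ?_, fun x φ => ?_, fun G hG φ => ?_⟩, fun g =>
    ⟨T21_pair hP_zero α σ g, T22_pair α σ P₀ g, ?_, fun G hG φ => ?_⟩⟩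
  · obtain ⟨G, hG, -⟩ := exists_freeDensityCumulant hP_int hP_int_two hP_zero hP_cont ρbar α hσ g
    exact ⟨G, (eventually_abs_le_amplitudeRadius α σ P₀).mono hG⟩
  · exact ae_integrable_T22Integrand_labelGroupings hP_int hP_int_two α hσ g hm hs
  · exact (integrable_sum_T hP_int hP_int_two α hσ g x φ).1
  · exact freeDensityCumulant_isBigO hP_int hP_int_two hP_zero hP_cont ρbar α hσ g hG φ
  · have h := ae_integrable_T22Integrand_labelGroupings hP_int hP_int_two α hσ g (n := 1) (m := 1)
      (s := {0}) (by decide) (by decide)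
    -- Almost-everywhere statements on wave vectors with zero sum pull back along `k ↦ (k, -k)`.
    filter_upwards [measurePreserving_pair.quasiMeasurePreserving.ae h] with k hk
    rw [compl_zero_fin_two] at hk
    exact hk.congr (Eventually.of_forall fun h => T22Integrand_pair α P₀ g k h)
  · have h := freeDensityCumulant_isBigO hP_int hP_int_two hP_zero hP_cont ρbar α hσ g hG φ
    simp only [← measurePreserving_pair.integral_comp measurableEmbedding_pair,
      groupingSum_pair hP_zero] at h
    exact h
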